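/- **Theorem (Improved gate cost for $G$).** Let $N\ge 1$, $m\ge 2$ be integers and $\mu,x\in\mathbb R$. Consider the single-flavour 1+1D lattice Schwinger model with $N$ sites (one qubit each) and $N-1$ gauge links (links $n=1,\dots,N-1$ joining sites $n$ and $n+1$; $m$ qubits each), with Hamiltonian $$H=\sum_{n=1}^{N-1}L^2(n)+\sum_{n=1}^{N}(-1)^n\Big(\frac{\mu}{2}+\frac{\mu}{2}\sigma_3(n)\Big)+x\sum_{n=1}^{N-1}\Big(\sigma^+(n)\,e^{i\theta(n)}\,\sigma^-(n+1)+\text{h.c.}\Big),$$ where $\sigma_3(n)$ and $\sigma^{\pm}(n)=\frac12(\sigma_1(n)\pm i\sigma_2(n))$ act on site $n$ and the gauge operators are truncated to $\Lambda=2^m$ levels in binary encoding: $L^2=\sum_{l=0}^{\Lambda-1}(l-\Lambda/2)^2|l\rangle\langle l|$ and $e^{i\theta}=\sum_{l=0}^{\Lambda-1}|l+1\rangle\langle l|$ with $|\Lambda\rangle=|0\rangle$. Assume $H\ne0$ (automatic if $N\ge2$). Let $n_q=N+m(N-1)$ and let $H=\sum_{\vec x,\vec z\in\{0,1\}^{n_q}}\alpha_{\vec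 x,\vec z}\,P(\vec x,\vec z)$ be the Pauli decomposition of $H$, with $P(\vec x,\vec z)=\bigotimes_j i^{x_jz_j}X^{x_j}Z^{z_j}$. The block-encoding state of the linear combination of unitaries is $$|G\rangle=\sum_{\vec x,\vec z}\sqrt{\frac{|\alpha_{\vec x,\vec z}|}{\sum_{\vec x',\vec z'}|\alpha_{\vec x',\vec z'}|}}\;|\vec x,\vec z\rangle .$$ Write $F_k=\frac{1}{\sqrt5}\big(\phi^{k}-(-\phi)^{-k}\big)$, where $\phi$ is the golden ratio. Then there is a circuit of CNOT gates, $T$ gates, $R_z$ rotations and (an unspecified number of) single-qubit Clifford gates, on $2n_q=2N+2m(N-1)$ register qubits and $m$ ancilla qubits, that maps $|0\cdots0\rangle|0^m\rangle$ to $|G\rangle|0^m\rangle$ and satisfies $$\#T\le 56-16m+8mF_{m+5}-8F_{m+6}-16\cdot2^m+4N+4m2^m+8Nm,$$ $$\#\mathrm{CNOT}\le 54-22m-2F_{m+5}-8F_{m+6}+8mF_{m+5}-14\cdot2^m+25N+4m2^m+11Nm,$$ $$\#R_z\le -48+12F_{m+5}+12\cdot2^m+6N .$$ Moreover there is an absolute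 constant $K$ such that, whenever $2\le m\le\lceil\log_2N+1\rceil$, this circuit also satisfies $\#T+\#\mathrm{CNOT}+\#R_z\le K\,N\log N$. -/

import Mathlib

noncomputable section

namespace Schwinger

/-! ### Qubits, operators and states

The computational basis of a register with qubits labelled by `ι` is `ι → Fin 2`. -/

/-- Linear operators on a register of qubits labelled by `ι`, as matrices in the computational
basis. -/
abbrev Op (ι : Type) : Type := Matrix (ι → Fin 2) (ι → Fin 2) ℂ

/-- State vectors of a register of qubits labelled by `ι`. -/
abbrev State (ι : Type) : Type := (ι → Fin 2) → ℂ

open Classical in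
/-- The operator `A` on qubits labelled by `κ`, applied to the qubits `e k` of a larger register
(`e` injective), tensored with the identity on all other qubits. -/
def liftOp {κ ι : Type} (e : κ → ι) (A : Op κ) : Op ι :=
  Matrix.of fun b c => if ∀ j, j ∉ Set.range e → b j = c j then A (b ∘ e) (c ∘ e) else 0

open Classical in
/-- The single-qubit operator `A` applied to qubit `i`, tensored with the identity elsewhere. -/
def onQubit {ι : Type} (i : ι) (A : Matrix (Fin 2) (Fin 2) ℂ) : Op ι :=
  Matrix.of fun b c => if ∀ j, j ≠ i → b j = c j then A (b i) (c i) else 0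

/-- The tensor product of one single-qubit operator for every qubit. -/
def tensorOp {ι : Type} [Fintype ι] (A : ι → Matrix (Fin 2) (Fin 2) ℂ) : Op ι :=
  Matrix.of fun b c => ∏ j, A j (b j) (c j)

/-! ### Pauli operators and their binary representation -/

def pauliX : Matrix (Fin 2) (Fin 2) ℂ := !![0, 1; 1, 0]
def pauliY : Matrix (Fin 2) (Fin 2) ℂ := !![0, -Complex.I; Complex.I, 0]
def pauliZ : Matrix (Fin 2) (Fin 2) ℂ := !![1, 0; 0, -1]

/-- `σ⁺ = (σ₁ + i σ₂) / 2`. -/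
def sigmaPlus : Matrix (Fin 2) (Fin 2) ℂ := (1 / 2 : ℂ) • (pauliX + Complex.I • pauliY)

/-- `σ⁻ = (σ₁ - i σ₂) / 2`. -/
def sigmaMinus : Matrix (Fin 2) (Fin 2) ℂ := (1 / 2 : ℂ) • (pauliX - Complex.I • pauliY)

/-- The Pauli string `P(x, z) = ⨂ⱼ i^(xⱼ zⱼ) X^(xⱼ) Z^(zⱼ)` with binary representation `(x, z)`. -/
def pauliString {ι : Type} [Fintype ι] (x z : ι → Fin 2) : Op ι :=
  tensorOp fun j =>
    Complex.I ^ ((x j : ℕ) * (z j : ℕ)) • (pauliX ^ (x j : ℕ) * pauliZ ^ (z j : ℕ))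

/-- The coefficient of `P(x, z)` in the (unique) expansion of the operator `A` in Pauli strings. -/
def pauliCoeff {ι : Type} [Fintype ι] [DecidableEq ι] (A : Op ι) (x z : ι → Fin 2) : ℂ :=
  (pauliString x z * A).trace / 2 ^ Fintype.card ι

/-- The sum of the absolute values of all Pauli coefficients. -/
def pauliNorm {ι : Type} [Fintype ι] [DecidableEq ι] (A : Op ι) : ℝ :=
  ∑ x : ι → Fin 2, ∑ z : ι → Fin 2, ‖pauliCoeff A x z‖

/-- The block-encoding state `∑ √(|α(x, z)| / ∑ |α|) |x, z⟩` of the linear combination of unitaries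
`A = ∑ α(x, z) P(x, z)`. Its register has an `x` qubit `Sum.inl i` and a `z` qubit `Sum.inr i`
for each qubit `i` that `A` acts on. -/
def lcuState {ι : Type} [Fintype ι] [DecidableEq ι] (A : Op ι) : State (ι ⊕ ι) :=
  fun b => (Real.sqrt (‖pauliCoeff A (b ∘ Sum.inl) (b ∘ Sum.inr)‖ / pauliNorm A) : ℂ)

/-! ### The truncated lattice Schwinger Hamiltonian -/

/-- The qubits of the model: one for each of the `N` sites and `m` for each of the `N - 1` links. -/
abbrev SysQubit (N m : ℕ) : Type := Fin N ⊕ (Fin (N - 1) × Fin m)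

/-- The qubits of the block-encoding state. -/
abbrev RegQubit (N m : ℕ) : Type := SysQubit N m ⊕ SysQubit N m

/-- The integer `0 ≤ l < 2 ^ m` with binary digits `b` (digit `0` least significant). -/
def linkValue {m : ℕ} (b : Fin m → Fin 2) : ℕ := ∑ j, (b j : ℕ) * 2 ^ (j : ℕ)

/-- `L² = ∑ (l - Λ / 2)² |l⟩⟨l|` with `Λ = 2 ^ m`. -/
def fieldSq (m : ℕ) : Op (Fin m) :=
  Matrix.diagonal fun b => ((linkValue b : ℂ) - 2 ^ m / 2) ^ 2

/-- The raising operator `e^(iθ) = ∑ |l + 1⟩⟨l|`, with `l + 1` taken modulo `2 ^ m`. -/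
def raising (m : ℕ) : Op (Fin m) :=
  Matrix.of fun b c => if linkValue b ≡ linkValue c + 1 [MOD 2 ^ m] then 1 else 0

/-- An operator of the gauge field on link `n`. -/
def onLink {N m : ℕ} (n : Fin (N - 1)) (A : Op (Fin m)) : Op (SysQubit N m) :=
  liftOp (fun j : Fin m => Sum.inr (n, j)) A

/-- An operator on the spin of site `n`. -/
def onSite {N m : ℕ} (n : Fin N) (A : Matrix (Fin 2) (Fin 2) ℂ) : Op (SysQubit N m) :=
  onQubit (Sum.inl n) A

/-- The left and right end of a link. -/
def leftSite {N : ℕ} (n : Fin (N - 1)) : Fin N := ⟨n, by omega⟩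
def rightSite {N : ℕ} (n : Fin (N - 1)) : Fin N := ⟨n + 1, by omega⟩

/-- `H₀ = ∑_{links} L²(n) + ∑_{n = 1}^N (-1)^n (μ/2 + μ/2 σ₃(n))`; site `n : Fin N` has the
number `n + 1`. -/
def freeHamiltonian (N m : ℕ) (μ : ℝ) : Op (SysQubit N m) :=
  ∑ n : Fin (N - 1), onLink n (fieldSq m) +
    ∑ n : Fin N, (-1 : ℂ) ^ ((n : ℕ) + 1) •
      ((μ / 2 : ℂ) • (1 : Op (SysQubit N m)) + (μ / 2 : ℂ) • onSite n pauliZ)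

/-- `σ⁺(n) e^(iθ(n)) σ⁻(n + 1)`. -/
def hopping {N m : ℕ} (n : Fin (N - 1)) : Op (SysQubit N m) :=
  onSite (leftSite n) sigmaPlus * onLink n (raising m) * onSite (rightSite n) sigmaMinus

/-- `V = ∑_{links} (σ⁺(n) e^(iθ(n)) σ⁻(n + 1) + h.c.)`. -/
def interaction (N m : ℕ) : Op (SysQubit N m) :=
  ∑ n : Fin (N - 1), (hopping n + (hopping n).conjTranspose)

/-- The Hamiltonian `H = H₀ + x V`. -/
def hamiltonian (N m : ℕ) (μ x : ℝ) : Op (SysQubit N m) :=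
  freeHamiltonian N m μ + (x : ℂ) • interaction N m

/-! ### Circuits -/

/-- Elementary gates. The single-qubit gates `H` and `S` generate the single-qubit Clifford group;
in particular `S ^ 3` is the inverse of `S`, and the inverse of `T` is a product of one `T` and
three `S`. -/
inductive Gate (ι : Type) : Type
  | H (i : ι) : Gate ι
  | S (i : ι) : Gate ι
  | T (i : ι) : Gate ι
  | Rz (θ : ℝ) (i : ι) : Gate ι
  | CNOT (control target : ι) (h : control ≠ target) : Gate ι

namespace Gate

def hadamard : Matrix (Fin 2) (Fin 2) ℂ := ((Real.sqrt 2 : ℂ)⁻¹) • !![1, 1; 1, -1]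

/-- The diagonal single-qubit operator with diagonal `a, d`. -/
def diag2 (a d : ℂ) : Matrix (Fin 2) (Fin 2) ℂ := !![a, 0; 0, d]

open Classical in
/-- `|b⟩ ↦ |b'⟩`, where `b'` is `b` with the control bit added to the target bit modulo `2`. -/
def cnotOp {ι : Type} (control target : ι) : Op ι :=
  Matrix.of fun b c =>
    if b = Function.update c target (c target + c control) then 1 else 0

/-- The unitary matrix of a gate. -/
def toOp {ι : Type} : Gate ι → Op ι
  | H i => onQubit i hadamard
  | S i => onQubit i (diag2 1 Complex.I)
  | T i => onQubit i (diag2 1 (Complex.exp (Complex.I * Real.pi / 4)))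
  | Rz θ i => onQubit i
      (diag2 (Complex.exp (-(Complex.I * θ / 2))) (Complex.exp (Complex.I * θ / 2)))
  | CNOT c t _ => cnotOp c t

def isT {ι : Type} : Gate ι → Bool
  | T _ => true
  | _ => false

def isRz {ι : Type} : Gate ι → Bool
  | Rz _ _ => true
  | _ => false

def isCNOT {ι : Type} : Gate ι → Bool
  | CNOT _ _ _ => true
  | _ => false

end Gate

/-- A circuit: a list of gates, the first one applied first. -/
abbrev Circuit (ι : Type) : Type := List (Gate ι)

namespace Circuit

/-- Apply the circuit to a state. -/
def run {ι : Type} [Fintype ι] [DecidableEq ι] (C : Circuit ι) (ψ : State ι) : State ι :=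
  C.foldl (fun φ g => g.toOp.mulVec φ) ψ

def numT {ι : Type} (C : Circuit ι) : ℕ := C.countP Gate.isT
def numRz {ι : Type} (C : Circuit ι) : ℕ := C.countP Gate.isRz
def numCNOT {ι : Type} (C : Circuit ι) : ℕ := C.countP Gate.isCNOT

end Circuit

/-- The state `|0 … 0⟩`. -/
def zeroState (ι : Type) [Fintype ι] : State ι := fun b => if b = 0 then 1 else 0

/-- The state `ψ ⊗ |0 … 0⟩` of a register `ι` together with ancillas `κ`. -/
def withZeroAncillas {ι : Type} (κ : Type) [Fintype κ] (ψ : State ι) : State (ι ⊕ κ) :=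
  fun b => ψ (b ∘ Sum.inl) * zeroState κ (b ∘ Sum.inr)

/-- The circuit maps `|0 … 0⟩ ⊗ |0 … 0⟩` to `ψ ⊗ |0 … 0⟩`: it prepares `ψ` on the register `ι` and
returns all ancillas `κ` to `|0⟩`. -/
def Prepares {ι κ : Type} [Fintype ι] [DecidableEq ι] [Fintype κ] [DecidableEq κ]
    (C : Circuit (ι ⊕ κ)) (ψ : State ι) : Prop :=
  C.run (zeroState (ι ⊕ κ)) = withZeroAncillas κ ψ

/-- `(φ^k - (-φ)^(-k)) / √5`, with `φ` the golden ratio. -/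
def binet (k : ℕ) : ℝ :=
  (Real.goldenRatio ^ k - (-Real.goldenRatio) ^ (-(k : ℤ))) / Real.sqrt 5

end Schwinger

end

noncomputable section

namespace Schwinger

/-! The Hamiltonian is cut into a multiple of the identity and one operator for each register qubit
`q` (`hamiltonian_eq_sum`). The cut is chosen so that one fixed circuit `links` sends each
single-excitation string `|q⟩` to a state with nonnegative amplitudes, whose squares are
proportional to the absolute Pauli coefficients of the `q`-th piece (`encodes_leafOp`), and fixes
the zero string, which stands for the identity. It therefore suffices to prepare a one-hot
superposition, with the total weights of the pieces as probabilities, and then to run `links`.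
Circuits preserve inner products, and orthogonal states with nonnegative amplitudes have disjoint
supports. So no Pauli string is shared by two pieces, nothing cancels, and the sum is the
block-encoding state; its normalisation is forced by unitarity (`superposition_eq_lcuState`).

Field energy: with `Z_k = ±1`, the shifted level is `-(1 + ∑ 2^k Z_k) / 2`. In its square, the terms
with highest bit `k` have coefficients `2^k / 2` (alone) and `2^(k+j) / 2` (with `j < k`), of total
`4^k / 2`. The relative weights `2^(-k)` and `2^(j-k)` are those of fair coins tossed at the bits
`k-1, k-2, …` until the first success, which `scan` performs.

Hopping: adding one is a sum over the length of the carry, each term a product of `σ⁺` and `σ⁻`,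
with `X` at the top bit because of the wrap-around. Such a product on `c` qubits plus its adjoint
contains exactly the strings of `X` and `Y` with an even number of `Y`, each with absolute
coefficient `2^(1-c)` (`norm_pauliCoeff_ladder`). CNOT gates write the flipped bits, and controlled
Hadamards with a parity qubit produce the even superposition (`run_parityHads_evenState`).

All these amplitudes are powers of `1/√2`, so `links` needs only controlled Hadamards, of two T
gates and one CNOT each. Rotations are needed only for the one-hot state. Its weights fall into
groups of equal value, and a group of `l` qubits is filled by repeated doubling with at most `2 *
Nat.size l` rotations (`exists_spread`). This gives at most `8m(N-1) + 2N` T gates, `11m(N-1) + 3N`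
CNOTs and order `m log N` rotations, which lie below the claimed Fibonacci expressions. -/

theorem fin_two_eq (a : Fin 2) : a = 0 ∨ a = 1 := by omega

/-! ### Action of gates and circuits on amplitudes -/

section Gates

variable {ι : Type} [Fintype ι] [DecidableEq ι]

theorem onQubit_mulVec (i : ι) (A : Matrix (Fin 2) (Fin 2) ℂ) (ψ : State ι) (b : ι → Fin 2) :
    (onQubit i A).mulVec ψ b = ∑ v, A (b i) v * ψ (Function.update b i v) := by
  have h : ∀ c : ι → Fin 2, (onQubit i A) b c * ψ c =
      ∑ v, if c = Function.update b i v then A (b i) v * ψ c else 0 := by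
    intro c
    rw [Finset.sum_eq_single (c i)]
    · by_cases hc : ∀ j, j ≠ i → b j = c j
      · have : c = Function.update b i (c i) := by
          ext j
          by_cases hj : j = i
          · subst hj; simp
          · simp [hj, hc j hj]
        rw [if_pos this]
        simp only [onQubit, Matrix.of_apply]
        rw [if_pos hc]
      · have : c ≠ Function.update b i (c i) := by
          intro h
          apply hc
          intro j hj
          rw [h]; simp [hj]
        rw [if_neg this]
        simp only [onQubit, Matrix.of_apply]
        rw [if_neg hc, zero_mul]
    · intro v _ hv
      rw [if_neg]
      intro h
      apply hv
      rw [h]; simp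
    · simp
  simp only [Matrix.mulVec, dotProduct]
  rw [Finset.sum_congr rfl fun c _ => h c, Finset.sum_comm]
  simp

theorem cnotOp_mulVec {c t : ι} (h : c ≠ t) (ψ : State ι) (b : ι → Fin 2) :
    (Gate.cnotOp c t).mulVec ψ b = ψ (Function.update b t (b t + b c)) := by
  have key : ∀ d : ι → Fin 2, b = Function.update d t (d t + d c) ↔
      d = Function.update b t (b t + b c) := by
    have inv : ∀ d : ι → Fin 2, Function.update (Function.update d t (d t + d c)) t
        ((Function.update d t (d t + d c)) t + (Function.update d t (d t + d c)) c) = d := by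
      intro d
      simp only [Function.update_self, Function.update_of_ne h, Function.update_idem]
      have : d t + d c + d c = d t := by
        rcases fin_two_eq (d c) with h | h <;> rcases fin_two_eq (d t) with h' | h' <;> simp [h, h']
      rw [this]; simp
    intro d
    constructor
    · intro h; rw [h, inv]
    · intro h; rw [h, inv]
  have entry : ∀ d : ι → Fin 2, Gate.cnotOp c t b d =
      if d = Function.update b t (b t + b c) then 1 else 0 := by
    intro d
    simp only [Gate.cnotOp, Matrix.of_apply]
    by_cases hd : b = Function.update d t (d t + d c)
    · rw [if_pos ((key d).1 hd), if_pos (by convert hd)]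
    · rw [if_neg fun h => hd ((key d).2 h), if_neg (by convert hd)]
  simp [Matrix.mulVec, dotProduct, entry]

theorem onQubit_mulVec_mulVec (i : ι) (A B : Matrix (Fin 2) (Fin 2) ℂ) (ψ : State ι) :
    (onQubit i A).mulVec ((onQubit i B).mulVec ψ) = (onQubit i (A * B)).mulVec ψ := by
  ext b
  simp only [onQubit_mulVec, Fin.sum_univ_two, Function.update_self, Function.update_idem,
    Matrix.mul_apply]
  ring

theorem onQubit_one_mulVec (i : ι) (ψ : State ι) : (onQubit i 1).mulVec ψ = ψ := by
  ext b
  rw [onQubit_mulVec]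
  rcases fin_two_eq (b i) with h | h <;> simp [h] <;> rw [← h] <;> simp

theorem onQubit_smul_mulVec (i : ι) (a : ℂ) (A : Matrix (Fin 2) (Fin 2) ℂ) (ψ : State ι) :
    (onQubit i (a • A)).mulVec ψ = a • (onQubit i A).mulVec ψ := by
  ext b
  simp only [onQubit_mulVec, Pi.smul_apply, Matrix.smul_apply, smul_eq_mul, Finset.mul_sum,
    mul_assoc]

namespace Circuit

theorem run_nil (ψ : State ι) : run [] ψ = ψ := rfl

theorem run_cons (g : Gate ι) (C : Circuit ι) (ψ : State ι) :
    run (g :: C) ψ = run C (g.toOp.mulVec ψ) := rfl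

theorem run_append (C D : Circuit ι) (ψ : State ι) : run (C ++ D) ψ = run D (run C ψ) := by
  simp [run]

theorem run_add (C : Circuit ι) (ψ φ : State ι) : run C (ψ + φ) = run C ψ + run C φ := by
  induction C generalizing ψ φ with
  | nil => rfl
  | cons g C ih => simp only [run_cons, Matrix.mulVec_add, ih]

theorem run_smul (C : Circuit ι) (a : ℂ) (ψ : State ι) : run C (a • ψ) = a • run C ψ := by
  induction C generalizing ψ with
  | nil => rfl
  | cons g C ih => simp only [run_cons, Matrix.mulVec_smul, ih]

theorem run_zero (C : Circuit ι) : run C (0 : State ι) = 0 := by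
  simpa using run_smul C 0 0

theorem run_sum {α : Type*} (C : Circuit ι) (s : Finset α) (ψ : α → State ι) :
    run C (∑ a ∈ s, ψ a) = ∑ a ∈ s, run C (ψ a) := by
  classical
  induction s using Finset.induction_on with
  | empty => simp [run_zero]
  | insert a s ha ih => rw [Finset.sum_insert ha, Finset.sum_insert ha, run_add, ih]

end Circuit

end Gates

namespace Circuit

theorem numT_append {ι : Type} (C D : Circuit ι) : numT (C ++ D) = numT C + numT D := by
  simp [numT]

theorem numRz_append {ι : Type} (C D : Circuit ι) : numRz (C ++ D) = numRz C + numRz D := by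
  simp [numRz]

theorem numCNOT_append {ι : Type} (C D : Circuit ι) : numCNOT (C ++ D) = numCNOT C + numCNOT D := by
  simp [numCNOT]

end Circuit

/-! ### Circuits preserve inner products -/

section Unitarity

variable {ι : Type} [Fintype ι] [DecidableEq ι]

theorem conjTranspose_onQubit {ι : Type} (i : ι) (A : Matrix (Fin 2) (Fin 2) ℂ) :
    (onQubit i A).conjTranspose = onQubit i A.conjTranspose := by
  ext b c
  simp only [onQubit, Matrix.conjTranspose_apply, Matrix.of_apply]
  have : (∀ j, j ≠ i → c j = b j) ↔ (∀ j, j ≠ i → b j = c j) :=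
    forall₂_congr fun j _ => eq_comm
  split_ifs with h1 h2 h2
  · rfl
  · exact absurd (this.1 h1) h2
  · exact absurd (this.2 h2) h1
  · simp

theorem onQubit_isometry (i : ι) {A : Matrix (Fin 2) (Fin 2) ℂ} (hA : A.conjTranspose * A = 1)
    (ψ φ : State ι) :
    dotProduct (star ((onQubit i A).mulVec ψ)) ((onQubit i A).mulVec φ) =
      dotProduct (star ψ) φ := by
  rw [Matrix.star_mulVec, ← Matrix.dotProduct_mulVec, conjTranspose_onQubit,
    onQubit_mulVec_mulVec, hA, onQubit_one_mulVec]

theorem cnotOp_isometry {c t : ι} (h : c ≠ t) (ψ φ : State ι) :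
    dotProduct (star ((Gate.cnotOp c t).mulVec ψ)) ((Gate.cnotOp c t).mulVec φ) =
      dotProduct (star ψ) φ := by
  have inv : Function.Involutive fun b : ι → Fin 2 => Function.update b t (b t + b c) := by
    intro d
    simp only [Function.update_self, Function.update_of_ne h, Function.update_idem]
    have : d t + d c + d c = d t := by
      rcases fin_two_eq (d c) with h | h <;> rcases fin_two_eq (d t) with h' | h' <;> simp [h, h']
    rw [this]; simp
  simp only [dotProduct, Pi.star_apply, cnotOp_mulVec h]
  exact Equiv.sum_comp inv.toPerm fun b => star (ψ b) * φ b

theorem diag2_unitary {a d : ℂ} (ha : star a * a = 1) (hd : star d * d = 1) :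
    (Gate.diag2 a d).conjTranspose * Gate.diag2 a d = 1 := by
  ext i j
  fin_cases i <;> fin_cases j <;> simp_all [Gate.diag2, Matrix.mul_apply]

theorem star_exp_mul_exp {z : ℂ} (hz : z.re = 0) :
    star (Complex.exp z) * Complex.exp z = 1 := by
  have h : star (Complex.exp z) = Complex.exp (star z) := (Complex.exp_conj z).symm
  rw [h, ← Complex.exp_add]
  have : star z + z = 0 := by
    apply Complex.ext <;> simp [hz]
  rw [this, Complex.exp_zero]

theorem sqrt_two_inv_mul_self : ((Real.sqrt 2 : ℂ)⁻¹) * ((Real.sqrt 2 : ℂ)⁻¹) = 1 / 2 := by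
  rw [← mul_inv, ← Complex.ofReal_mul, Real.mul_self_sqrt (by norm_num)]
  norm_num

theorem hadamard_mul_self : Gate.hadamard * Gate.hadamard = 1 := by
  have h := sqrt_two_inv_mul_self
  ext i j
  fin_cases i <;> fin_cases j <;> simp [Gate.hadamard, Matrix.mul_apply] <;>
    linear_combination 2 * h

theorem hadamard_conjTranspose : Gate.hadamard.conjTranspose = Gate.hadamard := by
  ext i j
  fin_cases i <;> fin_cases j <;> simp [Gate.hadamard]

theorem Gate.toOp_isometry (g : Gate ι) (ψ φ : State ι) :
    dotProduct (star (g.toOp.mulVec ψ)) (g.toOp.mulVec φ) = dotProduct (star ψ) φ := by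
  cases g with
  | H i => exact onQubit_isometry i (by rw [hadamard_conjTranspose, hadamard_mul_self]) ψ φ
  | S i => exact onQubit_isometry i (diag2_unitary (by simp) (by simp)) ψ φ
  | T i =>
    refine onQubit_isometry i (diag2_unitary (by simp) (star_exp_mul_exp ?_)) ψ φ
    simp
  | Rz θ i =>
    refine onQubit_isometry i (diag2_unitary (star_exp_mul_exp ?_) (star_exp_mul_exp ?_)) ψ φ <;>
    simp
  | CNOT c t h => exact cnotOp_isometry h ψ φ

theorem Circuit.run_isometry (C : Circuit ι) (ψ φ : State ι) :
    dotProduct (star (C.run ψ)) (C.run φ) = dotProduct (star ψ) φ := by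
  induction C generalizing ψ φ with
  | nil => rfl
  | cons g C ih => rw [run_cons, run_cons, ih, g.toOp_isometry]

end Unitarity

/-! ### Controlled rotations from Clifford gates, T gates and `R_z` -/

section Rotations

variable {ι : Type} [Fintype ι] [DecidableEq ι]

/-- The rotation `exp (-i α Y / 2)`. -/
def rotY (α : ℝ) : Matrix (Fin 2) (Fin 2) ℂ :=
  !![(Real.cos (α / 2) : ℂ), -(Real.sin (α / 2) : ℂ); (Real.sin (α / 2) : ℂ), (Real.cos (α / 2) : ℂ)]

/-- The diagonal gates `g` conjugated by the Clifford operator that takes `Z` to `Y`. -/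
def conjY {ι : Type} (i : ι) (g : Circuit ι) : Circuit ι :=
  [Gate.S i, Gate.S i, Gate.S i, Gate.H i] ++ g ++ [Gate.H i, Gate.S i]

theorem diag2_mul (a b c d : ℂ) : Gate.diag2 a b * Gate.diag2 c d = Gate.diag2 (a * c) (b * d) := by
  ext i j
  fin_cases i <;> fin_cases j <;> simp [Gate.diag2, Matrix.mul_apply]

/-- Conjugation by the Hadamard gate takes `Z` to `X`, and by `S` takes `X` to `Y`; so a diagonal
operator keeps its eigenvalues and becomes diagonal in the eigenbasis of `Y`. -/
theorem clifford_conj_diag2 (a d : ℂ) :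
    Gate.diag2 1 Complex.I * (Gate.hadamard * (Gate.diag2 a d * (Gate.hadamard *
      (Gate.diag2 1 Complex.I * (Gate.diag2 1 Complex.I * Gate.diag2 1 Complex.I))))) =
      !![(a + d) / 2, -Complex.I * (a - d) / 2; Complex.I * (a - d) / 2, (a + d) / 2] := by
  have h := sqrt_two_inv_mul_self
  have h2 := Complex.I_mul_I
  rw [diag2_mul, diag2_mul]
  ext i j
  fin_cases i <;> fin_cases j <;> simp [Gate.diag2, Gate.hadamard, Matrix.mul_apply]
  · linear_combination (a + d) * h
  · linear_combination -(a - d) * Complex.I * h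
  · linear_combination (a - d) * Complex.I * h
  · linear_combination (a + d) * h - (a + d) * (Real.sqrt 2 : ℂ)⁻¹ ^ 2 * h2

theorem clifford_conj_rz (α : ℝ) :
    Gate.diag2 1 Complex.I * (Gate.hadamard *
      (Gate.diag2 (Complex.exp (-(Complex.I * α / 2))) (Complex.exp (Complex.I * α / 2)) *
      (Gate.hadamard * (Gate.diag2 1 Complex.I *
        (Gate.diag2 1 Complex.I * Gate.diag2 1 Complex.I))))) = rotY α := by
  rw [clifford_conj_diag2]
  have h1 : Complex.exp (Complex.I * α / 2) = Real.cos (α / 2) + Real.sin (α / 2) * Complex.I := by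
    rw [show Complex.I * α / 2 = ((α / 2 : ℝ) : ℂ) * Complex.I by push_cast; ring,
      Complex.exp_mul_I]
    simp
  have h2 : Complex.exp (-(Complex.I * α / 2)) =
      Real.cos (α / 2) - Real.sin (α / 2) * Complex.I := by
    rw [show -(Complex.I * α / 2) = ((-(α / 2) : ℝ) : ℂ) * Complex.I by push_cast; ring,
      Complex.exp_mul_I]
    push_cast
    simp
    ring
  rw [h1, h2]
  have hI := Complex.I_mul_I
  ext i j
  fin_cases i <;> fin_cases j <;> simp only [rotY, Matrix.of_apply, Matrix.cons_val', Fin.zero_eta,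
    Fin.mk_one, Matrix.cons_val_zero, Matrix.cons_val_one, Matrix.cons_val_fin_one, Fin.isValue]
  · ring
  · linear_combination (Real.sin (α / 2) : ℂ) * hI
  · linear_combination -(Real.sin (α / 2) : ℂ) * hI
  · ring

theorem rotY_mul (α β : ℝ) : rotY α * rotY β = rotY (α + β) := by
  ext i j
  fin_cases i <;> fin_cases j <;>
    simp [rotY, Matrix.mul_apply, add_div, Complex.cos_add, Complex.sin_add] <;> ring

theorem rotY_zero : rotY 0 = 1 := by
  ext i j
  fin_cases i <;> fin_cases j <;> simp [rotY]

theorem run_conjY {i : ι} {g : Circuit ι} {D : Matrix (Fin 2) (Fin 2) ℂ}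
    (hg : ∀ ψ, Circuit.run g ψ = (onQubit i D).mulVec ψ) (ψ : State ι) :
    Circuit.run (conjY i g) ψ = (onQubit i (Gate.diag2 1 Complex.I * (Gate.hadamard *
      (D * (Gate.hadamard * (Gate.diag2 1 Complex.I *
        (Gate.diag2 1 Complex.I * Gate.diag2 1 Complex.I))))))).mulVec ψ := by
  simp only [conjY, Circuit.run_append, Circuit.run_cons, Circuit.run_nil, hg, Gate.toOp,
    onQubit_mulVec_mulVec]

theorem run_conjY_rz (α : ℝ) (i : ι) (ψ : State ι) :
    Circuit.run (conjY i [Gate.Rz α i]) ψ = (onQubit i (rotY α)).mulVec ψ := by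
  rw [run_conjY (fun ψ => rfl), clifford_conj_rz]

/-- The T gate is the rotation by `π / 4` up to the phase `exp (iπ / 8)`. Its inverse, written `S³
T`, has the opposite phase, so the phases cancel when both are used. -/
theorem diag2_T :
    Gate.diag2 1 (Complex.exp (Complex.I * Real.pi / 4)) =
      Complex.exp (Complex.I * Real.pi / 8) •
        Gate.diag2 (Complex.exp (-(Complex.I * ((Real.pi / 4 : ℝ) : ℂ) / 2)))
          (Complex.exp (Complex.I * ((Real.pi / 4 : ℝ) : ℂ) / 2)) := by
  ext i j
  fin_cases i <;> fin_cases j <;> simp [Gate.diag2, ← Complex.exp_add]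
  · rw [eq_comm, Complex.exp_eq_one_iff]
    exact ⟨0, by push_cast; ring⟩
  · ring_nf

theorem diag2_T_inv :
    Gate.diag2 1 Complex.I * (Gate.diag2 1 Complex.I * (Gate.diag2 1 Complex.I *
      Gate.diag2 1 (Complex.exp (Complex.I * Real.pi / 4)))) =
      Complex.exp (-(Complex.I * Real.pi / 8)) •
        Gate.diag2 (Complex.exp (-(Complex.I * ((-(Real.pi / 4) : ℝ) : ℂ) / 2)))
          (Complex.exp (Complex.I * ((-(Real.pi / 4) : ℝ) : ℂ) / 2)) := by
  have hI : Complex.I = Complex.exp (Complex.I * Real.pi / 2) := by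
    rw [show Complex.I * Real.pi / 2 = Real.pi / 2 * Complex.I by ring, Complex.exp_pi_div_two_mul_I]
  have hone : Complex.exp (2 * Real.pi * Complex.I) = 1 := Complex.exp_two_pi_mul_I
  rw [diag2_mul, diag2_mul, diag2_mul]
  have h1 : Complex.I * (Complex.I * (Complex.I * Complex.exp (Complex.I * Real.pi / 4))) =
      Complex.exp (-(Complex.I * Real.pi / 8)) *
        Complex.exp (Complex.I * ((-(Real.pi / 4) : ℝ) : ℂ) / 2) := by
    have : Complex.I * (Complex.I * (Complex.I * Complex.exp (Complex.I * Real.pi / 4))) =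
        Complex.exp (Complex.I * Real.pi / 2) * (Complex.exp (Complex.I * Real.pi / 2) *
        (Complex.exp (Complex.I * Real.pi / 2) * Complex.exp (Complex.I * Real.pi / 4))) := by
      rw [← hI]
    -- The exponents are `7iπ / 4` on the left and `-iπ / 4` on the right; a factor `exp (2πi) = 1`
    -- makes up the difference.
    rw [this, ← Complex.exp_add, ← Complex.exp_add, ← Complex.exp_add, ← Complex.exp_add,
      ← mul_one (Complex.exp (_ + _ / 2)), ← hone, ← Complex.exp_add]
    congr 1
    push_cast
    ring
  have h2 : (1 : ℂ) * (1 * (1 * 1)) = Complex.exp (-(Complex.I * Real.pi / 8)) *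
      Complex.exp (-(Complex.I * ((-(Real.pi / 4) : ℝ) : ℂ) / 2)) := by
    rw [← Complex.exp_add, eq_comm, mul_one, mul_one, mul_one, Complex.exp_eq_one_iff]
    exact ⟨0, by push_cast; ring⟩
  rw [h1, h2]
  ext i j
  fin_cases i <;> fin_cases j <;> simp [Gate.diag2]

theorem run_conjY_T (i : ι) (ψ : State ι) :
    Circuit.run (conjY i [Gate.T i]) ψ =
      Complex.exp (Complex.I * Real.pi / 8) • (onQubit i (rotY (Real.pi / 4))).mulVec ψ := by
  rw [run_conjY (fun ψ => rfl), diag2_T, Matrix.smul_mul, Matrix.mul_smul, Matrix.mul_smul,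
    clifford_conj_rz, onQubit_smul_mulVec]

theorem run_conjY_T_inv (i : ι) (ψ : State ι) :
    Circuit.run (conjY i [Gate.T i, Gate.S i, Gate.S i, Gate.S i]) ψ =
      Complex.exp (-(Complex.I * Real.pi / 8)) •
        (onQubit i (rotY (-(Real.pi / 4)))).mulVec ψ := by
  have hg : ∀ φ : State ι, Circuit.run [Gate.T i, Gate.S i, Gate.S i, Gate.S i] φ =
      (onQubit i (Gate.diag2 1 Complex.I * (Gate.diag2 1 Complex.I * (Gate.diag2 1 Complex.I *
      Gate.diag2 1 (Complex.exp (Complex.I * Real.pi / 4)))))).mulVec φ := by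
    intro φ
    simp only [Circuit.run_cons, Circuit.run_nil, Gate.toOp, onQubit_mulVec_mulVec]
  rw [run_conjY hg, diag2_T_inv, Matrix.smul_mul, Matrix.mul_smul, Matrix.mul_smul,
    clifford_conj_rz, onQubit_smul_mulVec]

/-- `|1⟩|0⟩ ↦ cos φ |1⟩|0⟩ + sin φ |1⟩|1⟩` on control and target, `|0⟩|b⟩ ↦ |0⟩|b⟩`. -/
def ctrlRot {ι : Type} (φ : ℝ) (c t : ι) (h : c ≠ t) : Circuit ι :=
  conjY t [Gate.Rz (-(φ - Real.pi / 2)) t] ++ [Gate.CNOT c t h] ++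
    conjY t [Gate.Rz (φ - Real.pi / 2) t]

/-- `ctrlRot (π / 4)`, compiled to `T` gates. -/
def ctrlHad {ι : Type} (c t : ι) (h : c ≠ t) : Circuit ι :=
  conjY t [Gate.T t] ++ [Gate.CNOT c t h] ++
    conjY t [Gate.T t, Gate.S t, Gate.S t, Gate.S t]

/-- At `φ = π / 4` the two rotation angles are `π / 4` and `-π / 4`, hence a T gate and its inverse,
and the phases `exp (± iπ / 8)` cancel exactly. -/
theorem run_ctrlHad {c t : ι} (h : c ≠ t) (ψ : State ι) :
    Circuit.run (ctrlHad c t h) ψ = Circuit.run (ctrlRot (Real.pi / 4) c t h) ψ := by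
  simp only [ctrlHad, ctrlRot, Circuit.run_append, run_conjY_T, run_conjY_T_inv, run_conjY_rz,
    Circuit.run_smul, Circuit.run_cons, Circuit.run_nil, smul_smul]
  rw [← Complex.exp_add, add_neg_cancel, Complex.exp_zero, one_smul,
    show Real.pi / 4 - Real.pi / 2 = -(Real.pi / 4) by ring, neg_neg]

/-- With control `0` the two rotations cancel. With control `1` they conjugate `X` into the
reflection that sends `|0⟩` to `cos φ |0⟩ + sin φ |1⟩`; `hψ` makes the other column of this
reflection irrelevant. -/
theorem run_ctrlRot_apply {φ : ℝ} {c t : ι} (h : c ≠ t) {ψ : State ι}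
    (hψ : ∀ b, b c = 1 → b t = 1 → ψ b = 0) (b : ι → Fin 2) :
    Circuit.run (ctrlRot φ c t h) ψ b = if b c = 0 then ψ b else
      (if b t = 0 then (Real.cos φ : ℂ) else Real.sin φ) * ψ (Function.update b t 0) := by
  simp only [ctrlRot, Circuit.run_append, run_conjY_rz, Circuit.run_cons, Circuit.run_nil,
    Gate.toOp]
  have key : ∀ b : ι → Fin 2, b c = 0 →
      (onQubit t (rotY (φ - Real.pi / 2))).mulVec ((Gate.cnotOp c t).mulVec
        ((onQubit t (rotY (-(φ - Real.pi / 2)))).mulVec ψ)) b = ψ b := by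
    intro b hb
    have : (onQubit t (rotY (φ - Real.pi / 2))).mulVec ((Gate.cnotOp c t).mulVec
        ((onQubit t (rotY (-(φ - Real.pi / 2)))).mulVec ψ)) b =
        (onQubit t (rotY (φ - Real.pi / 2))).mulVec
        ((onQubit t (rotY (-(φ - Real.pi / 2)))).mulVec ψ) b := by
      rw [onQubit_mulVec, onQubit_mulVec]
      refine Finset.sum_congr rfl fun v _ => ?_
      rw [cnotOp_mulVec h]
      simp [Function.update_of_ne h, hb]
    rw [this, onQubit_mulVec_mulVec, rotY_mul, add_neg_cancel, rotY_zero, onQubit_one_mulVec]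
  split_ifs with hc ht
  · exact key b hc
  all_goals
    replace hc : b c = 1 := (fin_two_eq _).resolve_left hc
    have h1 : ψ (Function.update b t 1) = 0 := hψ _ (by simp [Function.update_of_ne h, hc]) (by simp)
    -- The gates contain half angles of `φ - π / 2`; the double-angle formulas turn their products
    -- into `cos φ` and `sin φ`.
    have hcos : Real.cos φ =
        - 2 * (Real.sin ((φ - Real.pi / 2) / 2) * Real.cos ((φ - Real.pi / 2) / 2)) := by
      have := Real.sin_two_mul ((φ - Real.pi / 2) / 2)
      rw [show 2 * ((φ - Real.pi / 2) / 2) = φ - Real.pi / 2 by ring,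
        Real.sin_sub_pi_div_two] at this
      linarith
    have hsin : Real.sin φ =
        Real.cos ((φ - Real.pi / 2) / 2) ^ 2 - Real.sin ((φ - Real.pi / 2) / 2) ^ 2 := by
      have := Real.cos_two_mul' ((φ - Real.pi / 2) / 2)
      rwa [show 2 * ((φ - Real.pi / 2) / 2) = φ - Real.pi / 2 by ring,
        Real.cos_sub_pi_div_two] at this
    simp only [onQubit_mulVec, cnotOp_mulVec h, Fin.sum_univ_two, Function.update_self,
      Function.update_idem, Function.update_of_ne h, hc, h1, mul_zero, add_zero, zero_add]
    have hneg : -(φ - Real.pi / 2) / 2 = -((φ - Real.pi / 2) / 2) := neg_div _ _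
    simp only [rotY, hneg, Real.cos_neg, Real.sin_neg, hcos, hsin]
    generalize Real.cos ((φ - Real.pi / 2) / 2) = u
    generalize Real.sin ((φ - Real.pi / 2) / 2) = v
  · rw [ht]
    simp
    ring
  · rw [(fin_two_eq _).resolve_left ht]
    simp
    ring

end Rotations

/-! ### One-hot states and the doubling scheme -/

section OneHot

variable {ι : Type} [Fintype ι] [DecidableEq ι]

/-- The computational basis state `|b⟩`. -/
abbrev ket (b : ι → Fin 2) : State ι := Pi.single b 1

/-- The bit string whose only nonzero bit is `q`. -/
abbrev one (q : ι) : ι → Fin 2 := Pi.single q 1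

theorem toOp_CNOT_ket {c t : ι} (h : c ≠ t) (b : ι → Fin 2) :
    (Gate.CNOT c t h).toOp.mulVec (ket b) = ket (Function.update b t (b t + b c)) := by
  ext d
  simp only [Gate.toOp, cnotOp_mulVec h, ket, Pi.single_apply]
  refine if_congr ?_ rfl rfl
  have inv : ∀ b : ι → Fin 2, Function.update (Function.update b t (b t + b c)) t
      ((Function.update b t (b t + b c)) t + (Function.update b t (b t + b c)) c) = b := by
    intro d
    simp only [Function.update_self, Function.update_of_ne h, Function.update_idem]
    have : d t + d c + d c = d t := by
      rcases fin_two_eq (d c) with h | h <;> rcases fin_two_eq (d t) with h' | h' <;> simp [h, h']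
    rw [this]; simp
  constructor
  · intro h; rw [← h, inv]
  · intro h; rw [h, inv]

theorem run_ctrlRot_ket {φ : ℝ} {c t : ι} (h : c ≠ t) {b : ι → Fin 2} (hb : b c = 0 ∨ b t = 0) :
    Circuit.run (ctrlRot φ c t h) (ket b) = if b c = 0 then ket b else
      (Real.cos φ : ℂ) • ket b + (Real.sin φ : ℂ) • ket (Function.update b t 1) := by
  ext d
  rw [run_ctrlRot_apply h]
  · simp only [ket]
    split_ifs with h1 h2 h3 h4 h5
    · rfl
    · have n1 : d ≠ b := fun h => h2 (h ▸ h1)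
      have n2 : d ≠ Function.update b t 1 := fun h' => h2 (by
        rw [h', Function.update_of_ne h] at h1; exact h1)
      simp [n1, n2]
    · have n1 : d ≠ b := fun h => h1 (h ▸ h4)
      have n2 : Function.update d t 0 ≠ b := fun h' => h1 (by
        rw [← h', Function.update_of_ne h] at h4; exact h4)
      simp [n1, n2]
    · have n2 : d ≠ Function.update b t 1 := fun h' => by simp [h'] at h3
      rw [← h3]
      simp [n2, Pi.single_apply]
    · have n1 : d ≠ b := fun h => h1 (h ▸ h5)
      have n2 : Function.update d t 0 ≠ b := fun h' => h1 (by
        rw [← h', Function.update_of_ne h] at h5; exact h5)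
      simp [n1, n2]
    · have hbt := hb.resolve_left h5
      have hdt := (fin_two_eq _).resolve_left h3
      have n1 : d ≠ b := fun h => h3 (h ▸ hbt)
      have : Function.update d t 0 = b ↔ d = Function.update b t 1 := by
        constructor
        · intro h; rw [← h, Function.update_idem, ← hdt]; simp
        · intro h; rw [h, Function.update_idem, ← hbt]; simp
      simp [n1, Pi.single_apply, this]
  · intro e hc ht
    have : e ≠ b := by
      rintro rfl
      rcases hb with hb | hb <;> simp_all
    simp [this]

theorem run_eq_sum_ket (C : Circuit ι) (ψ : State ι) :
    Circuit.run C ψ = ∑ b, ψ b • Circuit.run C (ket b) := by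
  have : ψ = ∑ b, ψ b • ket b := by
    ext d
    simp [Finset.sum_apply, Pi.single_apply]
  conv_lhs => rw [this]
  rw [Circuit.run_sum]
  simp only [Circuit.run_smul]

/-- A superposition of the zero string and of strings with a single nonzero bit. -/
def oneHot (c : ℝ) (f : ι → ℝ) : State ι :=
  (c : ℂ) • ket 0 + ∑ q, (f q : ℂ) • ket (one q)

/-- Moves a part of the excitation of `s` to `t`. -/
def split {ι : Type} (φ : ℝ) (s t : ι) (h : s ≠ t) : Circuit ι :=
  ctrlRot φ s t h ++ [Gate.CNOT t s h.symm]

/-- Moves half of the excitation of `s` to `t`. -/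
def splitHad {ι : Type} (s t : ι) (h : s ≠ t) : Circuit ι :=
  ctrlHad s t h ++ [Gate.CNOT t s h.symm]

theorem run_splitHad {s t : ι} (h : s ≠ t) (ψ : State ι) :
    Circuit.run (splitHad s t h) ψ = Circuit.run (split (Real.pi / 4) s t h) ψ := by
  simp only [splitHad, split, Circuit.run_append, run_ctrlHad]

/-- The controlled rotation leaves part of the amplitude on both `s` and `t` excited; the final CNOT
then clears `s`, so the state stays one-hot. An empty `t` is needed for this. -/
theorem run_split_oneHot {φ : ℝ} {s t : ι} (h : s ≠ t) (c : ℝ) {f : ι → ℝ} (ht : f t = 0) :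
    Circuit.run (split φ s t h) (oneHot c f) = oneHot c (fun q =>
      if q = t then Real.sin φ * f s else if q = s then Real.cos φ * f s else f q) := by
  have h0 : Circuit.run (split φ s t h) (ket 0) = ket 0 := by
    simp only [split, Circuit.run_append, Circuit.run_cons, Circuit.run_nil]
    rw [run_ctrlRot_ket h (Or.inl rfl), if_pos (by rfl), toOp_CNOT_ket]
    simp
  have h1 : ∀ q, q ≠ s → q ≠ t → Circuit.run (split φ s t h) (ket (one q)) = ket (one q) := by
    intro q hs ht
    simp only [split, Circuit.run_append, Circuit.run_cons, Circuit.run_nil]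
    rw [run_ctrlRot_ket h (Or.inl (by simp [hs.symm])), if_pos (by simp [hs.symm]), toOp_CNOT_ket]
    congr 1
    simp [hs.symm, ht.symm]
  have h2 : Circuit.run (split φ s t h) (ket (one s)) =
      (Real.cos φ : ℂ) • ket (one s) + (Real.sin φ : ℂ) • ket (one t) := by
    simp only [split, Circuit.run_append, Circuit.run_cons, Circuit.run_nil]
    rw [run_ctrlRot_ket h (Or.inr (by simp [h.symm])), if_neg (by simp), Matrix.mulVec_add,
      Matrix.mulVec_smul, Matrix.mulVec_smul, toOp_CNOT_ket, toOp_CNOT_ket]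
    congr 3
    · simp [h.symm]
    · ext q
      by_cases hqs : q = s
      · subst hqs; simp [h]
      · by_cases hqt : q = t
        · subst hqt; simp [h.symm]
        · simp [hqs, hqt]
  have hL : ∀ q, (f q : ℂ) • Circuit.run (split φ s t h) (ket (one q)) =
      ((if q = s then Real.cos φ * f s else f q : ℝ) : ℂ) • ket (one q) +
        if q = s then ((Real.sin φ * f s : ℝ) : ℂ) • ket (one t) else 0 := by
    intro q
    by_cases hqs : q = s
    · subst hqs
      rw [h2, if_pos rfl, if_pos rfl]
      push_cast
      module
    · by_cases hqt : q = t
      · subst hqt; simp [hqs, ht]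
      · rw [h1 q hqs hqt]; simp [hqs]
  have hR : ∀ q, ((if q = t then Real.sin φ * f s else if q = s then Real.cos φ * f s else f q : ℝ) : ℂ)
        • ket (one q) =
      ((if q = s then Real.cos φ * f s else f q : ℝ) : ℂ) • ket (one q) +
        if q = t then ((Real.sin φ * f s : ℝ) : ℂ) • ket (one t) else 0 := by
    intro q
    by_cases hqt : q = t
    · subst hqt; simp [h.symm, ht]
    · simp [hqt]
  simp only [oneHot, Circuit.run_add, Circuit.run_smul, Circuit.run_sum, h0, hL, hR,
    Finset.sum_add_distrib, Finset.sum_ite_eq', Finset.mem_univ, if_true]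

/-- The angle is the argument of `√a + i √b`, whose modulus is `√(a + b)`; this includes the case `a
= b = 0`. -/
theorem exists_angle {a b : ℝ} (ha : 0 ≤ a) (hb : 0 ≤ b) :
    ∃ φ : ℝ, Real.cos φ * √(a + b) = √a ∧ Real.sin φ * √(a + b) = √b := by
  have hn : ‖(⟨√a, √b⟩ : ℂ)‖ = √(a + b) := by
    rw [Complex.norm_def, Complex.normSq_mk, Real.mul_self_sqrt ha, Real.mul_self_sqrt hb]
  refine ⟨Complex.arg ⟨√a, √b⟩, ?_, ?_⟩
  · rw [mul_comm, ← hn, Complex.norm_mul_cos_arg]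
  · rw [mul_comm, ← hn, Complex.norm_mul_sin_arg]

section Counts

variable {ι : Type}

theorem numT_ctrlHad {s t : ι} (h : s ≠ t) : (ctrlHad s t h).numT = 2 := rfl
theorem numCNOT_ctrlHad {s t : ι} (h : s ≠ t) : (ctrlHad s t h).numCNOT = 1 := rfl
theorem numT_split (φ : ℝ) {s t : ι} (h : s ≠ t) : (split φ s t h).numT = 0 := rfl
theorem numRz_split (φ : ℝ) {s t : ι} (h : s ≠ t) : (split φ s t h).numRz = 2 := rfl
theorem numCNOT_split (φ : ℝ) {s t : ι} (h : s ≠ t) : (split φ s t h).numCNOT = 2 := rfl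
theorem numT_splitHad {s t : ι} (h : s ≠ t) : (splitHad s t h).numT = 2 := rfl
theorem numRz_splitHad {s t : ι} (h : s ≠ t) : (splitHad s t h).numRz = 0 := rfl
theorem numCNOT_splitHad {s t : ι} (h : s ≠ t) : (splitHad s t h).numCNOT = 2 := rfl

end Counts

/-- Pair the two lists and halve the probability of each filled qubit into its empty partner.
Halving is a controlled Hadamard, hence free of rotations. -/
theorem exists_doubling {w : ℝ} (l₁ l₂ : List ι) (hlen : l₁.length = l₂.length)
    (hnd : (l₁ ++ l₂).Nodup) :
    ∃ C : Circuit ι, C.numT ≤ 2 * l₁.length ∧ C.numCNOT ≤ 2 * l₁.length ∧ C.numRz = 0 ∧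
      ∀ c f, (∀ q ∈ l₁, f q = √(2 * w)) → (∀ q ∈ l₂, f q = 0) →
        C.run (oneHot c f) = oneHot c (fun q => if q ∈ l₁ ++ l₂ then √w else f q) := by
  induction l₁ generalizing l₂ with
  | nil =>
    obtain rfl : l₂ = [] := List.length_eq_zero_iff.1 hlen.symm
    exact ⟨[], by simp [Circuit.numT], by simp [Circuit.numCNOT], by simp [Circuit.numRz],
      fun c f _ _ => by simp [Circuit.run_nil]⟩
  | cons s l₁ ih =>
    cases l₂ with
    | nil => simp at hlen
    | cons t l₂ =>
      have hst : s ≠ t := by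
        rintro rfl
        simp at hnd
      have hp : (s :: t :: (l₁ ++ l₂)).Nodup := by
        refine (List.Perm.nodup_iff ?_).1 hnd
        rw [List.cons_append]
        exact (List.perm_middle).cons s
      have hp2 := (List.nodup_cons.1 (List.nodup_cons.1 hp).2)
      have hs := (List.nodup_cons.1 hp).1
      obtain ⟨C, hT, hC, hR, hrun⟩ := ih l₂ (by simpa using hlen) hp2.2
      refine ⟨splitHad s t hst ++ C, ?_, ?_, ?_, ?_⟩
      · rw [Circuit.numT_append, numT_splitHad, List.length_cons]; omega
      · rw [Circuit.numCNOT_append, numCNOT_splitHad, List.length_cons]; omega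
      · rw [Circuit.numRz_append, numRz_splitHad, hR]
      · intro c f hf1 hf2
        have hs' : s ∉ l₁ ++ l₂ := fun h => hs (List.mem_cons_of_mem _ h)
        rw [Circuit.run_append, run_splitHad, run_split_oneHot hst c (hf2 t (by simp)), hrun]
        · congr 1
          have h2 : √2 / 2 * √(2 * w) = √w := by
            rw [Real.sqrt_mul (by norm_num)]
            have := Real.mul_self_sqrt (show (0 : ℝ) ≤ 2 by norm_num)
            linear_combination (√w / 2) * this
          ext q
          rw [hf1 s (by simp), Real.sin_pi_div_four, Real.cos_pi_div_four, h2]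
          have hmem : q ∈ s :: l₁ ++ t :: l₂ ↔ q = s ∨ q = t ∨ q ∈ l₁ ++ l₂ := by
            simp only [List.mem_append, List.mem_cons]; tauto
          by_cases hq : q ∈ l₁ ++ l₂
          · rw [if_pos hq, if_pos (hmem.2 (Or.inr (Or.inr hq)))]
          · rw [if_neg hq]
            by_cases hqt : q = t
            · rw [if_pos hqt, if_pos (hmem.2 (by tauto))]
            · rw [if_neg hqt]
              by_cases hqs : q = s
              · rw [if_pos hqs, if_pos (hmem.2 (by tauto))]
              · rw [if_neg hqs, if_neg (by rw [hmem]; tauto)]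
        · intro q hq
          have h1 : q ≠ s := fun h => hs' (by rw [← h]; simp [hq])
          have h2 : q ≠ t := fun h => hp2.1 (by rw [← h]; simp [hq])
          rw [if_neg h2, if_neg h1]
          exact hf1 q (by simp [hq])
        · intro q hq
          have h1 : q ≠ s := fun h => hs' (by rw [← h]; simp [hq])
          have h2 : q ≠ t := fun h => hp2.1 (by rw [← h]; simp [hq])
          rw [if_neg h2, if_neg h1]
          exact hf2 q (by simp [hq])

/-- Induction along the binary expansion of the length. An even list is obtained by filling half of
it at double weight and doubling; an odd list first receives one qubit from the root by a generic
split. Only the binary digits `1` cost rotations, two each. The sharper count for even lengths is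
what allows an odd length, which recurses to an even one, to stay within `Nat.size`. -/
theorem exists_spread_aux (ρ : ι) (l : List ι) (hnd : l.Nodup) (hρ : ρ ∉ l) {w R : ℝ} (hw : 0 ≤ w)
    (hR : l.length * w ≤ R) :
    ∃ C : Circuit ι, C.numT ≤ 2 * l.length ∧ C.numCNOT ≤ 2 * l.length ∧
      C.numRz ≤ 2 * Nat.size l.length ∧ (Even l.length → C.numRz ≤ 2 * (Nat.size l.length - 1)) ∧
      ∀ c f, f ρ = √R → (∀ q ∈ l, f q = 0) →
        C.run (oneHot c f) = oneHot c (fun q =>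
          if q ∈ l then √w else if q = ρ then √(R - l.length * w) else f q) := by
  induction hn : l.length using Nat.strong_induction_on generalizing l w R with
  | _ n ih =>
  subst hn
  rcases Nat.even_or_odd' l.length with ⟨a, ha | ha⟩
  · rcases Nat.eq_zero_or_pos a with rfl | hapos
    · obtain rfl : l = [] := List.length_eq_zero_iff.1 (by omega)
      refine ⟨[], by simp [Circuit.numT], by simp [Circuit.numCNOT], by simp [Circuit.numRz],
        fun _ => by simp [Circuit.numRz], fun c f h _ => ?_⟩
      rw [Circuit.run_nil]
      congr 1
      ext q
      by_cases hq : q = ρ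
      · subst hq; simp [h]
      · simp [hq]
    · have hlen1 : (l.take a).length = a := by rw [List.length_take]; omega
      have hlen2 : (l.drop a).length = a := by rw [List.length_drop]; omega
      have happ := List.take_append_drop a l
      have hR' : ((l.take a).length : ℝ) * (2 * w) ≤ R := by
        rw [hlen1]; rw [ha] at hR; push_cast at hR; linarith
      -- The first half is filled at weight `2 * w`, so the root gives up the same total as for the
      -- full list at weight `w`.
      obtain ⟨C, hT, hC, hRz, hRz2, hrun⟩ := ih a (by omega) (l.take a)
        (hnd.sublist (List.take_sublist a l))
        (fun h => hρ (List.mem_of_mem_take h)) (w := 2 * w) (R := R) (by positivity) hR' hlen1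
      obtain ⟨D, hT', hC', hRz', hrun'⟩ := exists_doubling (w := w) (l.take a) (l.drop a)
        (hlen1.trans hlen2.symm) (by rw [happ]; exact hnd)
      rw [hlen1] at hT' hC'
      have h2 : Nat.size (2 * a) = Nat.size a + 1 := by
        have := Nat.size_bit (b := false) (n := a) (by simp [Nat.bit]; omega)
        simpa [Nat.bit] using this
      refine ⟨C ++ D, ?_, ?_, ?_, ?_, ?_⟩
      · rw [Circuit.numT_append]; omega
      · rw [Circuit.numCNOT_append]; omega
      · rw [Circuit.numRz_append, hRz', ha]
        omega
      · rw [Circuit.numRz_append, hRz', ha]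
        omega
      · intro c f hf hf0
        have hdisj : ∀ q ∈ l.drop a, q ∉ l.take a := by
          intro q h1 h2
          rw [← happ] at hnd
          exact (List.disjoint_of_nodup_append hnd) h2 h1
        rw [Circuit.run_append, hrun c f hf fun q hq => hf0 q (List.mem_of_mem_take hq), hrun', happ]
        · congr 1
          ext q
          by_cases hq : q ∈ l
          · simp [hq]
          · have : q ∉ l.take a := fun h => hq (List.mem_of_mem_take h)
            simp only [hq, this, if_false]
            rw [ha]
            push_cast
            congr 2
            ring
        · intro q hq
          rw [if_pos hq]
        · intro q hq
          have h1 : q ≠ ρ := fun h => hρ (h ▸ List.mem_of_mem_drop hq)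
          rw [if_neg (hdisj q hq), if_neg h1]
          exact hf0 q (List.mem_of_mem_drop hq)
  · cases l with
    | nil => simp at ha
    | cons t l =>
      have hlen : l.length = 2 * a := by simpa using ha
      have hρt : ρ ≠ t := fun h => hρ (by simp [h])
      have ht := (List.nodup_cons.1 hnd).1
      have hR1 : ((l.length : ℝ) + 1) * w ≤ R := by simpa using hR
      have hR' : (l.length : ℝ) * w ≤ R - w := by linarith
      have hRw : 0 ≤ R - w := le_trans (by positivity) hR'
      -- The root's weight `R` is divided into `w` for the extra qubit and `R - w` for the rest.
      obtain ⟨φ, hφ1, hφ2⟩ := exists_angle hRw hw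
      rw [sub_add_cancel] at hφ1 hφ2
      obtain ⟨C, hT, hC, hRz, hRz2, hrun⟩ := ih l.length (by simp) l (List.nodup_cons.1 hnd).2
        (fun h => hρ (by simp [h])) (w := w) (R := R - w) hw hR' rfl
      have h1 : Nat.size (2 * a + 1) = Nat.size a + 1 := by
        have := Nat.size_bit (b := true) (n := a) (by simp [Nat.bit])
        simpa [Nat.bit] using this
      have h2 : Nat.size (2 * a) - 1 = Nat.size a := by
        rcases Nat.eq_zero_or_pos a with rfl | hapos
        · simp
        · have := Nat.size_bit (b := false) (n := a) (by simp [Nat.bit]; omega)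
          rw [show 2 * a = Nat.bit false a by simp [Nat.bit], this]
          simp
      have h3 := hRz2 (by rw [hlen]; simp)
      rw [hlen, h2] at h3
      refine ⟨split φ ρ t hρt ++ C, ?_, ?_, ?_, ?_, ?_⟩
      · rw [Circuit.numT_append, numT_split, List.length_cons]; omega
      · rw [Circuit.numCNOT_append, numCNOT_split, List.length_cons]; omega
      · rw [Circuit.numRz_append, numRz_split, ha]
        omega
      · intro h
        rw [ha] at h
        exact absurd h (by simp)
      · intro c f hf hf0
        rw [Circuit.run_append, run_split_oneHot hρt c (hf0 t (by simp)), hrun]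
        · congr 1
          ext q
          by_cases hq : q ∈ l
          · simp [hq]
          · by_cases hqt : q = t
            · subst hqt
              simp [ht, hρt.symm, hf, hφ2]
            · by_cases hqρ : q = ρ
              · subst hqρ
                simp only [hq, hqt, List.mem_cons, or_self, if_false, if_true, List.length_cons]
                push_cast
                congr 1
                ring
              · simp [hq, hqt, hqρ]
        · simp [hρt, hf, hφ1]
        · intro q hq
          have h1 : q ≠ t := fun h => ht (h ▸ hq)
          have h2 : q ≠ ρ := fun h => hρ (by simp [← h, hq])
          rw [if_neg h1, if_neg h2]
          exact hf0 q (by simp [hq])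

theorem exists_spread (ρ : ι) (l : List ι) (hnd : l.Nodup) (hρ : ρ ∉ l) {w R : ℝ} (hw : 0 ≤ w)
    (hR : l.length * w ≤ R) :
    ∃ C : Circuit ι, C.numT ≤ 2 * l.length ∧ C.numCNOT ≤ 2 * l.length ∧
      C.numRz ≤ 2 * Nat.size l.length ∧
      ∀ c f, f ρ = √R → (∀ q ∈ l, f q = 0) →
        C.run (oneHot c f) = oneHot c (fun q =>
          if q ∈ l then √w else if q = ρ then √(R - l.length * w) else f q) := by
  obtain ⟨C, h1, h2, h3, _, h4⟩ := exists_spread_aux ρ l hnd hρ hw hR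
  exact ⟨C, h1, h2, h3, h4⟩

end OneHot

/-! ### Building blocks of the link circuit -/

section Links

variable {ι : Type} [Fintype ι] [DecidableEq ι]

/-- The `CNOT` gate as a circuit; empty if the two qubits coincide. -/
def cnot (c t : ι) : Circuit ι := if h : c ≠ t then [Gate.CNOT c t h] else []

/-- The controlled preparation of `(|0⟩ + |1⟩) / √2`; empty if the two qubits coincide. -/
def had (c t : ι) : Circuit ι := if h : c ≠ t then ctrlHad c t h else []

theorem run_cnot_ket {c t : ι} (h : c ≠ t) (b : ι → Fin 2) :
    Circuit.run (cnot c t) (ket b) = ket (Function.update b t (b t + b c)) := by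
  rw [cnot, dif_pos h, Circuit.run_cons, Circuit.run_nil, toOp_CNOT_ket]

theorem run_cnot_ket_of_zero {c t : ι} {b : ι → Fin 2} (hb : b c = 0) :
    Circuit.run (cnot c t) (ket b) = ket b := by
  by_cases h : c ≠ t
  · rw [run_cnot_ket h, hb, add_zero, Function.update_eq_self]
  · rw [cnot, dif_neg h, Circuit.run_nil]

theorem run_cnot_apply {c t : ι} (h : c ≠ t) (ψ : State ι) (b : ι → Fin 2) :
    Circuit.run (cnot c t) ψ b = ψ (Function.update b t (b t + b c)) := by
  rw [cnot, dif_pos h, Circuit.run_cons, Circuit.run_nil, Gate.toOp, cnotOp_mulVec h]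

theorem run_had_ket_of_zero {c t : ι} {b : ι → Fin 2} (hb : b c = 0) :
    Circuit.run (had c t) (ket b) = ket b := by
  by_cases h : c ≠ t
  · rw [had, dif_pos h, run_ctrlHad, run_ctrlRot_ket h (Or.inl hb), if_pos hb]
  · rw [had, dif_neg h, Circuit.run_nil]

theorem sqrt_two_div_two : ((√2 / 2 : ℝ) : ℂ) = ((√2)⁻¹ : ℂ) := by
  rw [Real.sqrt_div_self, Complex.ofReal_inv]

theorem run_had_ket_of_one {c t : ι} (h : c ≠ t) {b : ι → Fin 2} (hc : b c = 1) (ht : b t = 0) :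
    Circuit.run (had c t) (ket b) =
      ((√2)⁻¹ : ℂ) • ket b + ((√2)⁻¹ : ℂ) • ket (Function.update b t 1) := by
  rw [had, dif_pos h, run_ctrlHad, run_ctrlRot_ket h (Or.inr ht), if_neg (by simp [hc]),
    Real.cos_pi_div_four, Real.sin_pi_div_four, sqrt_two_div_two]

theorem run_had_apply {c t : ι} (h : c ≠ t) {ψ : State ι}
    (hψ : ∀ b, b c = 1 → b t = 1 → ψ b = 0) (b : ι → Fin 2) :
    Circuit.run (had c t) ψ b =
      if b c = 0 then ψ b else ((√2)⁻¹ : ℂ) * ψ (Function.update b t 0) := by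
  rw [had, dif_pos h, run_ctrlHad, run_ctrlRot_apply h hψ, Real.cos_pi_div_four,
    Real.sin_pi_div_four, sqrt_two_div_two, ite_self]

/-- Starting from a single excitation of `z k` with flag `r`, distributes a second excitation over
the lower qubits. -/
def scan (z : ℕ → ι) (r : ι) : ℕ → Circuit ι
  | 0 => []
  | k + 1 => had r (z k) ++ cnot (z k) r ++ scan z r k

/-- Adds the parity of the qubits `z j`, `j < k`, to `r`. -/
def addParity (z : ℕ → ι) (r : ι) : ℕ → Circuit ι
  | 0 => []
  | k + 1 => cnot (z k) r ++ addParity z r k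

/-- Suffix sums of the qubits `x j`, `j ≤ k`. -/
def suffixSum (x : ℕ → ι) : ℕ → Circuit ι
  | 0 => []
  | k + 1 => cnot (x (k + 1)) (x k) ++ suffixSum x k

/-- `had c t`, adding to `p` what is added to `t`. -/
def parityHad (p c t : ι) : Circuit ι := cnot t p ++ had c t ++ cnot t p

def parityHads (x z : ℕ → ι) (p : ι) : ℕ → Circuit ι
  | 0 => []
  | k + 1 => parityHad p (x k) (z k) ++ parityHads x z p k

theorem run_scan_of_zero {z : ℕ → ι} {r : ι} {k : ℕ} {b : ι → Fin 2} (hr : b r = 0)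
    (hz : ∀ j < k, b (z j) = 0) : Circuit.run (scan z r k) (ket b) = ket b := by
  induction k with
  | zero => rfl
  | succ k ih =>
    rw [scan, Circuit.run_append, Circuit.run_append, run_had_ket_of_zero hr,
      run_cnot_ket_of_zero (hz k (by omega)), ih fun j hj => hz j (by omega)]

/-- While the flag is up, each qubit met on the way down is excited with probability `1/2`, and the
first success lowers the flag. Success at `j` thus has amplitude `(1/√2)^(k-j)`, and no success
`(1/√2)^k`, with the flag still up. -/
theorem run_scan_of_one {z : ℕ → ι} {r : ι} {k : ℕ} (hzr : ∀ j, r ≠ z j)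
    (hinj : ∀ i < k, ∀ j < k, z i = z j → i = j) {b : ι → Fin 2} (hr : b r = 1)
    (hz : ∀ j < k, b (z j) = 0) :
    Circuit.run (scan z r k) (ket b) = ((√2)⁻¹ : ℂ) ^ k • ket b +
      ∑ j ∈ Finset.range k, ((√2)⁻¹ : ℂ) ^ (k - j) •
        ket (Function.update (Function.update b (z j) 1) r 0) := by
  induction k with
  | zero => simp [scan, Circuit.run_nil]
  | succ k ih =>
    rw [scan, Circuit.run_append, Circuit.run_append, run_had_ket_of_one (hzr k) hr (hz k (by omega)),
      Circuit.run_add, Circuit.run_add, Circuit.run_smul, Circuit.run_smul, Circuit.run_smul,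
      Circuit.run_smul, run_cnot_ket_of_zero (hz k (by omega)), run_cnot_ket (hzr k).symm,
      ih (fun i hi j hj => hinj i (by omega) j (by omega)) fun j hj => hz j (by omega)]
    have h1 : (Function.update b (z k) 1) r + (Function.update b (z k) 1) (z k) = 0 := by
      simp [Function.update_of_ne (hzr k), hr]
    -- In the branch where `z k` has been excited the flag is down, so the rest of the scan is idle.
    rw [h1, run_scan_of_zero (by simp)]
    · rw [Finset.sum_range_succ, smul_add, Finset.smul_sum, smul_smul, ← pow_succ',
        Nat.add_sub_cancel_left, pow_one, add_assoc]
      congr 2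
      refine Finset.sum_congr rfl fun j hj => ?_
      rw [smul_smul, ← pow_succ', Nat.succ_sub (Finset.mem_range.1 hj).le]
    · intro j hj
      have h2 : z j ≠ z k := fun h => by
        have := hinj j (by omega) k (by omega) h
        omega
      rw [Function.update_of_ne (hzr j).symm, Function.update_of_ne h2, hz j (by omega)]

/-- This clears the flag after the scan: it is still up exactly when there is one excitation, of odd
parity, rather than two. -/
theorem run_addParity {z : ℕ → ι} {r : ι} (hzr : ∀ j, r ≠ z j) (k : ℕ) (b : ι → Fin 2) :
    Circuit.run (addParity z r k) (ket b) =
      ket (Function.update b r (b r + ∑ j ∈ Finset.range k, b (z j))) := by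
  induction k generalizing b with
  | zero => simp [addParity, Circuit.run_nil]
  | succ k ih =>
    rw [addParity, Circuit.run_append, run_cnot_ket (hzr k).symm, ih]
    congr 1
    simp only [Function.update_self, Function.update_idem, Function.update_of_ne (hzr _).symm]
    rw [Finset.sum_range_succ, add_assoc, add_comm (b (z k))]

theorem run_suffixSum_of_zero {x : ℕ → ι} {k l : ℕ} (hkl : k ≤ l) {b : ι → Fin 2}
    (hb : ∀ j, k < j → j ≤ l → b (x j) = 0) :
    Circuit.run (suffixSum x l) (ket b) = Circuit.run (suffixSum x k) (ket b) := by
  induction l, hkl using Nat.le_induction with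
  | base => rfl
  | succ l hl ih =>
    rw [suffixSum, Circuit.run_append, run_cnot_ket_of_zero (hb (l + 1) (by omega) le_rfl),
      ih fun j h1 h2 => hb j h1 (by omega)]

/-- The CNOTs run from the top down, so the excitation of `x k` is copied onto every lower qubit in
turn: the bit pattern of a carry that ends at `k`. -/
theorem run_suffixSum_of_one {x : ℕ → ι} {k : ℕ} (hinj : ∀ i ≤ k, ∀ j ≤ k, x i = x j → i = j)
    {b : ι → Fin 2} (hk : b (x k) = 1) (hb : ∀ j < k, b (x j) = 0) :
    Circuit.run (suffixSum x k) (ket b) =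
      ket (fun q => if ∃ j < k, q = x j then 1 else b q) := by
  induction k generalizing b with
  | zero => simp [suffixSum, Circuit.run_nil]
  | succ k ih =>
    have hne : x (k + 1) ≠ x k := fun h => by
      have := hinj (k + 1) le_rfl k (by omega) h
      omega
    rw [suffixSum, Circuit.run_append, run_cnot_ket hne, hb k (by omega), hk, zero_add,
      ih (fun i hi j hj => hinj i (by omega) j (by omega)) (by simp)]
    · congr 1
      ext q
      by_cases h1 : ∃ j < k, q = x j
      · obtain ⟨j, hj, rfl⟩ := h1
        rw [if_pos ⟨j, hj, rfl⟩, if_pos ⟨j, by omega, rfl⟩]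
      · rw [if_neg h1]
        by_cases h2 : q = x k
        · rw [if_pos ⟨k, by omega, h2⟩, h2]; simp
        · rw [Function.update_of_ne h2, if_neg]
          rintro ⟨j, hj, rfl⟩
          rcases Nat.lt_succ_iff_lt_or_eq.1 hj with h | rfl
          · exact h1 ⟨j, h, rfl⟩
          · exact h2 rfl
    · intro j hj
      have h2 : x j ≠ x k := fun h => by
        have := hinj j (by omega) k (by omega) h
        omega
      rw [Function.update_of_ne h2, hb j (by omega)]

/-- The first CNOT removes from `p` what the second one adds. Without it, strings of the field
energy, which may have `t` excited while `c` is not, would be disturbed. -/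
theorem run_parityHad_of_zero {p c t : ι} (hcp : c ≠ p) (htp : t ≠ p) {b : ι → Fin 2}
    (hb : b c = 0) : Circuit.run (parityHad p c t) (ket b) = ket b := by
  rw [parityHad, Circuit.run_append, Circuit.run_append, run_cnot_ket htp,
    run_had_ket_of_zero (by rw [Function.update_of_ne hcp, hb]), run_cnot_ket htp]
  congr 1
  simp only [Function.update_self, Function.update_idem, Function.update_of_ne htp]
  have : b p + b t + b t = b p := by
    rcases fin_two_eq (b p) with h | h <;> rcases fin_two_eq (b t) with h' | h' <;> simp [h, h']
  rw [this, Function.update_eq_self]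

theorem run_parityHads_of_zero {x z : ℕ → ι} {p : ι} {k : ℕ} (hx : ∀ j, x j ≠ p)
    (hz : ∀ j, z j ≠ p) {b : ι → Fin 2} (hb : ∀ j < k, b (x j) = 0) :
    Circuit.run (parityHads x z p k) (ket b) = ket b := by
  induction k with
  | zero => rfl
  | succ k ih =>
    rw [parityHads, Circuit.run_append, run_parityHad_of_zero (hx k) (hz k) (hb k (by omega)),
      ih fun j hj => hb j (by omega)]

/-- The uniform superposition of the strings that agree with `b₀` off `S` and have even parity
on `S`. -/
def evenState (S : Finset ι) (b₀ : ι → Fin 2) : State ι := fun b =>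
  if (∀ q, q ∉ S → b q = b₀ q) ∧ ∑ q ∈ S, b q = 0 then ((√2)⁻¹ : ℂ) ^ (S.card - 1) else 0

/-- Linearity: it is enough to check the basis strings that occur in the state. -/
theorem run_eq_self_of_support {C : Circuit ι} {ψ : State ι}
    (h : ∀ b, ψ b ≠ 0 → C.run (ket b) = ket b) : C.run ψ = ψ := by
  rw [run_eq_sum_ket]
  ext d
  rw [Finset.sum_apply, Finset.sum_eq_single d]
  · by_cases hd : ψ d = 0
    · simp [hd]
    · simp [h d hd]
  · intro b _ hb
    by_cases hd : ψ b = 0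
    · simp [hd]
    · rw [h b hd]
      simp [hb.symm]
  · simp

/-- On the support `t` is `0`, so the first CNOT is idle. The Hadamard makes `t` a free bit, and the
second CNOT adds it to `p`, which keeps the parity of the enlarged set even; the amplitude gains one
factor `1/√2`. -/
theorem run_parityHad_evenState {p c t : ι} {S : Finset ι} {b₀ : ι → Fin 2} (hp : p ∈ S)
    (hc : c ∉ S) (ht : t ∉ S) (hct : c ≠ t) (hbc : b₀ c = 1) (hbt : b₀ t = 0) :
    Circuit.run (parityHad p c t) (evenState S b₀) = evenState (insert t S) b₀ := by
  have htp : t ≠ p := fun h => ht (h ▸ hp)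
  have hcp : c ≠ p := fun h => hc (h ▸ hp)
  rw [parityHad, Circuit.run_append, Circuit.run_append,
    run_eq_self_of_support (C := cnot t p) (ψ := evenState S b₀)]
  · ext b
    rw [run_cnot_apply htp, run_had_apply hct, Function.update_of_ne hcp]
    · split_ifs with h
      · have h1 : ¬ ∀ q, q ∉ S → (Function.update b p (b p + b t)) q = b₀ q := by
          intro h'
          have := h' c hc
          rw [Function.update_of_ne hcp, h, hbc] at this
          simp at this
        have h2 : ¬ ∀ q, q ∉ insert t S → b q = b₀ q := by
          intro h'
          have := h' c (by simp [hct, hc])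
          rw [h, hbc] at this
          simp at this
        rw [evenState, evenState, if_neg fun h => h1 h.1, if_neg fun h => h2 h.1]
      · have h1 : (∀ q, q ∉ S → Function.update (Function.update b p (b p + b t)) t 0 q = b₀ q) ↔
            ∀ q, q ∉ insert t S → b q = b₀ q := by
          refine forall_congr' fun q => ?_
          by_cases hqt : q = t
          · subst hqt; simp [hbt]
          · by_cases hqp : q = p
            · subst hqp; simp [hp]
            · simp [hqt, hqp]
        have h2 : ∑ q ∈ S, Function.update (Function.update b p (b p + b t)) t 0 q =
            ∑ q ∈ insert t S, b q := by
          rw [Finset.sum_insert ht, ← Finset.add_sum_erase _ _ hp, ← Finset.add_sum_erase S b hp,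
            Function.update_of_ne htp.symm, Function.update_self]
          have : ∑ x ∈ S.erase p, Function.update (Function.update b p (b p + b t)) t 0 x =
              ∑ x ∈ S.erase p, b x := by
            refine Finset.sum_congr rfl fun q hq => ?_
            have hqS := Finset.mem_of_mem_erase hq
            have hqt : q ≠ t := fun h => ht (h ▸ hqS)
            simp [hqt, Finset.ne_of_mem_erase hq]
          rw [this]
          abel
        -- The truncated subtraction in the exponent is harmless because `p` lies in `S`.
        have hcard : S.card = (S.card - 1) + 1 := by
          have := Finset.card_pos.2 ⟨p, hp⟩
          omega
        simp only [evenState, h1, h2]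
        rw [Finset.card_insert_of_notMem ht, mul_ite, mul_zero,
          Nat.add_sub_cancel, ← pow_succ', ← hcard]
    · intro b _ hb
      rw [evenState, if_neg]
      intro h
      have := h.1 t ht
      rw [hb, hbt] at this
      simp at this
  · intro b hb
    apply run_cnot_ket_of_zero
    by_contra h
    apply hb
    rw [evenState, if_neg]
    intro h'
    exact h ((h'.1 t ht).trans hbt)

/-- The controls `x j` lie outside the growing support, so they keep their values from `b₀` and
select which `z j` join it. -/
theorem run_parityHads_evenState {x z : ℕ → ι} {p : ι} {k : ℕ} {S : Finset ι} {b₀ : ι → Fin 2}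
    (hp : p ∈ S) (hx : ∀ j, x j ∉ S) (hz : ∀ j < k, z j ∉ S) (hxz : ∀ i j, x i ≠ z j)
    (hinj : ∀ i < k, ∀ j < k, z i = z j → i = j) (hb : ∀ j < k, b₀ (z j) = 0) :
    Circuit.run (parityHads x z p k) (evenState S b₀) =
      evenState (S ∪ ((Finset.range k).filter fun j => b₀ (x j) = 1).image z) b₀ := by
  induction k generalizing S with
  | zero => simp [parityHads, Circuit.run_nil]
  | succ k ih =>
    rw [parityHads, Circuit.run_append, Finset.range_add_one, Finset.filter_insert]
    split_ifs with h
    · rw [run_parityHad_evenState hp (hx k) (hz k (by omega)) (hxz k k) h (hb k (by omega)), ih]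
      · congr 1
        rw [Finset.image_insert, Finset.insert_union, Finset.union_insert]
      · simp [hp]
      · intro j; simp [hx j, hxz j k]
      · intro j hj
        have : z j ≠ z k := fun h => by
          have := hinj j (by omega) k (by omega) h
          omega
        simp [hz j (by omega), this]
      · exact fun i hi j hj => hinj i (by omega) j (by omega)
      · exact fun j hj => hb j (by omega)
    · rw [run_eq_self_of_support (C := parityHad p (x k) (z k)), ih hp hx (fun j hj => hz j (by omega))
        (fun i hi j hj => hinj i (by omega) j (by omega)) (fun j hj => hb j (by omega))]
      intro b hψ
      apply run_parityHad_of_zero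
      · exact fun h => hx k (h ▸ hp)
      · exact fun h => hz k (by omega) (h ▸ hp)
      · by_contra h'
        apply hψ
        rw [evenState, if_neg]
        intro h''
        rw [h''.1 _ (hx k)] at h'
        exact h ((fin_two_eq _).resolve_left h')

theorem evenState_singleton (p : ι) {b₀ : ι → Fin 2} (hp : b₀ p = 0) :
    evenState {p} b₀ = ket b₀ := by
  ext b
  rw [evenState, ket, Pi.single_apply]
  have : ((∀ q, q ∉ ({p} : Finset ι) → b q = b₀ q) ∧ ∑ q ∈ {p}, b q = 0) ↔ b = b₀ := by
    constructor
    · rintro ⟨h1, h2⟩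
      ext q
      by_cases hq : q = p
      · subst hq; rw [Finset.sum_singleton] at h2; rw [h2, hp]
      · rw [h1 q (by simpa using hq)]
    · rintro rfl; simp [hp]
  simp only [this, Finset.card_singleton, Nat.sub_self, pow_zero]

end Links

/-! ### Gate counts of the building blocks -/

section LinkCounts

variable {ι : Type} [DecidableEq ι]

theorem numT_cnot (c t : ι) : (cnot c t).numT = 0 := by
  unfold cnot; split_ifs <;> rfl
theorem numRz_cnot (c t : ι) : (cnot c t).numRz = 0 := by
  unfold cnot; split_ifs <;> rfl
theorem numCNOT_cnot (c t : ι) : (cnot c t).numCNOT ≤ 1 := by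
  unfold cnot; split_ifs <;> simp [Circuit.numCNOT, Gate.isCNOT]
theorem numT_had (c t : ι) : (had c t).numT ≤ 2 := by
  unfold had
  split_ifs
  · exact (numT_ctrlHad _).le
  · simp [Circuit.numT]
theorem numRz_had (c t : ι) : (had c t).numRz = 0 := by
  unfold had; split_ifs <;> rfl
theorem numCNOT_had (c t : ι) : (had c t).numCNOT ≤ 1 := by
  unfold had
  split_ifs
  · exact (numCNOT_ctrlHad _).le
  · simp [Circuit.numCNOT]

theorem counts_scan (z : ℕ → ι) (r : ι) (k : ℕ) : (scan z r k).numT ≤ 2 * k ∧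
    (scan z r k).numRz = 0 ∧ (scan z r k).numCNOT ≤ 2 * k := by
  induction k with
  | zero => simp [scan, Circuit.numT, Circuit.numRz, Circuit.numCNOT]
  | succ k ih =>
    have h1 := numT_had r (z k)
    have h2 := numRz_had r (z k)
    have h3 := numCNOT_had r (z k)
    have h4 := numT_cnot (z k) r
    have h5 := numRz_cnot (z k) r
    have h6 := numCNOT_cnot (z k) r
    simp only [scan, Circuit.numT_append, Circuit.numRz_append, Circuit.numCNOT_append]
    omega

theorem counts_addParity (z : ℕ → ι) (r : ι) (k : ℕ) :
    (addParity z r k).numT = 0 ∧ (addParity z r k).numRz = 0 ∧ (addParity z r k).numCNOT ≤ k := by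
  induction k with
  | zero => simp [addParity, Circuit.numT, Circuit.numRz, Circuit.numCNOT]
  | succ k ih =>
    have h4 := numT_cnot (z k) r
    have h5 := numRz_cnot (z k) r
    have h6 := numCNOT_cnot (z k) r
    simp only [addParity, Circuit.numT_append, Circuit.numRz_append, Circuit.numCNOT_append]
    omega

theorem counts_suffixSum (x : ℕ → ι) (k : ℕ) :
    (suffixSum x k).numT = 0 ∧ (suffixSum x k).numRz = 0 ∧ (suffixSum x k).numCNOT ≤ k := by
  induction k with
  | zero => simp [suffixSum, Circuit.numT, Circuit.numRz, Circuit.numCNOT]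
  | succ k ih =>
    have h4 := numT_cnot (x (k + 1)) (x k)
    have h5 := numRz_cnot (x (k + 1)) (x k)
    have h6 := numCNOT_cnot (x (k + 1)) (x k)
    simp only [suffixSum, Circuit.numT_append, Circuit.numRz_append, Circuit.numCNOT_append]
    omega

theorem counts_parityHad (p c t : ι) : (parityHad p c t).numT ≤ 2 ∧
    (parityHad p c t).numRz = 0 ∧ (parityHad p c t).numCNOT ≤ 3 := by
  have h1 := numT_had c t
  have h2 := numRz_had c t
  have h3 := numCNOT_had c t
  have h4 := numT_cnot t p
  have h5 := numRz_cnot t p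
  have h6 := numCNOT_cnot t p
  simp only [parityHad, Circuit.numT_append, Circuit.numRz_append, Circuit.numCNOT_append]
  omega

theorem counts_parityHads (x z : ℕ → ι) (p : ι) (k : ℕ) :
    (parityHads x z p k).numT ≤ 2 * k ∧ (parityHads x z p k).numRz = 0 ∧
      (parityHads x z p k).numCNOT ≤ 3 * k := by
  induction k with
  | zero => simp [parityHads, Circuit.numT, Circuit.numRz, Circuit.numCNOT]
  | succ k ih =>
    have h := counts_parityHad p (x k) (z k)
    simp only [parityHads, Circuit.numT_append, Circuit.numRz_append, Circuit.numCNOT_append]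
    omega

end LinkCounts

/-! ### The link circuit on single excitations -/

section LinkCircuit

variable {ι : Type} [Fintype ι] [DecidableEq ι]

theorem one_apply_of_ne {ι : Type} [DecidableEq ι] {q q' : ι} (h : q' ≠ q) : one q q' = 0 :=
  Pi.single_eq_of_ne h _

/-- The qubits that a link acts on: the `x` and `z` qubits of the link and of its two ends, and a
scratch qubit `r`. -/
structure LinkLayout (ι : Type) (m : ℕ) where
  x : ℕ → ι
  z : ℕ → ι
  xl : ι
  xr : ι
  zl : ι
  zr : ι
  r : ι
  x_inj : ∀ i < m, ∀ j < m, x i = x j → i = j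
  z_inj : ∀ i < m, ∀ j < m, z i = z j → i = j
  x_ne_z : ∀ i j, x i ≠ z j
  r_ne_x : ∀ i, r ≠ x i
  r_ne_z : ∀ i, r ≠ z i
  xl_ne_x : ∀ i, xl ≠ x i
  xr_ne_x : ∀ i, xr ≠ x i
  xl_ne_z : ∀ i, xl ≠ z i
  xr_ne_z : ∀ i, xr ≠ z i
  zl_ne_x : ∀ i, zl ≠ x i
  zr_ne_x : ∀ i, zr ≠ x i
  zl_ne_z : ∀ i, zl ≠ z i
  zr_ne_z : ∀ i, zr ≠ z i
  xl_ne_xr : xl ≠ xr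
  zl_ne_zr : zl ≠ zr
  zl_ne_xl : zl ≠ xl
  zl_ne_xr : zl ≠ xr
  zr_ne_xl : zr ≠ xl
  zr_ne_xr : zr ≠ xr

namespace LinkLayout

variable {m : ℕ}

/-- Expands a single excitation of `x k` to the Pauli strings of a hopping term. -/
def hopCircuit (L : LinkLayout ι m) : Circuit ι :=
  suffixSum L.x (m - 1) ++ cnot (L.x 0) L.xl ++ cnot (L.x 0) L.xr ++
    parityHad L.zr (L.x 0) L.zl ++ parityHads L.x L.z L.zr (m - 1)

/-- Expands a single excitation of a qubit of the link to the Pauli strings of its term. -/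
def circuit (L : LinkLayout ι m) : Circuit ι :=
  scan L.z L.r m ++ addParity L.z L.r m ++ L.hopCircuit

theorem run_hopCircuit_of_zero (L : LinkLayout ι m) {b : ι → Fin 2} (hx : ∀ i, b (L.x i) = 0) :
    L.hopCircuit.run (ket b) = ket b := by
  simp only [hopCircuit, Circuit.run_append]
  rw [run_suffixSum_of_zero (Nat.zero_le _) fun j _ _ => hx j]
  simp only [suffixSum, Circuit.run_nil]
  rw [run_cnot_ket_of_zero (hx 0), run_cnot_ket_of_zero (hx 0),
    run_parityHad_of_zero (L.zr_ne_x 0).symm L.zl_ne_zr (hx 0),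
    run_parityHads_of_zero (fun j => (L.zr_ne_x j).symm) (fun j => (L.zr_ne_z j).symm)
      fun j _ => hx j]

/-- Only the scratch qubit and the link's own qubits need to be `0`; the qubits of the end sites are
arbitrary. This is why links that share a site do not interfere. -/
theorem run_circuit_of_zero (L : LinkLayout ι m) {b : ι → Fin 2} (hr : b L.r = 0)
    (hx : ∀ i, b (L.x i) = 0) (hz : ∀ i, b (L.z i) = 0) :
    L.circuit.run (ket b) = ket b := by
  simp only [circuit, Circuit.run_append]
  rw [run_scan_of_zero hr fun j _ => hz j, run_addParity L.r_ne_z, Finset.sum_eq_zero fun j _ => hz j,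
    add_zero, Function.update_eq_self, L.run_hopCircuit_of_zero hx]

/-- Bits above `k` are passed untouched, the excitation of `z k` raises the flag, and the coin
tosses run below `k`. The parity step then returns the flag to `0`, and the hopping part is idle
since all `x` qubits are `0`. -/
theorem run_circuit_z (L : LinkLayout ι m) {k : ℕ} (hk : k < m) :
    L.circuit.run (ket (one (L.z k))) = ((√2)⁻¹ : ℂ) ^ k • ket (one (L.z k)) +
      ∑ j ∈ Finset.range k, ((√2)⁻¹ : ℂ) ^ (k - j) • ket (one (L.z k) + one (L.z j)) := by
  have hzne : ∀ j < m, j ≠ k → L.z j ≠ L.z k := fun j hj hjk h => hjk (L.z_inj j hj k hk h)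
  -- the bits above `k`
  have h1 : ∀ l, k < l → l ≤ m → (scan L.z L.r l).run (ket (one (L.z k))) =
      (scan L.z L.r (k + 1)).run (ket (one (L.z k))) := by
    intro l hl
    induction l, hl using Nat.le_induction with
    | base => exact fun _ => rfl
    | succ l hl ih =>
      intro hlm
      rw [scan, Circuit.run_append, Circuit.run_append,
        run_had_ket_of_zero (by simp [L.r_ne_z]), run_cnot_ket_of_zero, ih (by omega)]
      rw [one_apply_of_ne (hzne l (by omega) (by omega))]
  have hsum : ∀ (l : ℕ), l < m → ∑ j ∈ Finset.range m, (one (L.z l)) (L.z j) = 1 := by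
    intro l hl
    rw [Finset.sum_eq_single l]
    · simp
    · intro j hj hjl
      rw [one_apply_of_ne]
      exact fun h => hjl (L.z_inj j (Finset.mem_range.1 hj) l hl h)
    · intro h; simp [hl] at h
  have hr : ∀ j, L.z j ≠ L.r := fun j => (L.r_ne_z j).symm
  rw [circuit, Circuit.run_append, Circuit.run_append, h1 m hk le_rfl, scan, Circuit.run_append,
    Circuit.run_append, run_had_ket_of_zero (by simp [L.r_ne_z]), run_cnot_ket (hr k),
    run_scan_of_one L.r_ne_z (fun i hi j hj => L.z_inj i (by omega) j (by omega))
      (by simp [L.r_ne_z])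
      (fun j hj => by
        rw [Function.update_of_ne (hr j), one_apply_of_ne (hzne j (by omega) (by omega))])]
  simp only [Circuit.run_add, Circuit.run_smul, Circuit.run_sum]
  congr 1
  · congr 1
    rw [run_addParity L.r_ne_z]
    have : Function.update (Function.update (one (L.z k)) L.r ((one (L.z k)) L.r +
        (one (L.z k)) (L.z k))) L.r ((Function.update (one (L.z k)) L.r ((one (L.z k)) L.r +
        (one (L.z k)) (L.z k))) L.r + ∑ j ∈ Finset.range m, (Function.update (one (L.z k)) L.r
        ((one (L.z k)) L.r + (one (L.z k)) (L.z k))) (L.z j)) = one (L.z k) := by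
      simp only [Function.update_of_ne (hr _), Function.update_idem, Function.update_self, hsum k hk]
      ext q
      by_cases hq : q = L.r
      · subst hq; simp [L.r_ne_z]
      · simp [hq]
    rw [this, L.run_hopCircuit_of_zero]
    intro i
    simp [L.x_ne_z]
  · refine Finset.sum_congr rfl fun j hj => ?_
    have hj := Finset.mem_range.1 hj
    have hjk := hzne j (by omega) (by omega)
    congr 1
    have e1 : Function.update (Function.update (Function.update (one (L.z k)) L.r
        ((one (L.z k)) L.r + (one (L.z k)) (L.z k))) (L.z j) 1) L.r 0 =
        one (L.z k) + one (L.z j) := by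
      ext q
      by_cases hq : q = L.r
      · subst hq; simp [L.r_ne_z]
      · by_cases hq2 : q = L.z j
        · subst hq2; simp [hq, hjk]
        · simp [hq, hq2]
    rw [e1, run_addParity L.r_ne_z]
    -- Two excitations have even parity, so the flag, already lowered by the success at `j`, stays
    -- down.
    have e2 : ∑ i ∈ Finset.range m, (one (L.z k) + one (L.z j) : ι → Fin 2) (L.z i) = 0 := by
      simp only [Pi.add_apply, Finset.sum_add_distrib]
      rw [hsum k hk, hsum j (by omega)]
      rfl
    rw [e2, add_zero, Function.update_eq_self, L.run_hopCircuit_of_zero]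
    intro i
    simp [L.x_ne_z]

/-- The `x` bits of the hopping terms of the link that flip the bits `j ≤ k`. -/
def hopBits (L : LinkLayout ι m) (k : ℕ) : ι → Fin 2 := fun q =>
  if q = L.xl ∨ q = L.xr ∨ ∃ j ≤ k, q = L.x j then 1 else 0

/-- The `z` qubits that can be nonzero in the hopping terms that flip the bits `j ≤ k`. -/
def hopSupport (L : LinkLayout ι m) (k : ℕ) : Finset ι :=
  {L.zl, L.zr} ∪ ((Finset.range (m - 1)).filter fun j => j ≤ k).image L.z

/-- The scan is idle as no `z` qubit is excited. The suffix sums set all `x j` with `j ≤ k`; in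
particular `x 0` is set for every `k`, so it can control the flips of both sites and the Hadamard on
`zl`. -/
theorem run_circuit_x (L : LinkLayout ι m) {k : ℕ} (hk : k < m) :
    L.circuit.run (ket (one (L.x k))) = evenState (L.hopSupport k) (L.hopBits k) := by
  have hxne : ∀ j < m, j ≠ k → L.x j ≠ L.x k := fun j hj hjk h => hjk (L.x_inj j hj k hk h)
  simp only [circuit, hopCircuit, Circuit.run_append]
  rw [run_scan_of_zero (by simp [L.r_ne_x]) fun j _ => by simp [(L.x_ne_z k j).symm],
    run_addParity L.r_ne_z, Finset.sum_eq_zero fun j _ => by simp [(L.x_ne_z k j).symm],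
    add_zero, Function.update_eq_self,
    run_suffixSum_of_zero (k := k) (by omega) fun j h1 h2 => by
      rw [one_apply_of_ne (hxne j (by omega) (by omega))],
    run_suffixSum_of_one (fun i hi j hj => L.x_inj i (by omega) j (by omega)) (by simp)
      fun j hj => by rw [one_apply_of_ne (hxne j (by omega) (by omega))],
    run_cnot_ket (L.xl_ne_x 0).symm, run_cnot_ket (L.xr_ne_x 0).symm]
  have hx0 : (if ∃ j < k, L.x 0 = L.x j then 1 else one (L.x k) (L.x 0) : Fin 2) = 1 := by
    split_ifs with h
    · rfl
    · rcases Nat.eq_zero_or_pos k with rfl | hpos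
      · simp
      · exact absurd ⟨0, hpos, rfl⟩ h
  have hb : Function.update (Function.update (fun q => if ∃ j < k, q = L.x j then 1 else
      one (L.x k) q) L.xl ((if ∃ j < k, L.xl = L.x j then 1 else one (L.x k) L.xl) +
        (if ∃ j < k, L.x 0 = L.x j then 1 else one (L.x k) (L.x 0)))) L.xr
      (Function.update (fun q => if ∃ j < k, q = L.x j then 1 else
      one (L.x k) q) L.xl ((if ∃ j < k, L.xl = L.x j then 1 else one (L.x k) L.xl) +
        (if ∃ j < k, L.x 0 = L.x j then 1 else one (L.x k) (L.x 0))) L.xr +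
      Function.update (fun q => if ∃ j < k, q = L.x j then 1 else
      one (L.x k) q) L.xl ((if ∃ j < k, L.xl = L.x j then 1 else one (L.x k) L.xl) +
        (if ∃ j < k, L.x 0 = L.x j then 1 else one (L.x k) (L.x 0))) (L.x 0)) =
      L.hopBits k := by
    rw [Function.update_of_ne L.xl_ne_xr.symm, Function.update_of_ne (L.xl_ne_x 0).symm, hx0]
    ext q
    rw [hopBits]
    by_cases h1 : q = L.xr
    · subst h1
      simp [L.xr_ne_x]
    · rw [Function.update_of_ne h1]
      by_cases h2 : q = L.xl
      · subst h2
        simp [L.xl_ne_x]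
      · rw [Function.update_of_ne h2]
        by_cases h3 : q = L.x k
        · subst h3
          simp only [Pi.single_eq_same, ite_self]
          rw [if_pos (Or.inr (Or.inr ⟨k, le_rfl, rfl⟩))]
        · have : (∃ j < k, q = L.x j) ↔ q = L.xl ∨ q = L.xr ∨ ∃ j ≤ k, q = L.x j := by
            simp only [h1, h2, false_or]
            constructor
            · rintro ⟨j, hj, rfl⟩; exact ⟨j, hj.le, rfl⟩
            · rintro ⟨j, hj, rfl⟩
              exact ⟨j, lt_of_le_of_ne hj fun h => h3 (h ▸ rfl), rfl⟩
          simp [this, h3]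
  rw [hb]
  have hbx : ∀ j < m, L.hopBits k (L.x j) = 1 ↔ j ≤ k := by
    intro j hj
    rw [hopBits]
    simp only [(L.xl_ne_x j).symm, (L.xr_ne_x j).symm, false_or]
    constructor
    · intro h
      by_contra hjk
      rw [if_neg] at h
      · simp at h
      · rintro ⟨i, hi, hij⟩
        have := L.x_inj j hj i (by omega) hij
        omega
    · intro h
      rw [if_pos ⟨j, h, rfl⟩]
  have hbz : ∀ j, L.hopBits k (L.z j) = 0 := fun j => by
    simp [hopBits, (L.xl_ne_z j).symm, (L.xr_ne_z j).symm, fun i => (L.x_ne_z i j).symm]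
  have hbl : L.hopBits k L.zl = 0 := by
    simp [hopBits, L.zl_ne_xl, L.zl_ne_xr, L.zl_ne_x]
  have hbr : L.hopBits k L.zr = 0 := by
    simp [hopBits, L.zr_ne_xl, L.zr_ne_xr, L.zr_ne_x]
  -- A basis string with `zr = 0` is the even superposition on `{zr}`; this starts the growth of the
  -- support, with `zr` as parity qubit.
  rw [← evenState_singleton L.zr hbr, run_parityHad_evenState (by simp)
    (by simp [(L.zr_ne_x 0).symm]) (by simp [L.zl_ne_zr]) (L.zl_ne_x 0).symm
    ((hbx 0 (by omega)).2 (by omega)) hbl, run_parityHads_evenState (by simp)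
    (fun j => by simp [(L.zl_ne_x j).symm, (L.zr_ne_x j).symm])
    (fun j _ => by simp [(L.zl_ne_z j).symm, (L.zr_ne_z j).symm]) L.x_ne_z
    (fun i hi j hj => L.z_inj i (by omega) j (by omega)) fun j _ => hbz j]
  congr 1
  rw [hopSupport]
  congr 2
  refine Finset.filter_congr fun j hj => ?_
  rw [Finset.mem_range] at hj
  exact hbx j (by omega)

/-- The T gates come from `2m` controlled Hadamards: `m` in the scan, `m - 1` on link bits and one
on a site. -/
theorem counts_circuit (L : LinkLayout ι m) (hm : 1 ≤ m) : L.circuit.numT ≤ 4 * m ∧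
    L.circuit.numRz = 0 ∧ L.circuit.numCNOT ≤ 7 * m + 1 := by
  have h1 := counts_scan L.z L.r m
  have h2 := counts_addParity L.z L.r m
  have h3 := counts_suffixSum L.x (m - 1)
  have h4 := numT_cnot (L.x 0) L.xl
  have h5 := numRz_cnot (L.x 0) L.xl
  have h6 := numCNOT_cnot (L.x 0) L.xl
  have h7 := numT_cnot (L.x 0) L.xr
  have h8 := numRz_cnot (L.x 0) L.xr
  have h9 := numCNOT_cnot (L.x 0) L.xr
  have h10 := counts_parityHad L.zr (L.x 0) L.zl
  have h11 := counts_parityHads L.x L.z L.zr (m - 1)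
  simp only [circuit, hopCircuit, Circuit.numT_append, Circuit.numRz_append, Circuit.numCNOT_append]
  omega

end LinkLayout

end LinkCircuit

/-! ### Pauli coefficients of tensor products -/

section Pauli

variable {ι : Type} [Fintype ι] [DecidableEq ι]

theorem tensorOp_mul (A B : ι → Matrix (Fin 2) (Fin 2) ℂ) :
    tensorOp A * tensorOp B = tensorOp fun j => A j * B j := by
  ext b c
  simp only [tensorOp, Matrix.mul_apply, Matrix.of_apply]
  rw [Finset.prod_univ_sum, Fintype.piFinset_univ]
  simp only [Finset.prod_mul_distrib]

theorem trace_tensorOp (A : ι → Matrix (Fin 2) (Fin 2) ℂ) :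
    (tensorOp A).trace = ∏ j, (A j).trace := by
  simp only [tensorOp, Matrix.trace, Matrix.diag, Matrix.of_apply]
  rw [Finset.prod_univ_sum, Fintype.piFinset_univ]

theorem conjTranspose_tensorOp (A : ι → Matrix (Fin 2) (Fin 2) ℂ) :
    (tensorOp A).conjTranspose = tensorOp fun j => (A j).conjTranspose := by
  ext b c
  simp [tensorOp, Matrix.conjTranspose_apply]

theorem tensorOp_one : tensorOp (fun _ : ι => (1 : Matrix (Fin 2) (Fin 2) ℂ)) = 1 := by
  ext b c
  simp only [tensorOp, Matrix.of_apply, Matrix.one_apply]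
  by_cases h : b = c
  · subst h; simp
  · rw [if_neg h]
    obtain ⟨j, hj⟩ := Function.ne_iff.1 h
    exact Finset.prod_eq_zero (Finset.mem_univ j) (by simp [hj])

/-- The operator `i ^ (x z) X ^ x Z ^ z`. -/
def pauli (x z : Fin 2) : Matrix (Fin 2) (Fin 2) ℂ :=
  Complex.I ^ ((x : ℕ) * (z : ℕ)) • (pauliX ^ (x : ℕ) * pauliZ ^ (z : ℕ))

theorem pauliString_eq (x z : ι → Fin 2) : pauliString x z = tensorOp fun j => pauli (x j) (z j) :=
  rfl

theorem conjTranspose_pauli (x z : Fin 2) : (pauli x z).conjTranspose = pauli x z := by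
  ext i j
  fin_cases x <;> fin_cases z <;> fin_cases i <;> fin_cases j <;>
    simp [pauli, pauliX, pauliZ]

/-- The coefficient of a single-qubit Pauli operator. -/
def singleCoeff (A : Matrix (Fin 2) (Fin 2) ℂ) (x z : Fin 2) : ℂ := (pauli x z * A).trace / 2

theorem pauliCoeff_tensorOp (A : ι → Matrix (Fin 2) (Fin 2) ℂ) (x z : ι → Fin 2) :
    pauliCoeff (tensorOp A) x z = ∏ j, singleCoeff (A j) (x j) (z j) := by
  rw [pauliCoeff, pauliString_eq, tensorOp_mul, trace_tensorOp]
  simp only [singleCoeff, Finset.prod_div_distrib, Finset.prod_const, Finset.card_univ]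

theorem pauliCoeff_add (A B : Op ι) (x z : ι → Fin 2) :
    pauliCoeff (A + B) x z = pauliCoeff A x z + pauliCoeff B x z := by
  simp [pauliCoeff, mul_add, add_div]

theorem pauliCoeff_smul (a : ℂ) (A : Op ι) (x z : ι → Fin 2) :
    pauliCoeff (a • A) x z = a * pauliCoeff A x z := by
  simp [pauliCoeff, mul_div_assoc]

theorem pauliCoeff_zero (x z : ι → Fin 2) : pauliCoeff (0 : Op ι) x z = 0 := by
  simp [pauliCoeff]

theorem pauliCoeff_sum {α : Type*} (s : Finset α) (A : α → Op ι) (x z : ι → Fin 2) :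
    pauliCoeff (∑ a ∈ s, A a) x z = ∑ a ∈ s, pauliCoeff (A a) x z := by
  simp [pauliCoeff, Finset.mul_sum, Matrix.trace_sum, Finset.sum_div]

/-- Pauli strings are Hermitian, so taking the adjoint conjugates each coefficient. -/
theorem pauliCoeff_conjTranspose (A : Op ι) (x z : ι → Fin 2) :
    pauliCoeff A.conjTranspose x z = star (pauliCoeff A x z) := by
  have h : (pauliString x z).conjTranspose = pauliString x z := by
    rw [pauliString_eq, conjTranspose_tensorOp]
    simp only [conjTranspose_pauli]
  have h2 : (pauliString x z * A.conjTranspose).trace = star (pauliString x z * A).trace := by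
    rw [← Matrix.trace_conjTranspose, Matrix.conjTranspose_mul, h, Matrix.trace_mul_comm]
  rw [pauliCoeff, pauliCoeff, h2]
  simp

theorem singleCoeff_pauli (x' z' x z : Fin 2) :
    singleCoeff (pauli x' z') x z = if x = x' ∧ z = z' then 1 else 0 := by
  fin_cases x <;> fin_cases z <;> fin_cases x' <;> fin_cases z' <;>
    simp [singleCoeff, pauli, pauliX, pauliZ, Matrix.trace]

theorem pauliCoeff_pauliString (x' z' x z : ι → Fin 2) :
    pauliCoeff (pauliString x' z') x z = if x = x' ∧ z = z' then 1 else 0 := by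
  rw [pauliString_eq, pauliCoeff_tensorOp]
  simp only [singleCoeff_pauli]
  by_cases h : x = x' ∧ z = z'
  · rw [if_pos h]
    obtain ⟨rfl, rfl⟩ := h
    simp
  · rw [if_neg h]
    have : ∃ j, ¬ (x j = x' j ∧ z j = z' j) := by
      by_contra hcon
      push Not at hcon
      exact h ⟨funext fun j => (hcon j).1, funext fun j => (hcon j).2⟩
    obtain ⟨j, hj⟩ := this
    exact Finset.prod_eq_zero (Finset.mem_univ j) (if_neg hj)

theorem pauliString_zero_zero : pauliString (0 : ι → Fin 2) 0 = 1 := by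
  rw [← tensorOp_one, pauliString_eq]
  simp [pauli]

theorem singleCoeff_one (x z : Fin 2) :
    singleCoeff 1 x z = if x = 0 ∧ z = 0 then 1 else 0 := by
  rw [← singleCoeff_pauli]; simp [pauli]

theorem singleCoeff_pauliX (x z : Fin 2) :
    singleCoeff pauliX x z = if x = 1 ∧ z = 0 then 1 else 0 := by
  rw [← singleCoeff_pauli]; simp [pauli]

theorem singleCoeff_sigmaPlus (x z : Fin 2) :
    singleCoeff sigmaPlus x z = if x = 1 then (1 / 2) * Complex.I ^ (z : ℕ) else 0 := by
  have h := Complex.I_mul_I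
  fin_cases x <;> fin_cases z <;>
    simp [singleCoeff, sigmaPlus, pauli, pauliX, pauliY, pauliZ, Matrix.trace] <;>
    ring_nf

theorem singleCoeff_sigmaMinus (x z : Fin 2) :
    singleCoeff sigmaMinus x z = if x = 1 then (1 / 2) * (-Complex.I) ^ (z : ℕ) else 0 := by
  have h := Complex.I_mul_I
  fin_cases x <;> fin_cases z <;>
    simp [singleCoeff, sigmaMinus, pauli, pauliX, pauliY, pauliZ, Matrix.trace] <;>
    ring_nf

/-- A product of factors `± i` is real or imaginary according to the parity of their number. -/
theorem prod_I_pow {S : Finset ι} {ε : ι → ℂ} (hε : ∀ q ∈ S, ε q = Complex.I ∨ ε q = -Complex.I)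
    (z : ι → Fin 2) :
    (∑ q ∈ S, z q = 0 → ∏ q ∈ S, ε q ^ (z q : ℕ) = 1 ∨ ∏ q ∈ S, ε q ^ (z q : ℕ) = -1) ∧
    (∑ q ∈ S, z q ≠ 0 → ∏ q ∈ S, ε q ^ (z q : ℕ) = Complex.I ∨
      ∏ q ∈ S, ε q ^ (z q : ℕ) = -Complex.I) := by
  induction S using Finset.induction_on with
  | empty => simp
  | insert a S ha ih =>
    obtain ⟨ih1, ih2⟩ := ih fun q hq => hε q (Finset.mem_insert_of_mem hq)
    have hI := Complex.I_mul_I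
    rw [Finset.sum_insert ha, Finset.prod_insert ha]
    rcases fin_two_eq (z a) with h | h
    · rw [h]; simpa using ⟨ih1, ih2⟩
    · rw [h]
      rcases fin_two_eq (∑ q ∈ S, z q) with h' | h'
      · rw [h']
        rcases ih1 h' with h1 | h1 <;> rcases hε a (Finset.mem_insert_self a S) with h2 | h2 <;>
          simp [h1, h2]
      · rw [h']
        rcases ih2 (by simp [h']) with h1 | h1 <;>
          rcases hε a (Finset.mem_insert_self a S) with h2 | h2 <;> simp [h1, h2]

/-- Since `σ± = (X ± iY) / 2`, the coefficients of the product are `2^(-c)` times a product of `±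
i`, one for each `Y`. Adding the adjoint doubles the real coefficients and cancels the imaginary
ones, so an even number of `Y` survives. -/
theorem norm_pauliCoeff_ladder {A : ι → Matrix (Fin 2) (Fin 2) ℂ} {S : Finset ι} {B : ι → Fin 2}
    (hS : ∀ q ∈ S, (A q = sigmaPlus ∨ A q = sigmaMinus) ∧ B q = 1)
    (hS' : ∀ q, q ∉ S → (A q = 1 ∧ B q = 0) ∨ (A q = pauliX ∧ B q = 1)) (x z : ι → Fin 2) :
    ‖pauliCoeff (tensorOp A + (tensorOp A).conjTranspose) x z‖ =
      if x = B ∧ (∀ q, q ∉ S → z q = 0) ∧ ∑ q ∈ S, z q = 0 then 2 * (1 / 2) ^ S.card else 0 := by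
  classical
  rw [pauliCoeff_add, pauliCoeff_conjTranspose, pauliCoeff_tensorOp]
  by_cases h : x = B ∧ ∀ q, q ∉ S → z q = 0
  · obtain ⟨rfl, hz⟩ := h
    let ε : ι → ℂ := fun q => if A q = sigmaPlus then Complex.I else -Complex.I
    have h1 : ∏ j, singleCoeff (A j) (x j) (z j) = (1 / 2) ^ S.card * ∏ q ∈ S, ε q ^ (z q : ℕ) := by
      rw [← Finset.prod_subset (Finset.subset_univ S), ← Finset.prod_const, ← Finset.prod_mul_distrib]
      · refine Finset.prod_congr rfl fun q hq => ?_
        obtain ⟨h1, h2⟩ := hS q hq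
        by_cases h3 : A q = sigmaPlus
        · simp only [ε, if_pos h3]
          rw [h3, singleCoeff_sigmaPlus, if_pos h2]
        · simp only [ε, if_neg h3]
          rw [h1.resolve_left h3, singleCoeff_sigmaMinus, if_pos h2]
      · intro q _ hq
        rcases hS' q hq with ⟨h1, h2⟩ | ⟨h1, h2⟩
        · rw [h1, singleCoeff_one, if_pos ⟨h2, hz q hq⟩]
        · rw [h1, singleCoeff_pauliX, if_pos ⟨h2, hz q hq⟩]
    have hε : ∀ q ∈ S, ε q = Complex.I ∨ ε q = -Complex.I := by
      intro q _
      simp only [ε]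
      split_ifs <;> simp
    obtain ⟨k1, k2⟩ := prod_I_pow hε z
    rw [h1]
    by_cases h2 : ∑ q ∈ S, z q = 0
    · rw [if_pos ⟨rfl, hz, h2⟩]
      have hn : ‖((1 : ℂ) / 2) ^ S.card + (1 / 2) ^ S.card‖ = 2 * (1 / 2) ^ S.card := by
        rw [← two_mul]
        simp
      rcases k1 h2 with h3 | h3 <;> rw [h3]
      · rw [mul_one, star_pow]
        simpa using hn
      · rw [← norm_neg, ← hn]
        congr 1
        simp
    · rw [if_neg fun h => h2 h.2.2]
      rcases k2 h2 with h3 | h3 <;> rw [h3] <;> simp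
  · rw [if_neg fun h' => h ⟨h'.1, h'.2.1⟩]
    have : ∃ j, singleCoeff (A j) (x j) (z j) = 0 := by
      by_contra hcon
      push Not at hcon
      apply h
      refine ⟨funext fun q => ?_, fun q hq => ?_⟩
      · by_contra hx
        apply hcon q
        by_cases hq : q ∈ S
        · obtain ⟨h1, h2⟩ := hS q hq
          rw [h2] at hx
          rcases h1 with h1 | h1
          · rw [h1, singleCoeff_sigmaPlus, if_neg hx]
          · rw [h1, singleCoeff_sigmaMinus, if_neg hx]
        · rcases hS' q hq with ⟨h1, h2⟩ | ⟨h1, h2⟩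
          · rw [h1, singleCoeff_one, if_neg fun h => hx (h.1.trans h2.symm)]
          · rw [h1, singleCoeff_pauliX, if_neg fun h => hx (h.1.trans h2.symm)]
      · by_contra hz
        apply hcon q
        rcases hS' q hq with ⟨h1, h2⟩ | ⟨h1, h2⟩
        · rw [h1, singleCoeff_one, if_neg fun h => hz h.2]
        · rw [h1, singleCoeff_pauliX, if_neg fun h => hz h.2]
    obtain ⟨j, hj⟩ := this
    rw [Finset.prod_eq_zero (Finset.mem_univ j) hj]
    simp

theorem onQubit_eq_tensorOp (i : ι) (A : Matrix (Fin 2) (Fin 2) ℂ) :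
    onQubit i A = tensorOp fun j => if j = i then A else 1 := by
  ext b c
  simp only [onQubit, tensorOp, Matrix.of_apply]
  rw [← Finset.mul_prod_erase _ _ (Finset.mem_univ i), if_pos rfl]
  split_ifs with h
  · rw [Finset.prod_eq_one, mul_one]
    intro j hj
    have hji := Finset.ne_of_mem_erase hj
    rw [if_neg hji, h j hji, Matrix.one_apply_eq]
  · push Not at h
    obtain ⟨j, hj, hbc⟩ := h
    rw [Finset.prod_eq_zero (Finset.mem_erase.2 ⟨hj, Finset.mem_univ j⟩), mul_zero]
    rw [if_neg hj, Matrix.one_apply_ne hbc]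

end Pauli

/-! ### The raising operator as a sum over carry lengths -/

section LinkOps

variable {N m : ℕ}

theorem onLink_tensorOp (n : Fin (N - 1)) (R : Fin m → Matrix (Fin 2) (Fin 2) ℂ) :
    onLink (N := N) n (tensorOp R) = tensorOp fun q => match q with
      | Sum.inl _ => 1
      | Sum.inr (n', j) => if n' = n then R j else 1 := by
  ext b c
  simp only [onLink, liftOp, tensorOp, Matrix.of_apply, Function.comp_apply]
  rw [Fintype.prod_sum_type, Fintype.prod_prod_type,
    ← Finset.mul_prod_erase (Finset.univ : Finset (Fin (N - 1))) _ (Finset.mem_univ n)]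
  simp only [if_true]
  split_ifs with h
  · have h1 : ∏ s : Fin N, (1 : Matrix (Fin 2) (Fin 2) ℂ) (b (Sum.inl s)) (c (Sum.inl s)) = 1 := by
      refine Finset.prod_eq_one fun s _ => ?_
      rw [h, Matrix.one_apply_eq]
      simp
    have h2 : ∏ n' ∈ Finset.univ.erase n, ∏ j : Fin m,
        (if n' = n then R j else 1) (b (Sum.inr (n', j))) (c (Sum.inr (n', j))) = 1 := by
      refine Finset.prod_eq_one fun n' hn' => Finset.prod_eq_one fun j _ => ?_
      have hn := Finset.ne_of_mem_erase hn'
      rw [if_neg hn, h, Matrix.one_apply_eq]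
      simp [hn.symm]
    rw [h1, h2, one_mul, mul_one]
  · push Not at h
    obtain ⟨q, hq, hbc⟩ := h
    rcases q with s | ⟨n', j⟩
    · rw [Finset.prod_eq_zero (Finset.mem_univ s), zero_mul]
      rw [Matrix.one_apply_ne hbc]
    · have hn : n' ≠ n := by
        rintro rfl
        exact hq ⟨j, rfl⟩
      have : ∏ n' ∈ Finset.univ.erase n, ∏ j : Fin m,
          (if n' = n then R j else 1) (b (Sum.inr (n', j))) (c (Sum.inr (n', j))) = 0 := by
        refine Finset.prod_eq_zero (Finset.mem_erase.2 ⟨hn, Finset.mem_univ n'⟩) ?_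
        refine Finset.prod_eq_zero (Finset.mem_univ j) ?_
        rw [if_neg hn, Matrix.one_apply_ne hbc]
      rw [this]
      simp

theorem onLink_sum {α : Type*} (n : Fin (N - 1)) (s : Finset α) (A : α → Op (Fin m)) :
    onLink (N := N) n (∑ a ∈ s, A a) = ∑ a ∈ s, onLink n (A a) := by
  ext b c
  simp only [onLink, liftOp, Matrix.of_apply, Matrix.sum_apply]
  split_ifs <;> simp

theorem linkValue_succ (b : Fin (m + 1) → Fin 2) :
    linkValue b = (b 0 : ℕ) + 2 * linkValue fun j => b j.succ := by
  simp only [linkValue, Fin.sum_univ_succ, Fin.val_zero, pow_zero, mul_one, Fin.val_succ,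
    Finset.mul_sum]
  congr 1
  refine Finset.sum_congr rfl fun j _ => ?_
  ring

theorem linkValue_lt (b : Fin m → Fin 2) : linkValue b < 2 ^ m := by
  induction m with
  | zero => simp [linkValue]
  | succ m ih =>
    have h := ih fun j => b j.succ
    rw [linkValue_succ, pow_succ]
    have := (b 0).isLt
    omega

theorem linkValue_injective : Function.Injective (linkValue (m := m)) := by
  induction m with
  | zero => exact fun b c _ => funext fun j => j.elim0
  | succ m ih =>
    intro b c h
    rw [linkValue_succ, linkValue_succ] at h
    have h0 := (b 0).isLt
    have h1 := (c 0).isLt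
    have h2 : (b 0 : ℕ) = c 0 := by omega
    have h3 := ih (a₁ := fun j => b j.succ) (a₂ := fun j => c j.succ) (by omega)
    ext j
    refine Fin.cases ?_ (fun i => ?_) j
    · exact h2
    · exact congrArg Fin.val (congrFun h3 i)

/-- The factors of the term of the raising operator that flips exactly the bits `j ≤ k`. -/
def ladder (m : ℕ) (k j : Fin m) : Matrix (Fin 2) (Fin 2) ℂ :=
  if j < k then sigmaPlus else if j = k then (if (k : ℕ) + 1 = m then pauliX else sigmaMinus) else 1

/-- Addition of one at the lowest digit: either `0` becomes `1` and the higher digits stay, or `1`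
becomes `0` and the carry raises the higher digits. -/
theorem raising_succ (b c : Fin (m + 1) → Fin 2) : raising (m + 1) b c =
    sigmaMinus (b 0) (c 0) * (1 : Op (Fin m)) (fun j => b j.succ) (fun j => c j.succ) +
    sigmaPlus (b 0) (c 0) * raising m (fun j => b j.succ) (fun j => c j.succ) := by
  simp only [raising, Matrix.of_apply, linkValue_succ, Matrix.one_apply]
  generalize hb : (fun j : Fin m => b j.succ) = b'
  generalize hc : (fun j : Fin m => c j.succ) = c'
  have hm : 2 ^ (m + 1) = 2 * 2 ^ m := by ring
  have h2 : ∀ s t : ℕ, s ≡ t [MOD 2 ^ (m + 1)] → s % 2 = t % 2 := by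
    intro s t h
    exact Nat.ModEq.of_dvd ⟨2 ^ m, hm⟩ h
  have hbc : linkValue b' ≡ linkValue c' [MOD 2 ^ m] ↔ b' = c' := by
    constructor
    · intro h
      rw [Nat.ModEq, Nat.mod_eq_of_lt (linkValue_lt _), Nat.mod_eq_of_lt (linkValue_lt _)] at h
      exact linkValue_injective h
    · rintro rfl; rfl
  rcases fin_two_eq (b 0) with h0 | h0 <;> rcases fin_two_eq (c 0) with h1 | h1 <;> rw [h0, h1]
  · rw [if_neg]
    · simp [sigmaMinus, sigmaPlus, pauliX, pauliY]
    · intro h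
      have := h2 _ _ h
      simp at this
  · have : (((0 : Fin 2) : ℕ) + 2 * linkValue b' ≡ ((1 : Fin 2) : ℕ) + 2 * linkValue c' + 1
        [MOD 2 ^ (m + 1)]) ↔ linkValue b' ≡ linkValue c' + 1 [MOD 2 ^ m] := by
      rw [hm, Fin.val_zero, Fin.val_one, zero_add,
        show 1 + 2 * linkValue c' + 1 = 2 * (linkValue c' + 1) by ring]
      exact Nat.ModEq.mul_left_cancel_iff' (c := 2) two_ne_zero
    simp only [this]
    simp [sigmaMinus, sigmaPlus, pauliX, pauliY]
    norm_num
  · have : (((1 : Fin 2) : ℕ) + 2 * linkValue b' ≡ ((0 : Fin 2) : ℕ) + 2 * linkValue c' + 1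
        [MOD 2 ^ (m + 1)]) ↔ b' = c' := by
      rw [← hbc, hm, Fin.val_zero, Fin.val_one, zero_add, add_comm 1,
        Nat.ModEq.add_iff_right (Nat.ModEq.refl 1)]
      exact Nat.ModEq.mul_left_cancel_iff' (c := 2) two_ne_zero
    simp only [this]
    simp [sigmaMinus, sigmaPlus, pauliX, pauliY]
    norm_num
  · rw [if_neg]
    · simp [sigmaMinus, sigmaPlus, pauliX, pauliY]
    · intro h
      have := h2 _ _ h
      simp at this
      omega

/-- Iterating the carry rule lowers the digits below `k` and raises digit `k`. On the single top
digit, raising modulo `2` is `X`; this is the base case and the origin of the exceptional factor in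
`ladder`. -/
theorem raising_eq_sum (hm : 1 ≤ m) : raising m = ∑ k, tensorOp (ladder m k) := by
  induction m, hm using Nat.le_induction with
  | base =>
    ext b c
    simp only [raising, linkValue, ladder, tensorOp, Matrix.of_apply, Fin.sum_univ_one,
      Fin.prod_univ_one, Matrix.sum_apply]
    rcases fin_two_eq (b 0) with h0 | h0 <;> rcases fin_two_eq (c 0) with h1 | h1 <;>
      simp [h0, h1, pauliX, Nat.ModEq]
  | succ m hm ih =>
    ext b c
    rw [raising_succ, ih, Fin.sum_univ_succ, Matrix.add_apply, Matrix.sum_apply, Matrix.sum_apply,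
      Finset.mul_sum]
    congr 1
    · rw [← tensorOp_one]
      simp only [tensorOp, Matrix.of_apply]
      rw [Fin.prod_univ_succ]
      have h1 : ladder (m + 1) 0 0 = sigmaMinus := by
        simp [ladder]
        omega
      have h2 : ∀ j : Fin m, ladder (m + 1) 0 j.succ = 1 := by
        intro j; simp [ladder]
      simp only [h1, h2]
    · refine Finset.sum_congr rfl fun k _ => ?_
      simp only [tensorOp, Matrix.of_apply]
      rw [Fin.prod_univ_succ]
      have h1 : ladder (m + 1) k.succ 0 = sigmaPlus := by simp [ladder]
      have h2 : ∀ j : Fin m, ladder (m + 1) k.succ j.succ = ladder m k j := by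
        intro j; simp [ladder]
      simp only [h1, h2]

/-- The factors of the part of the hopping term of link `n` that flips exactly the bits `j ≤ k`. -/
def hopFactors (n : Fin (N - 1)) (k : Fin m) : SysQubit N m → Matrix (Fin 2) (Fin 2) ℂ
  | Sum.inl s => if s = leftSite n then sigmaPlus else if s = rightSite n then sigmaMinus else 1
  | Sum.inr (n', j) => if n' = n then ladder m k j else 1

theorem leftSite_ne_rightSite (n : Fin (N - 1)) : leftSite n ≠ rightSite n := by
  simp [leftSite, rightSite]

theorem hopping_eq_sum (hm : 1 ≤ m) (n : Fin (N - 1)) :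
    hopping (m := m) n = ∑ k, tensorOp (hopFactors n k) := by
  rw [hopping, raising_eq_sum hm, onLink_sum, Finset.mul_sum, Finset.sum_mul]
  refine Finset.sum_congr rfl fun k _ => ?_
  rw [onLink_tensorOp, onSite, onSite, onQubit_eq_tensorOp, onQubit_eq_tensorOp, tensorOp_mul,
    tensorOp_mul]
  congr 1
  ext1 q
  have hlr := leftSite_ne_rightSite n
  rcases q with s | ⟨n', j⟩
  · by_cases h1 : s = leftSite n
    · subst h1; simp [hopFactors, hlr]
    · by_cases h2 : s = rightSite n
      · subst h2; simp [hopFactors, hlr.symm]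
      · simp [hopFactors, h1, h2]
  · simp [hopFactors]

end LinkOps

/-! ### Diagonal Pauli strings -/

section Diagonal

variable {ι : Type} [Fintype ι] [DecidableEq ι]

/-- The eigenvalue of `Z` on the basis state `|a⟩`. -/
def sgn (a : Fin 2) : ℂ := (-1) ^ (a : ℕ)

theorem pauliString_zero_left (s : ι → Fin 2) :
    pauliString 0 s = Matrix.diagonal fun b => ∏ q, sgn (b q) ^ (s q : ℕ) := by
  have h : ∀ a b c : Fin 2, pauli 0 a b c = if b = c then sgn b ^ (a : ℕ) else 0 := by
    intro a b c
    fin_cases a <;> fin_cases b <;> fin_cases c <;> simp [pauli, pauliZ, sgn]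
  ext b c
  simp only [pauliString_eq, tensorOp, Matrix.of_apply, Pi.zero_apply, h, Matrix.diagonal_apply]
  split_ifs with hbc
  · subst hbc; simp
  · obtain ⟨j, hj⟩ := Function.ne_iff.1 hbc
    exact Finset.prod_eq_zero (Finset.mem_univ j) (if_neg hj)

theorem pauliString_zero_one (q : ι) :
    pauliString 0 (one q) = Matrix.diagonal fun b => sgn (b q) := by
  rw [pauliString_zero_left]
  congr 1
  ext b
  rw [Finset.prod_eq_single q]
  · simp
  · intro q' _ h
    simp [h]
  · simp

theorem pauliString_zero_one_add {q q' : ι} (h : q ≠ q') :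
    pauliString 0 (one q + one q') = Matrix.diagonal fun b => sgn (b q) * sgn (b q') := by
  rw [pauliString_zero_left]
  congr 1
  ext b
  rw [← Finset.mul_prod_erase _ _ (Finset.mem_univ q),
    ← Finset.mul_prod_erase _ _ (Finset.mem_erase.2 ⟨h.symm, Finset.mem_univ q'⟩),
    Finset.prod_eq_one]
  · simp [h, h.symm]
  · intro p hp
    simp only [Finset.mem_erase] at hp
    simp [hp.1, hp.2.1]

theorem onQubit_pauliZ (q : ι) : onQubit q pauliZ = pauliString 0 (one q) := by
  rw [onQubit_eq_tensorOp, pauliString_eq]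
  congr 1
  ext1 j
  by_cases h : j = q
  · subst h; simp [pauli]
  · simp [pauli, h]

end Diagonal

/-! ### The Hamiltonian as a sum over register qubits -/

section Hamiltonian

variable {N m : ℕ}

theorem sum_range_sq (a : ℕ → ℂ) (m : ℕ) : (∑ j ∈ Finset.range m, a j) ^ 2 =
    ∑ j ∈ Finset.range m, a j ^ 2 +
      2 * ∑ k ∈ Finset.range m, ∑ j ∈ Finset.range k, a k * a j := by
  induction m with
  | zero => simp
  | succ m ih =>
    rw [Finset.sum_range_succ, Finset.sum_range_succ, Finset.sum_range_succ, add_sq, ih,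
      ← Finset.mul_sum]
    ring

theorem onLink_diagonal (n : Fin (N - 1)) (d : (Fin m → Fin 2) → ℂ) :
    onLink (N := N) n (Matrix.diagonal d) =
      Matrix.diagonal fun b => d fun j => b (Sum.inr (n, j)) := by
  ext b c
  simp only [onLink, liftOp, Matrix.of_apply, Matrix.diagonal_apply]
  by_cases hbc : b = c
  · subst hbc; simp; rfl
  · rw [if_neg hbc]
    split_ifs with h1 h2
    · exfalso
      apply hbc
      ext1 q
      by_cases hq : q ∈ Set.range fun j : Fin m => (Sum.inr (n, j) : SysQubit N m)
      · obtain ⟨j, rfl⟩ := hq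
        exact congrFun h2 j
      · exact h1 q hq
    · rfl
    · rfl

/-- The part of `L²(n)` in which `k` is the highest bit that is acted on. -/
def fieldTerm [NeZero m] (n : Fin (N - 1)) (k : ℕ) : Op (SysQubit N m) :=
  (2 ^ k / 2 : ℂ) • pauliString 0 (one (Sum.inr (n, Fin.ofNat m k))) +
    ∑ j ∈ Finset.range k, (2 ^ (k + j) / 2 : ℂ) •
      pauliString 0 (one (Sum.inr (n, Fin.ofNat m k)) + one (Sum.inr (n, Fin.ofNat m j)))

theorem ofNat_injOn [NeZero m] {i j : ℕ} (hi : i < m) (hj : j < m)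
    (h : Fin.ofNat m i = Fin.ofNat m j) : i = j := by
  have := congrArg Fin.val h
  rwa [Fin.val_ofNat, Fin.val_ofNat, Nat.mod_eq_of_lt hi, Nat.mod_eq_of_lt hj] at this

theorem sum_fin_eq_sum_range [NeZero m] {M : Type*} [AddCommMonoid M] (f : Fin m → M) :
    ∑ j, f j = ∑ j ∈ Finset.range m, f (Fin.ofNat m j) := by
  rw [Finset.sum_range]
  refine Finset.sum_congr rfl fun j _ => ?_
  rw [Fin.ofNat_val_eq_self]

/-- The coefficient of the identity in `L²`. -/
def fieldConst (m : ℕ) : ℝ := (1 + ∑ j ∈ Finset.range m, (4 : ℝ) ^ j) / 4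

/-- Squaring `-(1 + ∑ 2^k Z_k) / 2` gives constant terms (as `Z_k² = 1`), single `Z_k` and products
`Z_k Z_j`; the last two are grouped by their highest index. -/
theorem onLink_fieldSq [NeZero m] (n : Fin (N - 1)) : onLink (N := N) n (fieldSq m) =
    (fieldConst m : ℂ) • 1 + ∑ k : Fin m, fieldTerm n k := by
  have h1 : ∀ k < m, (fieldTerm n k : Op (SysQubit N m)) = Matrix.diagonal fun b =>
      2 ^ k * sgn (b (Sum.inr (n, Fin.ofNat m k))) / 2 + ∑ j ∈ Finset.range k,
        (2 ^ k * sgn (b (Sum.inr (n, Fin.ofNat m k)))) *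
          (2 ^ j * sgn (b (Sum.inr (n, Fin.ofNat m j)))) / 2 := by
    intro k hk
    rw [fieldTerm, pauliString_zero_one]
    ext b c
    rw [Matrix.add_apply, Matrix.sum_apply, Matrix.smul_apply]
    by_cases hbc : b = c
    · subst hbc
      rw [Matrix.diagonal_apply_eq, Matrix.diagonal_apply_eq, smul_eq_mul]
      congr 1
      · ring
      · refine Finset.sum_congr rfl fun j hj => ?_
        have hj := Finset.mem_range.1 hj
        have hne : (Sum.inr (n, Fin.ofNat m k) : SysQubit N m) ≠ Sum.inr (n, Fin.ofNat m j) := by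
          intro h
          have := ofNat_injOn hk (hj.trans hk) (congrArg Prod.snd (Sum.inr_injective h))
          omega
        rw [pauliString_zero_one_add hne, Matrix.smul_apply, Matrix.diagonal_apply_eq, smul_eq_mul]
        ring
    · rw [Matrix.diagonal_apply_ne _ hbc, Matrix.diagonal_apply_ne _ hbc, Finset.sum_eq_zero]
      · simp
      · intro j _
        rw [pauliString_zero_left, Matrix.smul_apply, Matrix.diagonal_apply_ne _ hbc, smul_zero]
  rw [fieldSq, onLink_diagonal]
  ext b c
  rw [Matrix.add_apply, Matrix.sum_apply, Matrix.smul_apply]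
  by_cases hbc : b = c
  · subst hbc
    rw [Matrix.diagonal_apply_eq, Matrix.one_apply_eq, smul_eq_mul, mul_one]
    have h2 : ∑ k : Fin m, (fieldTerm n k : Op (SysQubit N m)) b b =
        ∑ k ∈ Finset.range m, (2 ^ k * sgn (b (Sum.inr (n, Fin.ofNat m k))) / 2 +
        ∑ j ∈ Finset.range k, (2 ^ k * sgn (b (Sum.inr (n, Fin.ofNat m k)))) *
          (2 ^ j * sgn (b (Sum.inr (n, Fin.ofNat m j)))) / 2) := by
      rw [Finset.sum_range]
      refine Finset.sum_congr rfl fun k _ => ?_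
      rw [h1 k k.isLt, Matrix.diagonal_apply_eq]
    rw [h2, Finset.sum_add_distrib]
    simp only [← Finset.sum_div]
    have h3 := sum_range_sq (fun k => 2 ^ k * sgn (b (Sum.inr (n, Fin.ofNat m k)))) m
    -- Each digit is `(1 - Z) / 2`, and `2 ^ m = 1 + ∑ 2 ^ k`.
    have h4 : (linkValue (fun j => b (Sum.inr (n, j))) : ℂ) - 2 ^ m / 2 =
        -(1 + ∑ k ∈ Finset.range m, 2 ^ k * sgn (b (Sum.inr (n, Fin.ofNat m k)))) / 2 := by
      rw [linkValue, sum_fin_eq_sum_range]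
      have h5 : ∀ a : Fin 2, sgn a = 1 - 2 * ((a : ℕ) : ℂ) := by
        intro a
        rcases fin_two_eq a with rfl | rfl <;> norm_num [sgn]
      have h6 : ∀ M : ℕ, (2 : ℂ) ^ M = 1 + ∑ k ∈ Finset.range M, 2 ^ k := by
        intro M
        induction M with
        | zero => simp
        | succ M ih => rw [Finset.sum_range_succ, pow_succ, ← add_assoc, ← ih]; ring
      have h7 : ∑ k ∈ Finset.range m, (2 : ℂ) ^ k * sgn (b (Sum.inr (n, Fin.ofNat m k))) =
          ∑ k ∈ Finset.range m, (2 : ℂ) ^ k - 2 * ∑ k ∈ Finset.range m,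
            ((b (Sum.inr (n, Fin.ofNat m k)) : ℕ) : ℂ) * 2 ^ k := by
        rw [Finset.mul_sum, ← Finset.sum_sub_distrib]
        refine Finset.sum_congr rfl fun k _ => ?_
        rw [h5]
        ring
      have h8 : ∑ k ∈ Finset.range m, ((b (Sum.inr (n, Fin.ofNat m k)) : ℕ) : ℂ) *
          2 ^ ((Fin.ofNat m k : Fin m) : ℕ) = ∑ k ∈ Finset.range m,
            ((b (Sum.inr (n, Fin.ofNat m k)) : ℕ) : ℂ) * 2 ^ k := by
        refine Finset.sum_congr rfl fun k hk => ?_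
        rw [Fin.val_ofNat, Nat.mod_eq_of_lt (Finset.mem_range.1 hk)]
      rw [h7, h6 m]
      push_cast
      rw [h8]
      ring
    have h9 : ∑ k ∈ Finset.range m, (2 ^ k * sgn (b (Sum.inr (n, Fin.ofNat m k)))) ^ 2 =
        ∑ k ∈ Finset.range m, (4 : ℂ) ^ k := by
      refine Finset.sum_congr rfl fun k _ => ?_
      have : sgn (b (Sum.inr (n, Fin.ofNat m k))) ^ 2 = 1 := by
        rw [sgn, ← pow_mul, mul_comm, pow_mul]; simp
      rw [mul_pow, this, mul_one, ← pow_mul, mul_comm, pow_mul]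
      norm_num
    rw [h4, fieldConst]
    push_cast
    rw [h9] at h3
    linear_combination h3 / 4
  · rw [Matrix.diagonal_apply_ne _ hbc, Matrix.one_apply_ne hbc, Finset.sum_eq_zero]
    · simp
    · intro k _
      rw [h1 k k.isLt, Matrix.diagonal_apply_ne _ hbc]

/-- The part of the Hamiltonian that is prepared from the register qubit `q`. -/
def leafOp [NeZero m] (μ x : ℝ) : RegQubit N m → Op (SysQubit N m)
  | Sum.inl (Sum.inl _) => 0
  | Sum.inl (Sum.inr (n, k)) =>
    (x : ℂ) • (tensorOp (hopFactors n k) + (tensorOp (hopFactors n k)).conjTranspose)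
  | Sum.inr (Sum.inl n) => ((-1) ^ ((n : ℕ) + 1) * (μ / 2) : ℂ) • pauliString 0 (one (Sum.inl n))
  | Sum.inr (Sum.inr (n, k)) => fieldTerm n k

/-- The coefficient of the identity in the Hamiltonian. -/
def idCoeff (N m : ℕ) (μ : ℝ) : ℝ :=
  (N - 1 : ℕ) * fieldConst m + ∑ n : Fin N, (-1) ^ ((n : ℕ) + 1) * (μ / 2)

theorem hamiltonian_eq_sum [NeZero m] (μ x : ℝ) : hamiltonian N m μ x =
    (idCoeff N m μ : ℂ) • 1 + ∑ q, leafOp μ x q := by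
  have hm : 1 ≤ m := Nat.one_le_iff_ne_zero.2 (NeZero.ne m)
  rw [hamiltonian, freeHamiltonian, interaction, Fintype.sum_sum_type, Fintype.sum_sum_type,
    Fintype.sum_sum_type, Fintype.sum_prod_type, Fintype.sum_prod_type]
  simp only [leafOp, onLink_fieldSq, hopping_eq_sum hm, Matrix.conjTranspose_sum,
    ← Finset.sum_add_distrib, onSite, onQubit_pauliZ, smul_add, Finset.smul_sum, smul_smul,
    Finset.sum_const_zero, zero_add]
  rw [Finset.sum_add_distrib, Finset.sum_add_distrib]
  simp only [Finset.sum_const, Finset.card_univ, Fintype.card_fin, ← Finset.sum_smul]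
  have h : (idCoeff N m μ : ℂ) =
      (N - 1 : ℕ) * (fieldConst m : ℂ) + ∑ n : Fin N, (-1) ^ ((n : ℕ) + 1) * (μ / 2 : ℂ) := by
    simp [idCoeff]
  rw [h, add_smul, ← Nat.cast_smul_eq_nsmul ℂ, smul_smul]
  abel

end Hamiltonian

/-! ### Preparation of the one-hot state -/

section Preparation

variable {ι : Type} [Fintype ι] [DecidableEq ι]

/-- The angle is `2 * φ` because `rotY` contains half of its argument. -/
theorem run_rotY_ket_zero (ρ : ι) (φ : ℝ) :
    Circuit.run (conjY ρ [Gate.Rz (2 * φ) ρ]) (ket 0) =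
      oneHot (Real.cos φ) fun q => if q = ρ then Real.sin φ else 0 := by
  rw [run_conjY_rz]
  ext b
  have hs : ∑ q, (((if q = ρ then Real.sin φ else 0 : ℝ) : ℂ) • ket (one q) : State ι) =
      (Real.sin φ : ℂ) • ket (one ρ) := by
    rw [Finset.sum_eq_single ρ]
    · rw [if_pos rfl]
    · intro q _ hq
      simp [hq]
    · simp
  rw [onQubit_mulVec, oneHot, hs, Fin.sum_univ_two]
  have h0 : b ρ = 0 → (b = one ρ) = False := by
    intro h
    refine eq_false fun h' => ?_
    rw [h'] at h
    simp at h
  have h1 : b ρ = 1 → (b = 0) = False := by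
    intro h
    refine eq_false fun h' => ?_
    rw [h'] at h
    simp at h
  have hu0 : ∀ c : ι → Fin 2, Function.update c ρ 1 ≠ 0 := by
    intro c hc
    have := congrFun hc ρ
    simp at this
  have hu1 : b ρ = 1 → ((Function.update b ρ 0 = 0) = (b = one ρ)) := by
    intro h
    refine propext ⟨fun h' => ?_, fun h' => ?_⟩
    · ext1 q
      by_cases hq : q = ρ
      · subst hq; rw [h]; simp
      · have := congrFun h' q
        rw [Function.update_of_ne hq] at this
        rw [this, one_apply_of_ne hq]
        rfl
    · rw [h']
      ext1 q
      by_cases hq : q = ρ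
      · subst hq; simp
      · simp [hq]
  rcases fin_two_eq (b ρ) with h | h
  · have : Function.update b ρ 0 = b := by rw [← h]; simp
    simp [h, this, rotY, Pi.single_apply, hu0, h0 h]
  · simp [h, rotY, Pi.single_apply, hu0, h1 h, hu1 h]

/-- The root `ρ` serves as a reservoir: each group draws its total weight from it, and the remainder
is passed on. -/
theorem exists_spreads (ρ : ι) (g : ι → ℝ) (hg : ∀ q, 0 ≤ g q) (G : List (List ι))
    (hnd : G.flatten.Nodup) (hρ : ρ ∉ G.flatten)
    (hconst : ∀ l ∈ G, ∀ q ∈ l, ∀ q' ∈ l, g q = g q') (R : ℝ) (hR : (G.flatten.map g).sum ≤ R) :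
    ∃ C : Circuit ι, C.numT ≤ 2 * G.flatten.length ∧ C.numCNOT ≤ 2 * G.flatten.length ∧
      C.numRz ≤ (G.map fun l => 2 * Nat.size l.length).sum ∧
      ∀ c f, f ρ = √R → (∀ q ∈ G.flatten, f q = 0) →
        C.run (oneHot c f) = oneHot c (fun q =>
          if q ∈ G.flatten then √(g q) else if q = ρ then √(R - (G.flatten.map g).sum) else f q) := by
  induction G generalizing R with
  | nil =>
    refine ⟨[], by simp [Circuit.numT], by simp [Circuit.numCNOT], by simp [Circuit.numRz],
      fun c f h _ => ?_⟩
    rw [Circuit.run_nil]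
    congr 1
    ext q
    by_cases hq : q = ρ
    · subst hq; simp [h]
    · simp [hq]
  | cons l G ih =>
    rw [List.flatten_cons] at hnd hρ hR
    rw [List.mem_append, not_or] at hρ
    rw [List.map_append, List.sum_append] at hR
    obtain ⟨hnd1, hnd2, hdisj⟩ := List.nodup_append'.1 hnd
    obtain ⟨w, hw, hlw⟩ : ∃ w, 0 ≤ w ∧ ∀ q ∈ l, g q = w := by
      cases l with
      | nil => exact ⟨0, le_rfl, by simp⟩
      | cons q l =>
        exact ⟨g q, hg q, fun q' hq' => hconst _ List.mem_cons_self q' hq' q List.mem_cons_self⟩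
    have hsum : (l.map g).sum = l.length * w := by
      rw [List.map_congr_left hlw, List.map_const', List.sum_replicate, nsmul_eq_mul]
    have hsum2 : 0 ≤ (G.flatten.map g).sum := List.sum_nonneg fun a ha => by
      obtain ⟨q, _, rfl⟩ := List.mem_map.1 ha
      exact hg q
    rw [hsum] at hR
    obtain ⟨C, hT, hC, hRz, hrun⟩ := exists_spread ρ l hnd1 hρ.1 hw (R := R) (by linarith)
    obtain ⟨D, hT', hC', hRz', hrun'⟩ := ih hnd2 hρ.2
      (fun l hl => hconst l (List.mem_cons_of_mem _ hl)) (R - l.length * w) (by linarith)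
    refine ⟨C ++ D, ?_, ?_, ?_, ?_⟩
    · rw [Circuit.numT_append, List.flatten_cons, List.length_append]; omega
    · rw [Circuit.numCNOT_append, List.flatten_cons, List.length_append]; omega
    · rw [Circuit.numRz_append, List.map_cons, List.sum_cons]; omega
    · intro c f hf hf0
      simp only [List.flatten_cons, List.mem_append] at hf0 ⊢
      rw [Circuit.run_append, hrun c f hf fun q hq => hf0 q (Or.inl hq), hrun']
      · congr 1
        ext q
        by_cases h1 : q ∈ G.flatten
        · simp only [h1, or_true, if_true]
        · by_cases h2 : q ∈ l
          · have h3 : q ≠ ρ := fun h => hρ.1 (h ▸ h2)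
            simp only [h1, h2, h3, true_or, if_true, if_false]
            rw [hlw q h2]
          · simp only [h1, h2, or_self, if_false]
            split_ifs
            · rw [List.map_append, List.sum_append, hsum]
              congr 1
              ring
            · rfl
      · simp [hρ.1]
      · intro q hq
        have h1 : q ∉ l := fun h => hdisj h hq
        have h2 : q ≠ ρ := fun h => hρ.2 (h ▸ hq)
        simp only [h1, h2, if_false]
        exact hf0 q (Or.inr hq)

/-- One rotation divides the probability between the zero string and the reservoir `ρ`. Since the
groups carry all of `g`, the reservoir ends empty, so `ρ` is returned to `0`. -/
theorem exists_prepare_oneHot (ρ : ι) (g : ι → ℝ) (hg : ∀ q, 0 ≤ g q) (G : List (List ι))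
    (hnd : G.flatten.Nodup) (hρ : ρ ∉ G.flatten) (hG : ∀ q, q ∉ G.flatten → g q = 0)
    (hconst : ∀ l ∈ G, ∀ q ∈ l, ∀ q' ∈ l, g q = g q') {a : ℝ} (ha : 0 ≤ a)
    (hsum : a + ∑ q, g q = 1) :
    ∃ C : Circuit ι, C.numT ≤ 2 * G.flatten.length ∧ C.numCNOT ≤ 2 * G.flatten.length ∧
      C.numRz ≤ 1 + (G.map fun l => 2 * Nat.size l.length).sum ∧
      C.run (ket 0) = oneHot (√a) fun q => √(g q) := by
  have hR : (G.flatten.map g).sum = ∑ q, g q := by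
    rw [← List.sum_toFinset g hnd]
    refine Finset.sum_subset (Finset.subset_univ _) fun q _ hq => hG q ?_
    simpa using hq
  obtain ⟨φ, h1, h2⟩ := exists_angle ha (Finset.sum_nonneg fun q (_ : q ∈ Finset.univ) => hg q)
  rw [hsum, Real.sqrt_one, mul_one] at h1 h2
  obtain ⟨C, hT, hC, hRz, hrun⟩ := exists_spreads ρ g hg G hnd hρ hconst (∑ q, g q) hR.le
  refine ⟨conjY ρ [Gate.Rz (2 * φ) ρ] ++ C, ?_, ?_, ?_, ?_⟩
  · rw [Circuit.numT_append]
    exact (Nat.zero_add _).trans_le hT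
  · rw [Circuit.numCNOT_append]
    exact (Nat.zero_add _).trans_le hC
  · rw [Circuit.numRz_append]
    exact Nat.add_le_add_left hRz 1
  · rw [Circuit.run_append, run_rotY_ket_zero, hrun _ _ (by simp [h2]), h1, hR, sub_self,
      Real.sqrt_zero]
    · congr 1
      ext q
      by_cases hq : q ∈ G.flatten
      · simp [hq]
      · by_cases hqρ : q = ρ <;> simp [hq, hqρ, hG q hq, hG ρ hρ]
    · intro q hq
      have : q ≠ ρ := fun h => hρ (h ▸ hq)
      simp [this]

end Preparation

/-! ### Superposing encoded pieces without cancellation -/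

section Superposition

variable {ι κ : Type} [Fintype ι] [DecidableEq ι] [Fintype κ] [DecidableEq κ]

/-- `ψ` is the state with amplitudes proportional to the square roots of the absolute values of the
Pauli coefficients of `A`, with all ancillas `κ` in `|0⟩`. -/
structure Encodes (A : Op ι) (w : ℝ) (ψ : State ((ι ⊕ ι) ⊕ κ)) : Prop where
  nonneg : ∀ b, ψ b = (‖ψ b‖ : ℂ)
  ancilla : ∀ b, b ∘ Sum.inr ≠ 0 → ψ b = 0
  coeff : ∀ b, b ∘ Sum.inr = 0 →
    ‖pauliCoeff A (b ∘ Sum.inl ∘ Sum.inl) (b ∘ Sum.inl ∘ Sum.inr)‖ = w * ‖ψ b‖ ^ 2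

/-- The inner product is a sum of nonnegative terms, so it vanishes only if each term does. -/
theorem disjoint_of_orthogonal {ψ φ : State ι} (hψ : ∀ b, ψ b = (‖ψ b‖ : ℂ))
    (hφ : ∀ b, φ b = (‖φ b‖ : ℂ)) (h : dotProduct (star ψ) φ = 0) (b : ι → Fin 2) :
    ψ b = 0 ∨ φ b = 0 := by
  have h1 : ∑ b, ‖ψ b‖ * ‖φ b‖ = 0 := by
    have : dotProduct (star ψ) φ = ((∑ b, ‖ψ b‖ * ‖φ b‖ : ℝ) : ℂ) := by
      rw [dotProduct, Complex.ofReal_sum]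
      refine Finset.sum_congr rfl fun b _ => ?_
      rw [Pi.star_apply, hψ b, hφ b]
      simp
    rw [h] at this
    exact_mod_cast this.symm
  have h2 := (Finset.sum_eq_zero_iff_of_nonneg fun b _ => by positivity).1 h1 b (Finset.mem_univ b)
  simpa using h2

/-- At each string at most one piece is nonzero, both as an amplitude and as a Pauli coefficient.
There the coefficient has norm `W a * ‖Φ a b‖ ^ 2`, so its square root is `√(W a)` times the
amplitude. -/
theorem sum_superposition {α : Type} [Fintype α] {O : α → Op ι} {W : α → ℝ}
    {Φ : α → State ((ι ⊕ ι) ⊕ κ)} {S : ℝ} (hS : 0 < S) (hW : ∀ a, 0 ≤ W a)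
    (hΦ : ∀ a, Encodes (O a) (W a) (Φ a)) (hdisj : ∀ a a', a ≠ a' → ∀ b, Φ a b = 0 ∨ Φ a' b = 0)
    (b : (ι ⊕ ι) ⊕ κ → Fin 2) :
    (∑ a, (√(W a / S) : ℂ) • Φ a) b = if b ∘ Sum.inr = 0 then
      (√(‖pauliCoeff (∑ a, O a) (b ∘ Sum.inl ∘ Sum.inl) (b ∘ Sum.inl ∘ Sum.inr)‖ / S) : ℂ)
        else 0 := by
  simp only [Finset.sum_apply, Pi.smul_apply, smul_eq_mul]
  split_ifs with hb
  · rw [pauliCoeff_sum]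
    by_cases h : ∃ a, Φ a b ≠ 0
    · obtain ⟨a, ha⟩ := h
      have h0 : ∀ a', a' ≠ a → Φ a' b = 0 := fun a' h => (hdisj a' a h b).resolve_right ha
      rw [Finset.sum_eq_single a, Finset.sum_eq_single a, (hΦ a).coeff b hb, mul_div_right_comm,
        Real.sqrt_mul (div_nonneg (hW a) hS.le), Real.sqrt_sq (norm_nonneg _), Complex.ofReal_mul,
        ← (hΦ a).nonneg]
      · intro a' _ h
        rw [← norm_eq_zero, (hΦ a').coeff b hb, h0 a' h]
        simp
      · simp
      · intro a' _ h
        rw [h0 a' h, mul_zero]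
      · simp
    · push Not at h
      rw [Finset.sum_eq_zero fun a _ => by rw [h a, mul_zero], Finset.sum_eq_zero]
      · simp
      · intro a _
        rw [← norm_eq_zero, (hΦ a).coeff b hb, h a]
        simp
  · exact Finset.sum_eq_zero fun a _ => by rw [(hΦ a).ancilla b hb, mul_zero]

/-- The Pauli norm of the sum is not computed: the squared amplitudes add up to `pauliNorm / S`, and
the state has norm one. -/
theorem superposition_eq_lcuState {α : Type} [Fintype α] {O : α → Op ι} {W : α → ℝ}
    {Φ : α → State ((ι ⊕ ι) ⊕ κ)} {S : ℝ} (hS : 0 < S) (hW : ∀ a, 0 ≤ W a)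
    (hΦ : ∀ a, Encodes (O a) (W a) (Φ a)) (hdisj : ∀ a a', a ≠ a' → ∀ b, Φ a b = 0 ∨ Φ a' b = 0)
    (hnorm : dotProduct (star (∑ a, (√(W a / S) : ℂ) • Φ a)) (∑ a, (√(W a / S) : ℂ) • Φ a) = 1) :
    ∑ a, (√(W a / S) : ℂ) • Φ a = withZeroAncillas κ (lcuState (∑ a, O a)) := by
  have h := sum_superposition hS hW hΦ hdisj
  have hN : pauliNorm (∑ a, O a) = S := by
    have h1 : ∀ b, star ((∑ a, (√(W a / S) : ℂ) • Φ a) b) * (∑ a, (√(W a / S) : ℂ) • Φ a) b =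
        ((if b ∘ Sum.inr = 0 then ‖pauliCoeff (∑ a, O a) (b ∘ Sum.inl ∘ Sum.inl)
          (b ∘ Sum.inl ∘ Sum.inr)‖ / S else 0 : ℝ) : ℂ) := by
      intro b
      rw [h]
      split_ifs
      · rw [Complex.star_def, Complex.conj_ofReal, ← Complex.ofReal_mul,
          Real.mul_self_sqrt (by positivity)]
      · simp
    rw [dotProduct] at hnorm
    simp only [Pi.star_apply, h1] at hnorm
    rw [← Complex.ofReal_sum] at hnorm
    have h2 : ∑ b : (ι ⊕ ι) ⊕ κ → Fin 2, (if b ∘ Sum.inr = 0 then ‖pauliCoeff (∑ a, O a)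
        (b ∘ Sum.inl ∘ Sum.inl) (b ∘ Sum.inl ∘ Sum.inr)‖ / S else 0 : ℝ) =
          pauliNorm (∑ a, O a) / S := by
      rw [← (Equiv.sumArrowEquivProdArrow (ι ⊕ ι) κ (Fin 2)).symm.sum_comp, Fintype.sum_prod_type,
        ← (Equiv.sumArrowEquivProdArrow ι ι (Fin 2)).symm.sum_comp, Fintype.sum_prod_type,
        pauliNorm, Finset.sum_div]
      refine Finset.sum_congr rfl fun x _ => ?_
      rw [Finset.sum_div]
      refine Finset.sum_congr rfl fun z _ => ?_
      rw [Finset.sum_eq_single 0]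
      · rw [if_pos]
        · rfl
        · rfl
      · intro b _ hb
        exact if_neg hb
      · simp
    rw [h2] at hnorm
    have h3 : pauliNorm (∑ a, O a) / S = 1 := by exact_mod_cast hnorm
    exact (div_eq_one_iff_eq hS.ne').1 h3
  ext b
  rw [h, withZeroAncillas, lcuState, zeroState, hN]
  split_ifs
  · rw [mul_one]; rfl
  · rw [mul_zero]

end Superposition

/-! ### The circuit of all links -/

section Links

variable {N m : ℕ} [NeZero m]

/-- The qubits of the register that link `n` acts on. -/
def layout (n : Fin (N - 1)) : LinkLayout (RegQubit N m ⊕ Fin m) m where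
  x i := Sum.inl (Sum.inl (Sum.inr (n, Fin.ofNat m i)))
  z i := Sum.inl (Sum.inr (Sum.inr (n, Fin.ofNat m i)))
  xl := Sum.inl (Sum.inl (Sum.inl (leftSite n)))
  xr := Sum.inl (Sum.inl (Sum.inl (rightSite n)))
  zl := Sum.inl (Sum.inr (Sum.inl (leftSite n)))
  zr := Sum.inl (Sum.inr (Sum.inl (rightSite n)))
  r := Sum.inr 0
  x_inj i hi j hj h := by
    simp only [Sum.inl.injEq, Sum.inr.injEq, Prod.mk.injEq, true_and] at h
    exact ofNat_injOn hi hj h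
  z_inj i hi j hj h := by
    simp only [Sum.inl.injEq, Sum.inr.injEq, Prod.mk.injEq, true_and] at h
    exact ofNat_injOn hi hj h
  x_ne_z := by simp
  r_ne_x := by simp
  r_ne_z := by simp
  xl_ne_x := by simp
  xr_ne_x := by simp
  xl_ne_z := by simp
  xr_ne_z := by simp
  zl_ne_x := by simp
  zr_ne_x := by simp
  zl_ne_z := by simp
  zr_ne_z := by simp
  xl_ne_xr := by simpa using leftSite_ne_rightSite n
  zl_ne_zr := by simpa using leftSite_ne_rightSite n
  zl_ne_xl := by simp
  zl_ne_xr := by simp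
  zr_ne_xl := by simp
  zr_ne_xr := by simp

/-- The circuits of all links. -/
def links (N m : ℕ) [NeZero m] : Circuit (RegQubit N m ⊕ Fin m) :=
  (List.finRange (N - 1)).flatMap fun n => (layout n).circuit

theorem run_flatMap_of_fixed {α ι : Type} [Fintype ι] [DecidableEq ι] (c : α → Circuit ι)
    {ψ : State ι} {l : List α} (h : ∀ a ∈ l, (c a).run ψ = ψ) :
    Circuit.run (l.flatMap c) ψ = ψ := by
  induction l with
  | nil => rfl
  | cons a l ih =>
    rw [List.flatMap_cons, Circuit.run_append, h a List.mem_cons_self,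
      ih fun a ha => h a (List.mem_cons_of_mem _ ha)]

theorem run_links_of_forall {ψ : State (RegQubit N m ⊕ Fin m)}
    (h : ∀ n, (layout n).circuit.run ψ = ψ) : (links N m).run ψ = ψ :=
  run_flatMap_of_fixed _ fun n _ => h n

/-- The other links fix the state both before and after link `n` acts, so the position of `n` in the
product does not matter. -/
theorem run_links {n : Fin (N - 1)} {ψ φ : State (RegQubit N m ⊕ Fin m)}
    (h : (layout n).circuit.run ψ = φ) (hψ : ∀ n', n' ≠ n → (layout n').circuit.run ψ = ψ)
    (hφ : ∀ n', n' ≠ n → (layout n').circuit.run φ = φ) : (links N m).run ψ = φ := by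
  obtain ⟨l₁, l₂, hl⟩ := List.append_of_mem (List.mem_finRange n)
  have hnd := List.nodup_finRange (N - 1)
  rw [hl, List.nodup_append', List.nodup_cons] at hnd
  have h1 : n ∉ l₁ := fun hn => hnd.2.2 hn List.mem_cons_self
  rw [links, hl, List.flatMap_append, List.flatMap_cons, Circuit.run_append, Circuit.run_append,
    run_flatMap_of_fixed _ fun n' hn' => hψ n' fun h => h1 (h ▸ hn'), h,
    run_flatMap_of_fixed _ fun n' hn' => hφ n' fun h => hnd.2.1.1 (h ▸ hn')]

theorem layout_fixes {n : Fin (N - 1)} {ψ : State (RegQubit N m ⊕ Fin m)}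
    (h : ∀ b, ψ b ≠ 0 → b (Sum.inr 0) = 0 ∧ ∀ j, b (Sum.inl (Sum.inl (Sum.inr (n, j)))) = 0 ∧
      b (Sum.inl (Sum.inr (Sum.inr (n, j)))) = 0) : (layout n).circuit.run ψ = ψ :=
  run_eq_self_of_support fun b hb => (layout n).run_circuit_of_zero (h b hb).1
    (fun _ => ((h b hb).2 _).1) fun _ => ((h b hb).2 _).2

end Links

/-! ### Strings of the register as pairs of `x` and `z` parts -/

section Encodings

variable {ι κ : Type} [Fintype ι] [DecidableEq ι] [Fintype κ] [DecidableEq κ]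

/-- The string with `x` part `x`, `z` part `z` and all ancillas `0`. -/
abbrev xzBits (κ : Type) (x z : ι → Fin 2) : (ι ⊕ ι) ⊕ κ → Fin 2 := Sum.elim (Sum.elim x z) 0

theorem eq_xzBits_iff {b : (ι ⊕ ι) ⊕ κ → Fin 2} {x z : ι → Fin 2} : b = xzBits κ x z ↔
    b ∘ Sum.inr = 0 ∧ b ∘ Sum.inl ∘ Sum.inl = x ∧ b ∘ Sum.inl ∘ Sum.inr = z := by
  constructor
  · rintro rfl; exact ⟨rfl, rfl, rfl⟩
  · rintro ⟨h1, h2, h3⟩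
    ext1 q
    rcases q with (q | q) | q
    · exact congrFun h2 q
    · exact congrFun h3 q
    · exact congrFun h1 q

theorem one_inl_inl (q : ι) : (one (Sum.inl (Sum.inl q)) : (ι ⊕ ι) ⊕ κ → Fin 2) =
    xzBits κ (one q) 0 := by
  ext1 p
  rcases p with (p | p) | p <;> simp [Pi.single_apply]

theorem one_inl_inr (q : ι) : (one (Sum.inl (Sum.inr q)) : (ι ⊕ ι) ⊕ κ → Fin 2) =
    xzBits κ 0 (one q) := by
  ext1 p
  rcases p with (p | p) | p <;> simp [Pi.single_apply]

theorem xzBits_add (z z' : ι → Fin 2) : xzBits κ 0 z + xzBits κ 0 z' = xzBits κ 0 (z + z') := by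
  ext1 p
  rcases p with (p | p) | p <;> simp

theorem encodes_ket {A : Op ι} {w : ℝ} {x₀ z₀ : ι → Fin 2}
    (h : ∀ x z, ‖pauliCoeff A x z‖ = if x = x₀ ∧ z = z₀ then w else 0) :
    Encodes (κ := κ) A w (ket (xzBits κ x₀ z₀)) where
  nonneg b := by
    rw [ket, Pi.single_apply]
    split_ifs <;> simp
  ancilla b hb := by
    rw [ket, Pi.single_apply, if_neg]
    rw [eq_xzBits_iff]
    exact fun h => hb h.1
  coeff b hb := by
    rw [h, ket, Pi.single_apply]
    by_cases hc : b ∘ Sum.inl ∘ Sum.inl = x₀ ∧ b ∘ Sum.inl ∘ Sum.inr = z₀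
    · rw [if_pos hc, if_pos (eq_xzBits_iff.2 ⟨hb, hc⟩)]
      simp
    · rw [if_neg hc, if_neg fun h => hc (eq_xzBits_iff.1 h).2]
      simp

/-- The conditions exclude one another, so at most one term is nonzero and the square has no cross
terms. -/
theorem mul_sq_add_sum_ite {w a : ℝ} {d : ℕ → ℝ} {s : Finset ℕ} {P : Prop} {Q : ℕ → Prop}
    [Decidable P] [DecidablePred Q] (hPQ : ∀ j ∈ s, P → ¬ Q j)
    (hQ : ∀ i ∈ s, ∀ j ∈ s, Q i → Q j → i = j) :
    w * ((if P then a else 0) + ∑ j ∈ s, if Q j then d j else 0) ^ 2 =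
      (if P then w * a ^ 2 else 0) + ∑ j ∈ s, if Q j then w * d j ^ 2 else 0 := by
  by_cases hP : P
  · rw [Finset.sum_eq_zero fun j hj => if_neg (hPQ j hj hP),
      Finset.sum_eq_zero fun j hj => if_neg (hPQ j hj hP), if_pos hP, if_pos hP]
    ring
  · rw [if_neg hP, if_neg hP, zero_add, zero_add]
    by_cases h : ∃ i ∈ s, Q i
    · obtain ⟨i, hi, hQi⟩ := h
      rw [Finset.sum_eq_single i, Finset.sum_eq_single i, if_pos hQi, if_pos hQi]
      · exact fun j hj hji => if_neg fun hQj => hji (hQ j hj i hi hQj hQi)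
      · exact fun h => absurd hi h
      · exact fun j hj hji => if_neg fun hQj => hji (hQ j hj i hi hQj hQi)
      · exact fun h => absurd hi h
    · push Not at h
      rw [Finset.sum_eq_zero fun j hj => if_neg (h j hj),
        Finset.sum_eq_zero fun j hj => if_neg (h j hj)]
      ring

end Encodings

/-! ### Field energy terms -/

section Leaves

variable {N m : ℕ} [NeZero m]

theorem one_add_one_injective {ι : Type} [DecidableEq ι] {p q q' : ι}
    (h : (one p + one q : ι → Fin 2) = one p + one q') : q = q' := by
  have h1 := congrFun (add_left_cancel h) q
  by_contra hne
  rw [one_apply_of_ne hne] at h1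
  simp at h1

/-- The coefficients `2^k / 2` and `2^(k+j) / 2` are written as the total weight `4^k / 2` times the
squared amplitudes of the scan, the form that `Encodes` asks for. -/
theorem pauliCoeff_fieldTerm (n : Fin (N - 1)) (k : ℕ) (x z : SysQubit N m → Fin 2) :
    pauliCoeff (fieldTerm n k) x z =
      (((if x = 0 ∧ z = one (Sum.inr (n, Fin.ofNat m k)) then 4 ^ k / 2 * ((√2)⁻¹ ^ k) ^ 2 else 0) +
        ∑ j ∈ Finset.range k,
          if x = 0 ∧ z = one (Sum.inr (n, Fin.ofNat m k)) + one (Sum.inr (n, Fin.ofNat m j))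
          then 4 ^ k / 2 * ((√2)⁻¹ ^ (k - j)) ^ 2 else 0 : ℝ) : ℂ) := by
  have hr : ∀ i : ℕ, ((√2)⁻¹ ^ i : ℝ) ^ 2 = (1 / 2) ^ i := by
    intro i
    rw [← pow_mul, mul_comm, pow_mul, inv_pow, Real.sq_sqrt zero_le_two, one_div]
  have h4 : (4 : ℝ) ^ k = 2 ^ k * 2 ^ k := by rw [← mul_pow]; norm_num
  rw [fieldTerm, pauliCoeff_add, pauliCoeff_sum, pauliCoeff_smul, pauliCoeff_pauliString,
    Complex.ofReal_add, Complex.ofReal_sum]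
  congr 1
  · split_ifs
    · have : (2 ^ k / 2 : ℝ) = 4 ^ k / 2 * ((√2)⁻¹ ^ k) ^ 2 := by
        rw [hr, h4, one_div, inv_pow]
        field_simp
      rw [mul_one, ← this]
      push_cast
      rfl
    · simp
  · refine Finset.sum_congr rfl fun j hj => ?_
    rw [pauliCoeff_smul, pauliCoeff_pauliString]
    split_ifs
    · have : (2 ^ (k + j) / 2 : ℝ) = 4 ^ k / 2 * ((√2)⁻¹ ^ (k - j)) ^ 2 := by
        have hk : 2 ^ k = (2 : ℝ) ^ (k - j) * 2 ^ j := by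
          rw [← pow_add, Nat.sub_add_cancel (Finset.mem_range.1 hj).le]
        rw [hr, h4, one_div, inv_pow, pow_add]
        nth_rw 2 [hk]
        rw [hk]
        field_simp
      rw [mul_one, ← this]
      push_cast
      rfl
    · simp

theorem encodes_z (n : Fin (N - 1)) (k : Fin m) :
    Encodes (fieldTerm n k) (4 ^ (k : ℕ) / 2)
      ((links N m).run (ket (one (Sum.inl (Sum.inr (Sum.inr (n, k))))))) := by
  have hz : ∀ i, (layout n).z i =
      (Sum.inl (Sum.inr (Sum.inr (n, Fin.ofNat m i))) : RegQubit N m ⊕ Fin m) := fun _ => rfl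
  have hrun := (layout (N := N) n).run_circuit_z k.isLt
  simp only [hz, one_inl_inr, xzBits_add] at hrun
  have hval : ∀ b, (((√2)⁻¹ : ℂ) ^ (k : ℕ) • ket (xzBits (Fin m) 0 (one (Sum.inr (n, Fin.ofNat m k))))
      + ∑ j ∈ Finset.range k, ((√2)⁻¹ : ℂ) ^ (k - j) • ket (xzBits (Fin m) 0
        (one (Sum.inr (n, Fin.ofNat m k)) + one (Sum.inr (n, Fin.ofNat m j)))) :
          State (RegQubit N m ⊕ Fin m)) b =
      (((if b = xzBits (Fin m) 0 (one (Sum.inr (n, Fin.ofNat m k))) then (√2)⁻¹ ^ (k : ℕ) else 0) +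
        ∑ j ∈ Finset.range k, if b = xzBits (Fin m) 0
          (one (Sum.inr (n, Fin.ofNat m k)) + one (Sum.inr (n, Fin.ofNat m j)))
          then (√2)⁻¹ ^ (k - j) else 0 : ℝ) : ℂ) := by
    intro b
    simp [Finset.sum_apply, Pi.single_apply, apply_ite Complex.ofReal]
  have hsupp : ∀ n', n' ≠ n → ∀ z : SysQubit N m → Fin 2, (∀ j, z (Sum.inr (n', j)) = 0) →
      (layout n').circuit.run (ket (xzBits (Fin m) 0 z)) = ket (xzBits (Fin m) 0 z) :=
    fun n' _ z hz => (layout n').run_circuit_of_zero rfl (fun _ => rfl) fun _ => hz _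
  have hone : ∀ n', n' ≠ n → ∀ (i : ℕ) (j : Fin m),
      one (Sum.inr (n, Fin.ofNat m i) : SysQubit N m) (Sum.inr (n', j)) = 0 := by
    intro n' hn' i j
    exact one_apply_of_ne (by simp [hn'])
  have hlinks : (links N m).run (ket (xzBits (Fin m) 0 (one (Sum.inr (n, Fin.ofNat m k))))) = _ :=
    run_links hrun (fun n' hn' => hsupp n' hn' _ (hone n' hn' _)) fun n' hn' => by
      rw [Circuit.run_add, Circuit.run_sum, Circuit.run_smul, hsupp n' hn' _ (hone n' hn' _)]
      congr 1
      refine Finset.sum_congr rfl fun j _ => ?_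
      rw [Circuit.run_smul, hsupp n' hn']
      intro i
      rw [Pi.add_apply, hone n' hn', hone n' hn', add_zero]
  rw [Fin.ofNat_val_eq_self] at hlinks hval
  rw [one_inl_inr, hlinks]
  have hnn : ∀ b : RegQubit N m ⊕ Fin m → Fin 2, (0 : ℝ) ≤
      (if b = xzBits (Fin m) 0 (one (Sum.inr (n, k))) then (√2)⁻¹ ^ (k : ℕ) else 0) +
        ∑ j ∈ Finset.range k, if b = xzBits (Fin m) 0
          (one (Sum.inr (n, k)) + one (Sum.inr (n, Fin.ofNat m j)))
          then (√2)⁻¹ ^ (k - j) else 0 := by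
    intro b
    refine add_nonneg ?_ (Finset.sum_nonneg fun j _ => ?_) <;> split_ifs <;> positivity
  refine ⟨fun b => ?_, fun b hb => ?_, fun b hb => ?_⟩
  · rw [hval, Complex.norm_real, Real.norm_of_nonneg (hnn b)]
  · rw [hval, if_neg fun h => hb (eq_xzBits_iff.1 h).1,
      Finset.sum_eq_zero fun j _ => if_neg fun h => hb (eq_xzBits_iff.1 h).1]
    simp
  · rw [hval, Complex.norm_real, Real.norm_of_nonneg (hnn b), mul_sq_add_sum_ite,
      pauliCoeff_fieldTerm, Fin.ofNat_val_eq_self, Complex.norm_real, Real.norm_of_nonneg]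
    · simp only [eq_xzBits_iff, hb, true_and]
    · refine add_nonneg ?_ (Finset.sum_nonneg fun j _ => ?_) <;> split_ifs <;> positivity
    · intro j _ h1 h2
      have h3 := (eq_xzBits_iff.1 (h1.symm.trans h2)).2.2
      have h4 := congrFun h3 (Sum.inr (n, Fin.ofNat m j))
      simp at h4
    · intro i hi j hj h1 h2
      have h3 := (eq_xzBits_iff.1 (h1.symm.trans h2)).2.2
      have h4 := one_add_one_injective h3
      simp only [Sum.inr.injEq, Prod.mk.injEq, true_and] at h4
      exact ofNat_injOn ((Finset.mem_range.1 hi).trans k.isLt)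
        ((Finset.mem_range.1 hj).trans k.isLt) h4

end Leaves

/-! ### Hopping terms, and the encoding of every piece -/

section Hopping

variable {N m : ℕ} [NeZero m]

open Classical in
/-- The qubits on which the part of the hopping term that flips exactly the bits `j ≤ k` has a
factor `σ⁺` or `σ⁻`. -/
def ladderQubits (n : Fin (N - 1)) (k : Fin m) : Finset (SysQubit N m) :=
  Finset.univ.filter fun q => match q with
    | Sum.inl s => s = leftSite n ∨ s = rightSite n
    | Sum.inr (n', j) => n' = n ∧ j ≤ k ∧ (j : ℕ) + 1 < m

/-- The qubits that are flipped by this term. -/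
def flippedBits (n : Fin (N - 1)) (k : Fin m) : SysQubit N m → Fin 2
  | Sum.inl s => if s = leftSite n ∨ s = rightSite n then 1 else 0
  | Sum.inr (n', j) => if n' = n ∧ j ≤ k then 1 else 0

theorem norm_pauliCoeff_hopFactors (n : Fin (N - 1)) (k : Fin m) (x z : SysQubit N m → Fin 2) :
    ‖pauliCoeff (tensorOp (hopFactors n k) + (tensorOp (hopFactors n k)).conjTranspose) x z‖ =
      if x = flippedBits n k ∧ (∀ q, q ∉ ladderQubits n k → z q = 0) ∧
        ∑ q ∈ ladderQubits n k, z q = 0 then 2 * (1 / 2) ^ (ladderQubits n k).card else 0 := by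
  apply norm_pauliCoeff_ladder
  · rintro (s | ⟨n', j⟩) hq
    · simp only [ladderQubits, Finset.mem_filter, Finset.mem_univ, true_and] at hq
      refine ⟨?_, if_pos hq⟩
      by_cases h : s = leftSite n
      · simp [hopFactors, h]
      · simp [hopFactors, hq.resolve_left h, (leftSite_ne_rightSite n).symm]
    · simp only [ladderQubits, Finset.mem_filter, Finset.mem_univ, true_and] at hq
      obtain ⟨rfl, h1, h2⟩ := hq
      refine ⟨?_, if_pos ⟨rfl, h1⟩⟩
      rcases h1.lt_or_eq with h | rfl
      · simp [hopFactors, ladder, h]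
      · simp [hopFactors, ladder, h2.ne]
  · rintro (s | ⟨n', j⟩) hq
    · simp only [ladderQubits, Finset.mem_filter, Finset.mem_univ, true_and, not_or] at hq
      left
      simp [hopFactors, flippedBits, hq.1, hq.2]
    · simp only [ladderQubits, Finset.mem_filter, Finset.mem_univ, true_and] at hq
      by_cases hn : n' = n
      · by_cases hj : j ≤ k
        · right
          have h1 : ¬ (j : ℕ) + 1 < m := fun h => hq ⟨hn, hj, h⟩
          have h2 : j = k := by
            have := j.isLt
            have := k.isLt
            have : (j : ℕ) ≤ k := hj
            ext
            omega
          have h3 : (k : ℕ) + 1 = m := by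
            have := k.isLt
            rw [h2] at h1
            omega
          simp [hopFactors, flippedBits, ladder, hn, h2, h3]
        · left
          have h1 : ¬ j < k := fun h => hj h.le
          have h2 : j ≠ k := fun h => hj h.le
          simp [hopFactors, flippedBits, ladder, h1, h2, hj]
      · left
        simp [hopFactors, flippedBits, hn]

theorem hopBits_layout (n : Fin (N - 1)) (k : Fin m) :
    (layout n).hopBits k = xzBits (Fin m) (flippedBits n k) 0 := by
  ext1 q
  rcases q with ((s | ⟨n', j⟩) | (s | ⟨n', j⟩)) | a
  · simp [LinkLayout.hopBits, layout, flippedBits]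
  · have : (∃ i ≤ (k : ℕ), n' = n ∧ j = Fin.ofNat m i) ↔ n' = n ∧ j ≤ k := by
      constructor
      · rintro ⟨i, hi, rfl, rfl⟩
        refine ⟨rfl, Fin.le_def.2 ?_⟩
        rw [Fin.val_ofNat]
        exact (Nat.mod_le _ _).trans hi
      · rintro ⟨rfl, h⟩
        exact ⟨j, h, rfl, (Fin.ofNat_val_eq_self j).symm⟩
    simp only [LinkLayout.hopBits, layout, flippedBits, Sum.inl.injEq, Sum.inr.injEq,
      Prod.mk.injEq, this, Sum.elim_inl, reduceCtorEq, false_or]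
  · simp [LinkLayout.hopBits, layout]
  · simp [LinkLayout.hopBits, layout]
  · simp [LinkLayout.hopBits, layout]

theorem hopSupport_layout (n : Fin (N - 1)) (k : Fin m) : (layout n).hopSupport k =
    (ladderQubits n k).map (Function.Embedding.inr.trans Function.Embedding.inl) := by
  ext q
  rcases q with ((s | ⟨n', j⟩) | (s | ⟨n', j⟩)) | a
  · simp [LinkLayout.hopSupport, layout]
  · simp [LinkLayout.hopSupport, layout]
  · simp [LinkLayout.hopSupport, layout, ladderQubits]
  · have : (∃ i, (i < m - 1 ∧ i ≤ k) ∧ n = n' ∧ Fin.ofNat m i = j) ↔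
        n' = n ∧ j ≤ k ∧ (j : ℕ) + 1 < m := by
      constructor
      · rintro ⟨i, ⟨hi, hik⟩, rfl, rfl⟩
        have him : i % m = i := Nat.mod_eq_of_lt (by omega)
        refine ⟨rfl, Fin.le_def.2 ?_, ?_⟩ <;> rw [Fin.val_ofNat, him]
        · exact hik
        · omega
      · rintro ⟨rfl, h1, h2⟩
        exact ⟨j, ⟨by omega, h1⟩, rfl, Fin.ofNat_val_eq_self j⟩
    simp only [LinkLayout.hopSupport, layout, ladderQubits, Finset.mem_union, Finset.mem_insert,
      Finset.mem_singleton, Sum.inl.injEq, Sum.inr.injEq, reduceCtorEq, false_or, Finset.mem_image,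
      Finset.mem_filter, Finset.mem_range, Prod.mk.injEq, this, Finset.mem_map, Finset.mem_univ,
      true_and, Function.Embedding.trans_apply, Function.Embedding.inr_apply,
      Function.Embedding.inl_apply, exists_eq_right]
  · simp [LinkLayout.hopSupport, layout]

theorem evenState_layout (n : Fin (N - 1)) (k : Fin m) (b : RegQubit N m ⊕ Fin m → Fin 2) :
    evenState ((layout n).hopSupport k) ((layout n).hopBits k) b =
      ((if b ∘ Sum.inr = 0 ∧ b ∘ Sum.inl ∘ Sum.inl = flippedBits n k ∧
        (∀ q, q ∉ ladderQubits n k → b (Sum.inl (Sum.inr q)) = 0) ∧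
        ∑ q ∈ ladderQubits n k, b (Sum.inl (Sum.inr q)) = 0
        then (√2)⁻¹ ^ ((ladderQubits n k).card - 1) else 0 : ℝ) : ℂ) := by
  have h : (∀ q, q ∉ (layout n).hopSupport k → b q = (layout n).hopBits k q) ↔
      b ∘ Sum.inr = 0 ∧ b ∘ Sum.inl ∘ Sum.inl = flippedBits n k ∧
        ∀ q, q ∉ ladderQubits n k → b (Sum.inl (Sum.inr q)) = 0 := by
    rw [hopBits_layout, hopSupport_layout]
    constructor
    · intro h
      refine ⟨funext fun a => h _ (by simp), funext fun q => h _ (by simp), fun q hq => h _ ?_⟩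
      simpa using hq
    · rintro ⟨h1, h2, h3⟩ ((q | q) | a) hq
      · exact congrFun h2 q
      · exact h3 q (by simpa using hq)
      · exact congrFun h1 a
  have h2 : ∑ q ∈ (layout n).hopSupport k, b q =
      ∑ q ∈ ladderQubits n k, b (Sum.inl (Sum.inr q)) := by
    rw [hopSupport_layout, Finset.sum_map]
    rfl
  have h3 : ((layout n : LinkLayout (RegQubit N m ⊕ Fin m) m).hopSupport k).card =
      (ladderQubits n k).card := by
    rw [hopSupport_layout, Finset.card_map]
  simp only [evenState, h, h2, h3, and_assoc]
  split_ifs <;> simp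

/-- There are `2^(c-1)` even strings on `c` ladder qubits, each of weight `2^(1-c)`, so the total
weight is `|x|` for every carry length. Hence all hopping pieces form a single group. -/
theorem encodes_x (x : ℝ) (n : Fin (N - 1)) (k : Fin m) :
    Encodes ((x : ℂ) • (tensorOp (hopFactors n k) + (tensorOp (hopFactors n k)).conjTranspose)) |x|
      ((links N m).run (ket (one (Sum.inl (Sum.inl (Sum.inr (n, k))))))) := by
  have hx : (layout n : LinkLayout (RegQubit N m ⊕ Fin m) m).x k =
      Sum.inl (Sum.inl (Sum.inr (n, k))) := by
    simp [layout]
  have hrun := (layout (N := N) n).run_circuit_x k.isLt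
  rw [hx] at hrun
  have hlinks := run_links hrun (fun n' hn' => by
      refine layout_fixes fun b hb => ?_
      rw [ket, Pi.single_apply] at hb
      obtain rfl := of_not_not fun h => hb (if_neg h)
      exact ⟨rfl, fun j => ⟨one_apply_of_ne (by simp [hn']), one_apply_of_ne (by simp)⟩⟩)
    fun n' hn' => by
      refine layout_fixes fun b hb => ?_
      rw [evenState_layout] at hb
      obtain ⟨h1, h2, h3, _⟩ := of_not_not fun h => hb (by rw [if_neg h, Complex.ofReal_zero])
      refine ⟨congrFun h1 0, fun j => ⟨?_, h3 _ ?_⟩⟩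
      · have := congrFun h2 (Sum.inr (n', j))
        simpa [flippedBits, hn'] using this
      · simp [ladderQubits, hn']
  rw [hlinks]
  refine ⟨fun b => ?_, fun b hb => ?_, fun b hb => ?_⟩
  · rw [evenState_layout, Complex.norm_real, Real.norm_of_nonneg]
    split_ifs <;> positivity
  · rw [evenState_layout, if_neg fun h => hb h.1, Complex.ofReal_zero]
  · rw [evenState_layout, Complex.norm_real, pauliCoeff_smul, norm_mul, Complex.norm_real,
      norm_pauliCoeff_hopFactors, Real.norm_eq_abs]
    simp only [hb, true_and, Function.comp_apply]
    congr 1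
    split_ifs
    · have hcard : 1 ≤ (ladderQubits n k).card :=
        Finset.card_pos.2 ⟨Sum.inl (leftSite n), by simp [ladderQubits]⟩
      obtain ⟨c, hc⟩ := Nat.exists_eq_add_of_le hcard
      rw [Real.norm_of_nonneg (by positivity), ← pow_mul, mul_comm _ 2, pow_mul, inv_pow,
        Real.sq_sqrt zero_le_two, hc, Nat.add_sub_cancel_left, pow_add]
      ring
    · simp

/-- The sum of the absolute values of the Pauli coefficients of `leafOp μ x q`. -/
def leafWeight (μ x : ℝ) : RegQubit N m → ℝ
  | Sum.inl (Sum.inl _) => 0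
  | Sum.inl (Sum.inr _) => |x|
  | Sum.inr (Sum.inl _) => |μ| / 2
  | Sum.inr (Sum.inr (_, k)) => 4 ^ (k : ℕ) / 2

theorem links_run_ket {b : RegQubit N m ⊕ Fin m → Fin 2} (hr : b (Sum.inr 0) = 0)
    (h : ∀ n j, b (Sum.inl (Sum.inl (Sum.inr (n, j)))) = 0 ∧
      b (Sum.inl (Sum.inr (Sum.inr (n, j)))) = 0) : (links N m).run (ket b) = ket b :=
  run_links_of_forall fun n => (layout n).run_circuit_of_zero hr (fun _ => (h n _).1)
    fun _ => (h n _).2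

theorem encodes_leafOp (μ x : ℝ) (q : RegQubit N m) :
    Encodes (leafOp μ x q) (leafWeight μ x q) ((links N m).run (ket (one (Sum.inl q)))) := by
  rcases q with (s | ⟨n, k⟩) | (s | ⟨n, k⟩)
  · rw [links_run_ket (one_apply_of_ne (by simp)) fun n j =>
      ⟨one_apply_of_ne (by simp), one_apply_of_ne (by simp)⟩, one_inl_inl]
    apply encodes_ket
    intro x z
    simp [leafOp, leafWeight, pauliCoeff_zero]
  · exact encodes_x x n k
  · rw [links_run_ket (one_apply_of_ne (by simp)) fun n j =>
      ⟨one_apply_of_ne (by simp), one_apply_of_ne (by simp)⟩, one_inl_inr]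
    apply encodes_ket
    intro x z
    rw [leafOp, leafWeight, pauliCoeff_smul, pauliCoeff_pauliString]
    split_ifs <;> simp
  · exact encodes_z n k

theorem encodes_one (c : ℝ) : Encodes ((c : ℂ) • (1 : Op (SysQubit N m))) |c|
    ((links N m).run (ket 0)) := by
  rw [links_run_ket rfl fun n j => ⟨rfl, rfl⟩,
    show (0 : RegQubit N m ⊕ Fin m → Fin 2) = xzBits (Fin m) 0 0 from
      eq_xzBits_iff.2 ⟨rfl, rfl, rfl⟩]
  apply encodes_ket
  intro x z
  rw [pauliCoeff_smul, ← pauliString_zero_zero, pauliCoeff_pauliString]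
  split_ifs <;> simp

theorem leafWeight_nonneg (μ x : ℝ) (q : RegQubit N m) : 0 ≤ leafWeight μ x q := by
  rcases q with (s | ⟨n, k⟩) | (s | ⟨n, k⟩) <;> rw [leafWeight] <;> positivity

/-- This turns a nonzero Hamiltonian into a positive total weight, so that one may divide by it. -/
theorem leafOp_eq_zero {μ x : ℝ} {q : RegQubit N m} (h : leafWeight μ x q = 0) :
    leafOp μ x q = 0 := by
  rcases q with (s | ⟨n, k⟩) | (s | ⟨n, k⟩)
  · rfl
  · rw [leafWeight, abs_eq_zero] at h
    simp [leafOp, h]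
  · rw [leafWeight] at h
    have : μ = 0 := by simpa using h
    simp [leafOp, this]
  · rw [leafWeight] at h
    simp at h

end Hopping

/-! ### Assembly of the full circuit -/

section Assembly

variable {N m : ℕ}

/-- The register qubits that are excited with equal amplitudes. -/
def groups (N m : ℕ) : List (List (RegQubit N m ⊕ Fin m)) :=
  ((List.finRange (N - 1) ×ˢ List.finRange m).map fun p => Sum.inl (Sum.inl (Sum.inr p))) ::
    (((List.finRange m).map fun k =>
      (List.finRange (N - 1)).map fun n => Sum.inl (Sum.inr (Sum.inr (n, k)))) ++
    [(List.finRange N).map fun n => Sum.inl (Sum.inr (Sum.inl n))])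

theorem groups_flatten : (groups N m).flatten =
    ((List.finRange (N - 1) ×ˢ List.finRange m).map fun p => Sum.inl (Sum.inl (Sum.inr p))) ++
      (((List.finRange m).flatMap fun k =>
        (List.finRange (N - 1)).map fun n => Sum.inl (Sum.inr (Sum.inr (n, k)))) ++
      (List.finRange N).map fun n => Sum.inl (Sum.inr (Sum.inl n))) := by
  simp [groups, List.flatMap]

theorem nodup_groups : (groups N m).flatten.Nodup := by
  rw [groups_flatten, List.nodup_append', List.nodup_append', List.nodup_flatMap]
  refine ⟨?_, ⟨⟨fun k _ => ?_, ?_⟩, ?_, ?_⟩, ?_⟩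
  · refine ((List.nodup_finRange _).product (List.nodup_finRange _)).map fun p q h => ?_
    simpa using h
  · refine (List.nodup_finRange _).map fun p q h => ?_
    simpa using h
  · refine (List.nodup_finRange m).imp fun {k k'} hk => ?_
    intro q h1 h2
    simp only [List.mem_map, List.mem_finRange, true_and] at h1 h2
    obtain ⟨n, rfl⟩ := h1
    obtain ⟨n', h⟩ := h2
    simp only [Sum.inl.injEq, Sum.inr.injEq, Prod.mk.injEq] at h
    exact hk h.2.symm
  · refine (List.nodup_finRange _).map fun p q h => ?_
    simpa using h
  · intro q h1 h2
    simp only [List.mem_flatMap, List.mem_map, List.mem_finRange, true_and] at h1 h2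
    obtain ⟨k, n, rfl⟩ := h1
    simp at h2
  · intro q h1 h2
    simp only [List.mem_append, List.mem_flatMap, List.mem_map, List.mem_finRange, true_and] at h1 h2
    obtain ⟨p, _, rfl⟩ := h1
    simp at h2

theorem length_groups : (groups N m).flatten.length = 2 * (m * (N - 1)) + N := by
  rw [groups_flatten]
  simp only [List.length_append, List.length_map, List.length_product, List.length_finRange,
    List.length_flatMap, List.map_const', List.sum_replicate, smul_eq_mul]
  ring

theorem sum_size_groups : ((groups N m).map fun l => 2 * Nat.size l.length).sum =
    2 * Nat.size (m * (N - 1)) + (2 * (m * Nat.size (N - 1)) + 2 * Nat.size N) := by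
  simp only [groups, List.map_cons, List.map_append, List.map_map, List.sum_cons, List.sum_append,
    List.length_map, List.length_product, List.length_finRange, Function.comp_def, List.map_const',
    List.sum_replicate, smul_eq_mul, List.map_nil, List.sum_nil]
  rw [mul_comm (N - 1) m]
  ring

theorem counts_links [NeZero m] : (links N m).numT ≤ 4 * m * (N - 1) ∧ (links N m).numRz = 0 ∧
    (links N m).numCNOT ≤ (7 * m + 1) * (N - 1) := by
  have hm : 1 ≤ m := Nat.one_le_iff_ne_zero.2 (NeZero.ne m)
  have h : ∀ l : List (Fin (N - 1)),
      Circuit.numT (l.flatMap fun n => (layout (m := m) n).circuit) ≤ 4 * m * l.length ∧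
      Circuit.numRz (l.flatMap fun n => (layout (m := m) n).circuit) = 0 ∧
      Circuit.numCNOT (l.flatMap fun n => (layout (m := m) n).circuit) ≤ (7 * m + 1) * l.length := by
    intro l
    induction l with
    | nil => simp [Circuit.numT, Circuit.numRz, Circuit.numCNOT]
    | cons n l ih =>
      have h := (layout (m := m) n).counts_circuit hm
      simp only [List.flatMap_cons, Circuit.numT_append, Circuit.numRz_append,
        Circuit.numCNOT_append, List.length_cons, mul_add, mul_one]
      omega
  have h := h (List.finRange (N - 1))
  rw [List.length_finRange] at h
  exact h

/-- The amplitudes of the one-hot state, squared. -/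
def excitation (μ x S : ℝ) : RegQubit N m ⊕ Fin m → ℝ
  | Sum.inl q => leafWeight μ x q / S
  | Sum.inr _ => 0

theorem exists_prepares [NeZero m] {μ x : ℝ} (hH : hamiltonian N m μ x ≠ 0) :
    ∃ C : Circuit (RegQubit N m ⊕ Fin m), Prepares C (lcuState (hamiltonian N m μ x)) ∧
      C.numT ≤ 8 * m * (N - 1) + 2 * N ∧ C.numCNOT ≤ 11 * m * (N - 1) + 3 * N ∧
      C.numRz ≤ 1 + 2 * Nat.size (m * (N - 1)) + 2 * m * Nat.size (N - 1) + 2 * Nat.size N := by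
  -- The index `none` stands for the identity part, encoded by the zero string.
  let O : Option (RegQubit N m) → Op (SysQubit N m) := fun a =>
    a.elim ((idCoeff N m μ : ℂ) • 1) (leafOp μ x)
  let W : Option (RegQubit N m) → ℝ := fun a => a.elim |idCoeff N m μ| (leafWeight μ x)
  let bits : Option (RegQubit N m) → RegQubit N m ⊕ Fin m → Fin 2 := fun a =>
    a.elim 0 fun q => one (Sum.inl q)
  let Φ := fun a => (links N m).run (ket (bits a))
  have hO : hamiltonian N m μ x = ∑ a, O a := by
    rw [Fintype.sum_option, hamiltonian_eq_sum]
    rfl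
  have hW : ∀ a, 0 ≤ W a := by
    rintro (_ | q)
    · exact abs_nonneg _
    · exact leafWeight_nonneg μ x q
  have hΦ : ∀ a, Encodes (O a) (W a) (Φ a) := by
    rintro (_ | q)
    · exact encodes_one _
    · exact encodes_leafOp μ x q
  have hbits : Function.Injective bits := by
    rintro (_ | q) (_ | q') h
    · rfl
    · have := congrFun h (Sum.inl q')
      simp [bits] at this
    · have := congrFun h (Sum.inl q)
      simp [bits] at this
    · by_contra hne
      have hqq : q ≠ q' := fun h => hne (congrArg some h)
      have := congrFun h (Sum.inl q)
      simp [bits, hqq] at this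
  -- Distinct basis strings are orthogonal, and so are their images under `links`.
  have hdisj : ∀ a a', a ≠ a' → ∀ b, Φ a b = 0 ∨ Φ a' b = 0 := fun a a' ha =>
    disjoint_of_orthogonal (hΦ a).nonneg (hΦ a').nonneg (by
      rw [Circuit.run_isometry]
      simp [ket, hbits.ne ha])
  have hS : 0 < ∑ a, W a := by
    refine (Finset.sum_nonneg fun a _ => hW a).lt_of_ne' fun h => hH ?_
    have h0 := (Finset.sum_eq_zero_iff_of_nonneg fun a _ => hW a).1 h
    rw [hO]
    refine Finset.sum_eq_zero ?_
    rintro (_ | q) _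
    · have : idCoeff N m μ = 0 := abs_eq_zero.1 (h0 none (Finset.mem_univ _))
      simp [O, this]
    · exact leafOp_eq_zero (h0 (some q) (Finset.mem_univ _))
  set S := ∑ a, W a with hSdef
  have hsum : |idCoeff N m μ| / S + ∑ q : RegQubit N m ⊕ Fin m, excitation μ x S q = 1 := by
    have h1 : ∑ q : RegQubit N m ⊕ Fin m, excitation μ x S q =
        (∑ q : RegQubit N m, leafWeight μ x q) / S := by
      rw [Fintype.sum_sum_type, Finset.sum_div]
      simp [excitation]
    rw [h1, ← add_div, div_eq_one_iff_eq hS.ne', hSdef, Fintype.sum_option]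
    rfl
  -- The ancilla `0` is the reservoir here; once emptied, it serves as scratch qubit for all links.
  obtain ⟨C, hT, hC, hRz, hrun⟩ := exists_prepare_oneHot (Sum.inr 0)
    (excitation μ x S : RegQubit N m ⊕ Fin m → ℝ) (by
      rintro (q | a)
      · exact div_nonneg (leafWeight_nonneg μ x q) hS.le
      · exact le_rfl)
    (groups N m) nodup_groups (by simp [groups_flatten]) (by
      rintro (((s | ⟨n, k⟩) | (s | ⟨n, k⟩)) | a) hq
      · simp [excitation, leafWeight]
      · simp [groups_flatten] at hq
      · simp [groups_flatten] at hq
      · simp [groups_flatten] at hq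
      · rfl) (by
      intro l hl q hq q' hq'
      simp only [groups, List.mem_cons, List.mem_append, List.mem_map, List.mem_finRange, true_and,
        List.not_mem_nil, or_false] at hl
      rcases hl with rfl | ⟨k, rfl⟩ | rfl <;> rw [List.mem_map] at hq hq' <;>
        obtain ⟨p, _, rfl⟩ := hq <;> obtain ⟨p', _, rfl⟩ := hq' <;> rfl)
    (div_nonneg (abs_nonneg (idCoeff N m μ)) hS.le) hsum
  have hsup : (C ++ links N m).run (ket 0) = ∑ a, (√(W a / S) : ℂ) • Φ a := by
    rw [Circuit.run_append, hrun, oneHot, Circuit.run_add, Circuit.run_sum, Fintype.sum_sum_type,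
      Fintype.sum_option]
    simp only [Circuit.run_smul]
    have : ∀ a : Fin m, ((√(excitation μ x S (Sum.inr a : RegQubit N m ⊕ Fin m)) : ℝ) : ℂ) = 0 := by
      intro a
      simp [excitation]
    simp only [this, zero_smul, Finset.sum_const_zero, add_zero]
    rfl
  have hL := counts_links (N := N) (m := m)
  rw [length_groups] at hT hC
  rw [sum_size_groups] at hRz
  refine ⟨C ++ links N m, ?_, ?_, ?_, ?_⟩
  · have h0 : zeroState (RegQubit N m ⊕ Fin m) = ket 0 := by
      ext b
      rw [zeroState, ket, Pi.single_apply]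
    rw [Prepares, h0, hsup, hO]
    refine superposition_eq_lcuState hS hW hΦ hdisj ?_
    rw [← hsup, Circuit.run_isometry]
    simp
  · rw [Circuit.numT_append]
    linarith [hL.1]
  · rw [Circuit.numCNOT_append]
    have h1 : N - 1 ≤ N := Nat.sub_le _ _
    linarith [hL.2.2]
  · rw [Circuit.numRz_append, hL.2.1]
    linarith

end Assembly

/-! ### Comparison with the stated bounds -/

section Numerics

theorem binet_eq_fib (k : ℕ) : binet k = Nat.fib k := by
  rw [binet, Real.coe_fib_eq, zpow_neg, zpow_natCast, ← inv_pow, inv_neg, Real.inv_goldenRatio,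
    neg_neg]

theorem size_le_self (a : ℕ) : Nat.size a ≤ a := Nat.size_le.2 a.lt_two_pow_self

theorem size_mul_le (a b : ℕ) : Nat.size (a * b) ≤ Nat.size a + Nat.size b := by
  rw [Nat.size_le, pow_add]
  exact Nat.mul_lt_mul'' (Nat.lt_size_self a) (Nat.lt_size_self b)

theorem two_pow_size_le (a : ℕ) : 2 ^ Nat.size a ≤ 2 * a + 1 := by
  rcases h : Nat.size a with _ | s
  · simp
  · have : 2 ^ s ≤ a := Nat.lt_size.1 (by omega)
    rw [pow_succ]
    omega

theorem sq_le_two_mul_two_pow (s : ℕ) : s ^ 2 ≤ 2 * 2 ^ s := by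
  rcases lt_or_ge s 3 with h | h
  · interval_cases s <;> norm_num
  · induction s, h using Nat.le_induction with
    | base => norm_num
    | succ s hs ih => rw [pow_succ 2]; nlinarith

theorem quadratic_le_two_pow (m : ℕ) : m ^ 2 + 6 * m + 5 ≤ 12 * 2 ^ m := by
  induction m with
  | zero => norm_num
  | succ m ih =>
    rcases Nat.eq_zero_or_pos m with rfl | h
    · norm_num
    · rw [pow_succ 2]; nlinarith

/-- A crude bound for the number of rotations. -/
theorem rotations_le (N m : ℕ) :
    1 + 2 * Nat.size (m * (N - 1)) + 2 * m * Nat.size (N - 1) + 2 * Nat.size N ≤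
      1 + 2 * m + (2 * m + 4) * Nat.size N := by
  have h1 : Nat.size (N - 1) ≤ Nat.size N := Nat.size_le_size (Nat.sub_le _ _)
  have h2 := size_mul_le m (N - 1)
  have h3 := size_le_self m
  have h4 := Nat.mul_le_mul_left (2 * m) h1
  nlinarith

theorem fib_bounds {m : ℕ} (hm : 2 ≤ m) :
    13 ≤ Nat.fib (m + 5) ∧ Nat.fib (m + 6) ≤ 2 * Nat.fib (m + 5) := by
  have h1 : Nat.fib 7 ≤ Nat.fib (m + 5) := Nat.fib_mono (by omega)
  have h2 : Nat.fib (m + 6) = Nat.fib (m + 4) + Nat.fib (m + 5) := Nat.fib_add_two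
  have h3 : Nat.fib (m + 4) ≤ Nat.fib (m + 5) := Nat.fib_mono (by omega)
  exact ⟨h1, by omega⟩

/-- For `m ≥ 4` the exponential terms combine to `4 (m - 4) 2^m ≥ 0`, and the Fibonacci terms are at
least `8 (m - 2) F_{m+5}`. The cases `m = 2, 3`, where `m - 4` is negative, are evaluated directly.
-/
theorem numT_bound {N m : ℕ} (hm : 2 ≤ m) (hN : 1 ≤ N) : ((8 * m * (N - 1) + 2 * N : ℕ) : ℝ) ≤
    56 - 16 * m + 8 * m * binet (m + 5) - 8 * binet (m + 6) - 16 * 2 ^ m + 4 * N + 4 * m * 2 ^ m +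
      8 * N * m := by
  rw [binet_eq_fib, binet_eq_fib]
  push_cast [hN]
  have hN' : (1 : ℝ) ≤ N := by exact_mod_cast hN
  rcases eq_or_lt_of_le hm with rfl | h
  · norm_num [Nat.fib_add_two]
    linarith
  · rcases eq_or_lt_of_le (Nat.succ_le_of_lt h) with rfl | h4
    · norm_num [Nat.fib_add_two]
      linarith
    · obtain ⟨h1, h2⟩ := fib_bounds hm
      have h1' : (13 : ℝ) ≤ Nat.fib (m + 5) := by exact_mod_cast h1
      have h2' : (Nat.fib (m + 6) : ℝ) ≤ 2 * Nat.fib (m + 5) := by exact_mod_cast h2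
      have h4' : (4 : ℝ) ≤ m := by exact_mod_cast h4
      have h5 : 0 ≤ ((m : ℝ) - 4) * 2 ^ m := mul_nonneg (by linarith) (by positivity)
      have h6 : 0 ≤ ((m : ℝ) - 2) * (Nat.fib (m + 5) - 13) := mul_nonneg (by linarith) (by linarith)
      nlinarith

theorem numCNOT_bound {N m : ℕ} (hm : 2 ≤ m) (hN : 1 ≤ N) :
    ((11 * m * (N - 1) + 3 * N : ℕ) : ℝ) ≤
      54 - 22 * m - 2 * binet (m + 5) - 8 * binet (m + 6) + 8 * m * binet (m + 5) - 14 * 2 ^ m +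
        25 * N + 4 * m * 2 ^ m + 11 * N * m := by
  rw [binet_eq_fib, binet_eq_fib]
  push_cast [hN]
  have hN' : (1 : ℝ) ≤ N := by exact_mod_cast hN
  rcases eq_or_lt_of_le hm with rfl | h
  · norm_num [Nat.fib_add_two]
    linarith
  · rcases eq_or_lt_of_le (Nat.succ_le_of_lt h) with rfl | h4
    · norm_num [Nat.fib_add_two]
      linarith
    · obtain ⟨h1, h2⟩ := fib_bounds hm
      have h1' : (13 : ℝ) ≤ Nat.fib (m + 5) := by exact_mod_cast h1
      have h2' : (Nat.fib (m + 6) : ℝ) ≤ 2 * Nat.fib (m + 5) := by exact_mod_cast h2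
      have h4' : (4 : ℝ) ≤ m := by exact_mod_cast h4
      have h5 : 0 ≤ ((m : ℝ) - 4) * 2 ^ m := mul_nonneg (by linarith) (by positivity)
      have h6 : 0 ≤ ((m : ℝ) - 4) * (Nat.fib (m + 5) - 13) := mul_nonneg (by linarith) (by linarith)
      have h7 : (0 : ℝ) < 2 ^ m := by positivity
      nlinarith

theorem numRz_bound {N m : ℕ} (hm : 2 ≤ m) :
    ((1 + 2 * Nat.size (m * (N - 1)) + 2 * m * Nat.size (N - 1) + 2 * Nat.size N : ℕ) : ℝ) ≤
      -48 + 12 * binet (m + 5) + 12 * 2 ^ m + 6 * N := by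
  have h1 : 1 + 2 * Nat.size (m * (N - 1)) + 2 * m * Nat.size (N - 1) + 2 * Nat.size N + 48 ≤
      12 * Nat.fib (m + 5) + 12 * 2 ^ m + 6 * N := by
    refine (Nat.add_le_add_right (rotations_le N m) 48).trans ?_
    have h2 := (fib_bounds hm).1
    have h3 := two_pow_size_le N
    have h4 := sq_le_two_mul_two_pow (Nat.size N)
    have h5 := quadratic_le_two_pow m
    -- The mixed term `2 (m + 2) s` with `s = Nat.size N` is split into `(m + 2)²`, absorbed by `12
    -- * 2 ^ m`, and `s² ≤ 2 * 2 ^ s ≤ 4N + 2`, absorbed by `6 * N` and the Fibonacci term.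
    have h6 := two_mul_le_add_sq (m + 2) (Nat.size N)
    nlinarith
  rw [binet_eq_fib]
  have : ((1 + 2 * Nat.size (m * (N - 1)) + 2 * m * Nat.size (N - 1) + 2 * Nat.size N : ℕ) : ℝ) + 48
      ≤ 12 * Nat.fib (m + 5) + 12 * 2 ^ m + 6 * N := by exact_mod_cast h1
  linarith

theorem total_bound {N m : ℕ} (hm : 2 ≤ m) (h : m ≤ ⌈Real.logb 2 N + 1⌉₊) :
    ((8 * m * (N - 1) + 2 * N + (11 * m * (N - 1) + 3 * N) +
      (1 + 2 * Nat.size (m * (N - 1)) + 2 * m * Nat.size (N - 1) + 2 * Nat.size N) : ℕ) : ℝ) ≤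
        84 / Real.log 2 * (N * Real.log N) := by
  -- For `N ≤ 1` the ceiling equals `1`, which contradicts `2 ≤ m`.
  have hN : 2 ≤ N := by
    by_contra hN
    have : ⌈Real.logb 2 N + 1⌉₊ = 1 := by
      have : N = 0 ∨ N = 1 := by omega
      rcases this with rfl | rfl <;> simp
    omega
  have hN' : (2 : ℝ) ≤ N := by exact_mod_cast hN
  have hlog : 1 ≤ Real.logb 2 N := by
    rw [Real.le_logb_iff_rpow_le one_lt_two (by linarith)]
    simpa using hN'
  -- The ceiling is below `logb 2 N + 2`, and `logb 2 N ≥ 1`; with the total `28 m N` this gives the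
  -- constant `84 = 28 * 3`.
  have hm' : (m : ℝ) ≤ 3 * Real.logb 2 N := by
    have h1 : (m : ℝ) ≤ (⌈Real.logb 2 N + 1⌉₊ : ℝ) := by exact_mod_cast h
    have h2 := Nat.ceil_lt_add_one (show 0 ≤ Real.logb 2 N + 1 by linarith)
    linarith
  have h1 : 8 * m * (N - 1) + 2 * N + (11 * m * (N - 1) + 3 * N) +
      (1 + 2 * Nat.size (m * (N - 1)) + 2 * m * Nat.size (N - 1) + 2 * Nat.size N) ≤
        28 * (m * N) := by
    refine (Nat.add_le_add_left (rotations_le N m) _).trans ?_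
    have h2 := Nat.mul_le_mul_left (2 * m + 4) (size_le_self N)
    have h3 := Nat.mul_le_mul_left m (Nat.sub_le N 1)
    nlinarith
  calc _ ≤ ((28 * (m * N) : ℕ) : ℝ) := by exact_mod_cast h1
    _ = 28 * N * m := by push_cast; ring
    _ ≤ 28 * N * (3 * Real.logb 2 N) := by gcongr
    _ = 84 / Real.log 2 * (N * Real.log N) := by rw [Real.logb]; ring

end Numerics

end Schwinger
end

theorem mainTheorem1 :
    ∃ K : ℝ, ∀ (N m : ℕ) (μ x : ℝ), 2 ≤ m → Schwinger.hamiltonian N m μ x ≠ 0 →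
      Fintype.card (Schwinger.RegQubit N m) = 2 * N + 2 * m * (N - 1) ∧
      ∃ C : Schwinger.Circuit (Schwinger.RegQubit N m ⊕ Fin m),
        Schwinger.Prepares C (Schwinger.lcuState (Schwinger.hamiltonian N m μ x)) ∧
        (C.numT : ℝ) ≤ 56 - 16 * m + 8 * m * Schwinger.binet (m + 5)
          - 8 * Schwinger.binet (m + 6) - 16 * 2 ^ m + 4 * N + 4 * m * 2 ^ m + 8 * N * m ∧
        (C.numCNOT : ℝ) ≤ 54 - 22 * m - 2 * Schwinger.binet (m + 5)
          - 8 * Schwinger.binet (m + 6) + 8 * m * Schwinger.binet (m + 5)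
          - 14 * 2 ^ m + 25 * N + 4 * m * 2 ^ m + 11 * N * m ∧
        (C.numRz : ℝ) ≤ -48 + 12 * Schwinger.binet (m + 5) + 12 * 2 ^ m + 6 * N ∧
        (m ≤ ⌈Real.logb 2 N + 1⌉₊ →
          (C.numT : ℝ) + C.numCNOT + C.numRz ≤ K * (N * Real.log N)) := by
  refine ⟨84 / Real.log 2, fun N m μ x hm hH => ⟨?_, ?_⟩⟩
  · simp only [Fintype.card_sum, Fintype.card_prod, Fintype.card_fin]
    ring
  · have : NeZero m := ⟨by omega⟩
    -- Without sites all sums are empty and the Hamiltonian vanishes.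
    have hN : 1 ≤ N := by
      by_contra hN
      obtain rfl : N = 0 := by omega
      exact hH (by simp [Schwinger.hamiltonian, Schwinger.freeHamiltonian, Schwinger.interaction])
    obtain ⟨C, hC, hT, hCNOT, hRz⟩ := Schwinger.exists_prepares hH
    refine ⟨C, hC, ?_, ?_, ?_, fun h => ?_⟩
    · exact (Nat.cast_le.2 hT).trans (Schwinger.numT_bound hm hN)
    · exact (Nat.cast_le.2 hCNOT).trans (Schwinger.numCNOT_bound hm hN)
    · exact (Nat.cast_le.2 hRz).trans (Schwinger.numRz_bound hm)
    · refine le_trans ?_ (Schwinger.total_bound hm h)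
      exact_mod_cast Nat.add_le_add (Nat.add_le_add hT hCNOT) hRz
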